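/- **Setting.** Let $f(z,\theta)$, $\theta\in\Theta\subset\mathbb R$, be positive probability densities with respect to a measure $\nu$ on a measurable space, and let $Z_1,Z_2,\dots$ be i.i.d. with density $f(\cdot,\theta_0)$. Expectations without further mention are under this law. Assume: 1. $\Theta$ is compact, $\theta_0\in\operatorname{int}\Theta$, and $\theta\mapsto\log f(z,\theta)$ is $7$ times continuously differentiable on $\Theta$ for each $z$; 2. there are a function $B$ and a $Q>16$ with $|\partial_\theta^k\log f(z,\theta)|\le B(z)$ for all $z$, all $\theta\in\Theta$ and $0\le k\le 7$, and $E[B(Z_i)^Q]<\infty$; the functions $\partial_\theta^k\log f(\cdot,\theta)$ are measurable; 3. if $\theta\in\Theta$, $\theta\ne\theta_0$, then $f(Z_i,\theta)$ and $f(Z_i,\theta_0)$ are not almost surely equal; 4. $\mathcal I:=-E[\ell^\theta(Z_i,\theta_0)]>0$, and $|\partial_\theta^2f(z,\theta)|\le H(z)$ for all $z$ and all $\theta$ in a neighbourhood of $\theta_0$, for some $\nu$-integrable $H$. Here $\ell=\partial_\theta\log f$, $\ell^\theta=\partial^2_\theta\log f$, $\ell^{\theta\theta}=\partial^3_\theta\log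 f$, $\ell^{\theta\theta\theta}=\partial^4_\theta\log f$. With all functions evaluated at $\theta_0$, put $\mathcal Q_1=E[\ell^{\theta\theta}]$, $\mathcal Q_2=E[\ell^{\theta\theta\theta}]$, $U_i=\ell(Z_i)$, $V_i=\ell^\theta(Z_i)-E[\ell^\theta]$, $W_i=\ell^{\theta\theta}(Z_i)-E[\ell^{\theta\theta}]$, $$X_i=\mathcal I^{-1}U_i,\qquad Y_i=\tfrac12\mathcal I^{-2}\mathcal Q_1U_i+\mathcal I^{-1}V_i,\qquad \Upsilon=E[X_i^2]E[Y_i^2]+E[X_iY_i]^2,$$ $$b_0=\frac{E[\ell^{\theta\theta}]E[\ell^2]}{2\mathcal I^{3}}+\frac{E[\ell\ell^\theta]}{\mathcal I^{2}} .$$ For a finite set $s$ of indices let $U=|s|^{-1/2}\sum_{i\in s}U_i$, and likewise $V,W$, and $$A_1=\mathcal I^{-1}U,\qquad A_2=\tfrac12\mathcal I^{-3}\mathcal Q_1U^2+\mathcal I^{-2}UV,$$ $$A_3=\tfrac16\mathcal I^{-4}\mathcal Q_2U^3+\tfrac12\mathcal I^{-5}\mathcal Q_1^2U^3+\tfrac32\mathcal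 I^{-4}\mathcal Q_1U^2V+\tfrac12\mathcal I^{-3}U^2W+\mathcal I^{-3}UV^2 .$$ Without superscript they are taken over the whole sample $\{1,\dots,n\}$; for $n=2m$ the superscripts $(1),(2)$ denote the halves $\{1,\dots,m\}$ and $\{m+1,\dots,2m\}$. Let $\hat\theta$, $\hat\theta_{(1)}$, $\hat\theta_{(2)}$ be maximum likelihood estimators (maximizers over $\Theta$ of the log likelihood) based on the whole sample and on its halves, and put $$\hat\theta_{SS}=2\hat\theta-\tfrac12(\hat\theta_{(1)}+\hat\theta_{(2)}),\qquad \tfrac1n\hat b_{SS}=\tfrac12(\hat\theta_{(1)}+\hat\theta_{(2)})-\hat\theta .$$ Let $X_{(1)}=m^{-1/2}\sum_{i\le m}X_i$, $X_{(2)}=m^{-1/2}\sum_{m<i\le 2m}X_i$, and similarly $Y_{(1)},Y_{(2)}$. **Proposition.** As $n\to\infty$, $\sqrt n(\hat\theta-\theta_0)=A_1+n^{-1/2}A_2+n^{-1}A_3+o_p(n^{-1})$, and $b_0=E[A_2]$ for every $n\ge1$. Moreover, as $n=2m\to\infty$: (a) the bias estimate satisfies $$\hat b_{SS}-b_0=\tfrac12\Big(X_{(1)}Y_{(1)}+X_{(2)}Y_{(2)}-2b_0-\big(X_{(1)}Y_{(2)}+X_{(2)}Y_{(1)}\big)\Big)+o_p(1)=O_p(1),$$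 and if $\Upsilon>0$ then $\hat b_{SS}$ is not consistent: it does not converge to $b_0$ in probability; (b) $\sqrt n(\hat\theta_{SS}-\theta_0)=A_1+n^{-1/2}\tilde A_2+n^{-1}\tilde A_3+o_p(n^{-1})$ with $\tilde A_2=2A_2-(A_2^{(1)}+A_2^{(2)})$ and $\tilde A_3=2A_3-\sqrt2\,(A_3^{(1)}+A_3^{(2)})$; the variables $A_1,\tilde A_2,\tilde A_3$ are square integrable, $\operatorname{Var}(A_1)=\mathcal I^{-1}$, and with $\tilde\upsilon_{SS}=\operatorname{Var}(\tilde A_2)+2\sqrt n\,E[A_1\tilde A_2]+2E[A_1\tilde A_3]$ the higher-order variance of $\hat\theta_{SS}$ is $$\operatorname{Var}(A_1)+\frac{\tilde\upsilon_{SS}}n=\mathcal I^{-1}+\frac2n\Upsilon+O(n^{-2}).$$ -/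

import Mathlib

open MeasureTheory ProbabilityTheory Filter Topology

noncomputable section

/-- A one-parameter family of densities `f(z, θ)`, `θ ∈ Θ ⊆ ℝ`, with respect to a dominating
measure `ν` on the sample space, together with the true parameter value `θ₀`. -/
structure ParametricModel (𝒵 : Type*) [MeasurableSpace 𝒵] where
  ν : Measure 𝒵
  f : 𝒵 → ℝ → ℝ
  Θ : Set ℝ
  θ₀ : ℝ

namespace ParametricModel

variable {𝒵 Ω : Type*} [MeasurableSpace 𝒵] [MeasurableSpace Ω]

/-- The distribution with density `f(·, θ₀)`. -/
def law (M : ParametricModel 𝒵) : Measure 𝒵 :=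
  M.ν.withDensity (fun z => ENNReal.ofReal (M.f z M.θ₀))

/-- `∂ᵏ log f(z, θ) / ∂θᵏ` on the parameter space; at interior points of `Θ`, such as `θ₀`,
this is the ordinary `k`-th derivative. -/
def dlog (M : ParametricModel 𝒵) (k : ℕ) (z : 𝒵) (θ : ℝ) : ℝ :=
  iteratedDerivWithin k (fun t => Real.log (M.f z t)) M.Θ θ

/-- The information `𝓘 = -E[ℓ^θ(Z, θ₀)]`. -/
def info (M : ParametricModel 𝒵) : ℝ := -∫ z, M.dlog 2 z M.θ₀ ∂M.law

/-- `𝒬₁ = E[ℓ^θθ(Z, θ₀)]`. -/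
def Q₁ (M : ParametricModel 𝒵) : ℝ := ∫ z, M.dlog 3 z M.θ₀ ∂M.law

/-- `𝒬₂ = E[ℓ^θθθ(Z, θ₀)]`. -/
def Q₂ (M : ParametricModel 𝒵) : ℝ := ∫ z, M.dlog 4 z M.θ₀ ∂M.law

/-- The score `ℓ(z, θ₀)`. -/
def U (M : ParametricModel 𝒵) (z : 𝒵) : ℝ := M.dlog 1 z M.θ₀

/-- `ℓ^θ(z, θ₀)`, centred. -/
def V (M : ParametricModel 𝒵) (z : 𝒵) : ℝ :=
  M.dlog 2 z M.θ₀ - ∫ z', M.dlog 2 z' M.θ₀ ∂M.law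

/-- `ℓ^θθ(z, θ₀)`, centred. -/
def W (M : ParametricModel 𝒵) (z : 𝒵) : ℝ :=
  M.dlog 3 z M.θ₀ - ∫ z', M.dlog 3 z' M.θ₀ ∂M.law

/-- `X = 𝓘⁻¹ U`. -/
def X (M : ParametricModel 𝒵) (z : 𝒵) : ℝ := M.info⁻¹ * M.U z

/-- `Y = ½ 𝓘⁻² 𝒬₁ U + 𝓘⁻¹ V`. -/
def Y (M : ParametricModel 𝒵) (z : 𝒵) : ℝ :=
  1 / 2 * M.info⁻¹ ^ 2 * M.Q₁ * M.U z + M.info⁻¹ * M.V z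

/-- `Υ = E[X²] E[Y²] + E[X Y]²`. -/
def Upsilon (M : ParametricModel 𝒵) : ℝ :=
  (∫ z, M.X z ^ 2 ∂M.law) * (∫ z, M.Y z ^ 2 ∂M.law) + (∫ z, M.X z * M.Y z ∂M.law) ^ 2

/-- The higher-order bias `b₀ = 𝒬₁ E[ℓ²] / (2 𝓘³) + E[ℓ ℓ^θ] / 𝓘²`. -/
def b₀ (M : ParametricModel 𝒵) : ℝ :=
  M.Q₁ * (∫ z, M.dlog 1 z M.θ₀ ^ 2 ∂M.law) / (2 * M.info ^ 3)
    + (∫ z, M.dlog 1 z M.θ₀ * M.dlog 2 z M.θ₀ ∂M.law) / M.info ^ 2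

/-- The regularity conditions of the maximum likelihood model. -/
structure Regular (M : ParametricModel 𝒵) : Prop where
  /-- Each `f(·, θ)`, `θ ∈ Θ`, is a positive probability density. -/
  measurable_density : ∀ θ ∈ M.Θ, Measurable (fun z => M.f z θ)
  density_pos : ∀ z, ∀ θ ∈ M.Θ, 0 < M.f z θ
  lintegral_density : ∀ θ ∈ M.Θ, ∫⁻ z, ENNReal.ofReal (M.f z θ) ∂M.ν = 1
  /-- The log density is seven times continuously differentiable in the parameter. -/
  contDiffOn_log : ∀ z, ContDiffOn ℝ 7 (fun θ => Real.log (M.f z θ)) M.Θ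
  isCompact : IsCompact M.Θ
  mem_interior : M.θ₀ ∈ interior M.Θ
  /-- An envelope for the log density and its derivatives, with more than sixteen moments. -/
  envelope : ∃ B : 𝒵 → ℝ,
    (∀ z, ∀ θ ∈ M.Θ, ∀ k ≤ 7, |M.dlog k z θ| ≤ B z) ∧
      ∃ Q : ℝ, 16 < Q ∧ Integrable (fun z => B z ^ Q) M.law
  /-- Identification: for `θ ≠ θ₀`, the random variables `f(Z, θ)` and `f(Z, θ₀)` are not almost
  surely equal. -/
  identified : ∀ θ ∈ M.Θ, θ ≠ M.θ₀ → ¬ ((fun z => M.f z θ) =ᵐ[M.law] fun z => M.f z M.θ₀)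
  /-- Measurability of the derivatives of the log density. -/
  measurable_dlog : ∀ θ ∈ M.Θ, ∀ k ≤ 7, AEMeasurable (fun z => M.dlog k z θ) M.law
  /-- The information is positive. -/
  info_pos : 0 < M.info
  /-- Near `θ₀` the second derivative of the density is dominated by an integrable function. -/
  dominated : ∃ H : 𝒵 → ℝ, Integrable H M.ν ∧
    ∀ᶠ θ in 𝓝 M.θ₀, ∀ z, |iteratedDeriv 2 (M.f z) θ| ≤ H z

/-- `T` is (almost surely) a maximum likelihood estimator based on the observations `Z i`,
`i ∈ s`. -/
def IsMLE (M : ParametricModel 𝒵) (μ : Measure Ω) (Z : ℕ → Ω → 𝒵) (s : Finset ℕ)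
    (T : Ω → ℝ) : Prop :=
  ∀ᵐ ω ∂μ, IsMaxOn (fun θ => (s.card : ℝ)⁻¹ * ∑ i ∈ s, Real.log (M.f (Z i ω) θ)) M.Θ (T ω) ∧
    T ω ∈ M.Θ

end ParametricModel

/-! ### Normalised sums and the terms of the expansions -/

section Sums

variable {𝒵 Ω : Type*} [MeasurableSpace 𝒵]

/-- `|s|^{-1/2} ∑_{i ∈ s} g(Z_i)`. -/
def scaledSum (Z : ℕ → Ω → 𝒵) (g : 𝒵 → ℝ) (s : Finset ℕ) (ω : Ω) : ℝ :=
  (√(s.card : ℝ))⁻¹ * ∑ i ∈ s, g (Z i ω)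

/-- The first half of the sample `{0, …, 2m - 1}`. -/
def half₁ (m : ℕ) : Finset ℕ := Finset.range m

/-- The second half of the sample `{0, …, 2m - 1}`. -/
def half₂ (m : ℕ) : Finset ℕ := Finset.Ico m (2 * m)

/-- The whole sample `{0, …, n - 1}`. -/
def wholeSample (n : ℕ) : Finset ℕ := Finset.range n

namespace ParametricModel

/-- First-order term of the expansion of `√|s| (θ̂_s - θ₀)`: `A₁ = 𝓘⁻¹ U`. -/
def A₁ (M : ParametricModel 𝒵) (Z : ℕ → Ω → 𝒵) (s : Finset ℕ) (ω : Ω) : ℝ :=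
  M.info⁻¹ * scaledSum Z M.U s ω

/-- Second-order term: `A₂ = ½ 𝓘⁻³ 𝒬₁ U² + 𝓘⁻² U V`. -/
def A₂ (M : ParametricModel 𝒵) (Z : ℕ → Ω → 𝒵) (s : Finset ℕ) (ω : Ω) : ℝ :=
  1 / 2 * M.info⁻¹ ^ 3 * M.Q₁ * scaledSum Z M.U s ω ^ 2
    + M.info⁻¹ ^ 2 * scaledSum Z M.U s ω * scaledSum Z M.V s ω

/-- Third-order term:
`A₃ = (1/6) 𝓘⁻⁴ 𝒬₂ U³ + ½ 𝓘⁻⁵ 𝒬₁² U³ + (3/2) 𝓘⁻⁴ 𝒬₁ U² V + ½ 𝓘⁻³ U² W + 𝓘⁻³ U V²`. -/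
def A₃ (M : ParametricModel 𝒵) (Z : ℕ → Ω → 𝒵) (s : Finset ℕ) (ω : Ω) : ℝ :=
  1 / 6 * M.info⁻¹ ^ 4 * M.Q₂ * scaledSum Z M.U s ω ^ 3
    + 1 / 2 * M.info⁻¹ ^ 5 * M.Q₁ ^ 2 * scaledSum Z M.U s ω ^ 3
    + 3 / 2 * M.info⁻¹ ^ 4 * M.Q₁ * scaledSum Z M.U s ω ^ 2 * scaledSum Z M.V s ω
    + 1 / 2 * M.info⁻¹ ^ 3 * scaledSum Z M.U s ω ^ 2 * scaledSum Z M.W s ω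
    + M.info⁻¹ ^ 3 * scaledSum Z M.U s ω * scaledSum Z M.V s ω ^ 2

/-- The second-order term of the split-sample estimator,
`2 A₂ - (A₂⁽¹⁾ + A₂⁽²⁾) = X₍₁₎ Y₍₂₎ + X₍₂₎ Y₍₁₎`. -/
def A₂SS (M : ParametricModel 𝒵) (Z : ℕ → Ω → 𝒵) (m : ℕ) (ω : Ω) : ℝ :=
  2 * M.A₂ Z (wholeSample (2 * m)) ω - (M.A₂ Z (half₁ m) ω + M.A₂ Z (half₂ m) ω)

/-- The third-order term of the split-sample estimator, `2 A₃ - √2 (A₃⁽¹⁾ + A₃⁽²⁾)`. -/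
def A₃SS (M : ParametricModel 𝒵) (Z : ℕ → Ω → 𝒵) (m : ℕ) (ω : Ω) : ℝ :=
  2 * M.A₃ Z (wholeSample (2 * m)) ω - √2 * (M.A₃ Z (half₁ m) ω + M.A₃ Z (half₂ m) ω)

end ParametricModel

end Sums

section Estimators

variable {Ω : Type*}

/-- The split-sample jackknife `2 θ̂ - (θ̂₍₁₎ + θ̂₍₂₎) / 2` for a sample of size `2m`, where
`θhat s` is the estimator based on the observations with index in `s`. -/
def splitEstimator (θhat : Finset ℕ → Ω → ℝ) (m : ℕ) (ω : Ω) : ℝ :=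
  2 * θhat (wholeSample (2 * m)) ω - (θhat (half₁ m) ω + θhat (half₂ m) ω) / 2

/-- The implicit bias estimate `n ((θ̂₍₁₎ + θ̂₍₂₎) / 2 - θ̂)`, `n = 2m`, of the split-sample
jackknife. -/
def splitBias (θhat : Finset ℕ → Ω → ℝ) (m : ℕ) (ω : Ω) : ℝ :=
  ((2 * m : ℕ) : ℝ) *
    ((θhat (half₁ m) ω + θhat (half₂ m) ω) / 2 - θhat (wholeSample (2 * m)) ω)

end Estimators

section Stochastic

variable {Ω : Type*} [MeasurableSpace Ω]

/-- `S n = O_p(1)`: boundedness in probability. -/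
def BoundedInProbability (μ : Measure Ω) (S : ℕ → Ω → ℝ) : Prop :=
  ∀ ε : ℝ, 0 < ε → ∃ K : ℝ, ∀ᶠ n in atTop, μ {ω | K < |S n ω|} ≤ ENNReal.ofReal ε

/-- The stochastic expansion `√n (T n - θ₀) = A₁ + n^{-1/2} A₂ + n^{-1} A₃ + o_p(n^{-1})`, along
the sample sizes `n = size j`, `j → ∞`. -/
def HasThirdOrderExpansion (μ : Measure Ω) (size : ℕ → ℕ) (T : ℕ → Ω → ℝ) (θ₀ : ℝ)
    (A₁ A₂ A₃ : ℕ → Ω → ℝ) : Prop :=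
  TendstoInMeasure μ
    (fun j ω => (size j : ℝ) * (√(size j : ℝ) * (T j ω - θ₀)
      - (A₁ j ω + A₂ j ω / √(size j : ℝ) + A₃ j ω / (size j : ℝ))))
    atTop (fun _ => 0)

/-- The higher-order variance term
`υ = Var(A₂) + 2 √n E[A₁ A₂] + 2 E[A₁ A₃]` of an expansion with terms `A₁, A₂, A₃`. -/
def higherOrderVariance (μ : Measure Ω) (n : ℕ) (A₁ A₂ A₃ : Ω → ℝ) : ℝ :=
  variance A₂ μ + 2 * √(n : ℝ) * (∫ ω, A₁ ω * A₂ ω ∂μ) + 2 * ∫ ω, A₁ ω * A₃ ω ∂μ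

end Stochastic

end

/-!
The proof rests on one expansion, made uniform over all samples of a given size. Samples are
finite index sets `s`, and every limit is taken along `sampleFilter`, that is as `|s| → ∞`. The
half-samples `{0, …, m-1}` and `{m, …, 2m-1}` are then covered by the same theorem as the whole
sample, and the split-sample statements follow by combining three instances of it.

*The expansion.* Consistency (`Regular.tendstoInMeasure_mle`) is Wald's argument: by strict
positivity of the Kullback–Leibler divergence (`Regular.integral_log_lt`) and dominated
convergence, the log likelihood ratio is, near each `θ' ≠ θ₀`, dominated by a function of the
observation with negative mean; compactness and Chebyshev's inequality do the rest. Once the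
estimator is interior it solves the score equation, which is expanded to fourth order with a
remainder controlled by the average of the envelope (`Regular.exists_expanded_score`).
Substituting the equation into itself three times (`root_sub_expansion_eq`) gives `δ = A₁ + e A₂ +
e² A₃ + e³ r`, with `e = n^{-1/2}`, `δ = √n (θ̂ - θ₀)` and `r` a polynomial in quantities that are
bounded in probability, hence bounded.

*Bias.* Here `A₁` and `A₂` are `X` and `X Y` for the normalised sums of the model's functions `X`
and `Y`, with `E[X Y] = b₀` because the score is centred. In the bias estimate the terms `A₁`
cancel, and the terms `A₂` leave the product of the normalised half-sample differences of `X` and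
`Y` (`biasProduct`). Its mean is `b₀`, its variance is `Υ + O(1/n)` and its third absolute moments
are bounded. If it converged to `b₀` in probability, its variance would have to vanish in the
limit, so it does not when `Υ > 0`.

*Variance.* For the split-sample estimator `Ã₂ = X₍₁₎ Y₍₂₎ + X₍₂₎ Y₍₁₎`, and independence of the
halves gives `Var Ã₂ = 2 Υ` and `E[A₁ Ã₂] = 0` exactly. Fourth mixed moments of normalised sums are
Gaussian pairings plus an exact multiple of `1/n` (`integral_sum_mul_sum_mul_sum_mul_sum`), so
`E[A₁ A₃] = G + K/n`; the constant `G` cancels in `Ã₃`, whence `E[A₁ Ã₃] = -K/m` for `n = 2m`. The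
identity `Var A₁ = 𝓘⁻¹` is the information equality, obtained by differentiating `∫ f(z, θ) dν = 1`
twice at `θ₀`.
-/


/-! ### Boundedness and convergence in probability -/

section StochasticOrder

variable {Ω ι : Type*} [MeasurableSpace Ω] {μ : Measure Ω} {L : Filter ι} {S T : ι → Ω → ℝ}

/-- `S i = O_p(1)` along the filter `L`: boundedness in probability. Events are measured by the
outer measure, since estimators need not be measurable. -/
def IsBigOp (μ : Measure Ω) (L : Filter ι) (S : ι → Ω → ℝ) : Prop :=
  ∀ ε : ℝ, 0 < ε → ∃ K : ℝ, ∀ᶠ i in L, μ {ω | K < |S i ω|} ≤ ENNReal.ofReal ε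

lemma tendstoInMeasure_zero_iff :
    TendstoInMeasure μ S L (fun _ => 0) ↔
      ∀ ε : ℝ, 0 < ε → ∀ δ : ℝ, 0 < δ → ∀ᶠ i in L, μ {ω | ε ≤ |S i ω|} ≤ ENNReal.ofReal δ := by
  rw [tendstoInMeasure_iff_norm]
  simp only [sub_zero, Real.norm_eq_abs]
  refine forall₂_congr fun ε _ => ?_
  rw [ENNReal.tendsto_nhds_zero]
  constructor
  · intro h δ hδ
    exact h _ (by simpa using hδ)
  · intro h δ hδ
    rcases eq_or_ne δ ⊤ with rfl | htop
    · simp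
    · have := h δ.toReal (ENNReal.toReal_pos hδ.ne' htop)
      rwa [ENNReal.ofReal_toReal htop] at this

lemma tendstoInMeasure_sub_iff {c : ℝ} :
    TendstoInMeasure μ S L (fun _ => c) ↔
      TendstoInMeasure μ (fun i ω => S i ω - c) L (fun _ => 0) := by
  rw [tendstoInMeasure_iff_norm, tendstoInMeasure_iff_norm]
  simp

lemma measure_union_le_ofReal {s t : Set Ω} {a b : ℝ} (ha : 0 ≤ a) (hb : 0 ≤ b)
    (hs : μ s ≤ ENNReal.ofReal a) (ht : μ t ≤ ENNReal.ofReal b) :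
    μ (s ∪ t) ≤ ENNReal.ofReal (a + b) := by
  rw [ENNReal.ofReal_add ha hb]
  exact (measure_union_le _ _).trans (add_le_add hs ht)

lemma MeasureTheory.TendstoInMeasure.add_tendsto_zero (hS : TendstoInMeasure μ S L (fun _ => 0))
    (hT : TendstoInMeasure μ T L (fun _ => 0)) :
    TendstoInMeasure μ (fun i ω => S i ω + T i ω) L (fun _ => 0) := by
  rw [tendstoInMeasure_zero_iff] at *
  intro ε hε δ hδ
  filter_upwards [hS (ε / 2) (by positivity) (δ / 2) (by positivity),
    hT (ε / 2) (by positivity) (δ / 2) (by positivity)] with i h1 h2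
  refine (measure_mono ?_).trans ((measure_union_le_ofReal (by positivity) (by positivity)
    h1 h2).trans_eq (by ring_nf))
  intro ω (hω : ε ≤ |S i ω + T i ω|)
  by_contra! h
  simp only [Set.mem_union, Set.mem_ofPred_eq, not_or, not_le] at h
  linarith [abs_add_le (S i ω) (T i ω)]

lemma MeasureTheory.TendstoInMeasure.congr_zero (hS : TendstoInMeasure μ S L (fun _ => 0))
    (h : ∀ᶠ i in L, ∀ ω, T i ω = S i ω) : TendstoInMeasure μ T L (fun _ => 0) := by
  refine hS.congr' ?_ (ae_eq_refl _)
  filter_upwards [h] with i hi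
  exact Eventually.of_forall fun ω => (hi ω).symm

lemma MeasureTheory.TendstoInMeasure.isBigOp (hS : TendstoInMeasure μ S L (fun _ => 0)) :
    IsBigOp μ L S := by
  rw [tendstoInMeasure_zero_iff] at hS
  intro ε hε
  refine ⟨1, ?_⟩
  filter_upwards [hS 1 one_pos ε hε] with i hi
  exact (measure_mono fun ω (hω : 1 < |S i ω|) => hω.le).trans hi

namespace IsBigOp

lemma comp {κ : Type*} {L' : Filter κ} (hS : IsBigOp μ L S) {g : κ → ι} (hg : Tendsto g L' L) :
    IsBigOp μ L' (fun k => S (g k)) := fun ε hε =>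
  let ⟨K, hK⟩ := hS ε hε
  ⟨K, hg.eventually hK⟩

lemma exists_pos (hS : IsBigOp μ L S) {ε : ℝ} (hε : 0 < ε) :
    ∃ K : ℝ, 0 < K ∧ ∀ᶠ i in L, μ {ω | K < |S i ω|} ≤ ENNReal.ofReal ε := by
  obtain ⟨K, hK⟩ := hS ε hε
  refine ⟨max K 1, by positivity, ?_⟩
  filter_upwards [hK] with i hi
  exact (measure_mono fun ω (hω : max K 1 < |S i ω|) => (le_max_left _ _).trans_lt hω).trans hi

lemma congr (hS : IsBigOp μ L S) (h : ∀ i ω, T i ω = S i ω) : IsBigOp μ L T := by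
  have : T = S := by ext i ω; exact h i ω
  rwa [this]

lemma of_combine {R : ι → Ω → ℝ} (hS : IsBigOp μ L S) (hT : IsBigOp μ L T) (F : ℝ → ℝ → ℝ)
    (h : ∀ K K' : ℝ, 0 < K → 0 < K' → ∀ i ω, |S i ω| ≤ K → |T i ω| ≤ K' → |R i ω| ≤ F K K') :
    IsBigOp μ L R := by
  intro ε hε
  obtain ⟨K, hK0, hK⟩ := hS.exists_pos (half_pos hε)
  obtain ⟨K', hK0', hK'⟩ := hT.exists_pos (half_pos hε)
  refine ⟨F K K', ?_⟩
  filter_upwards [hK, hK'] with i h1 h2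
  refine (measure_mono ?_).trans ((measure_union_le_ofReal (by positivity) (by positivity)
    h1 h2).trans_eq (by ring_nf))
  intro ω (hω : F K K' < |R i ω|)
  by_contra! hn
  simp only [Set.mem_union, Set.mem_ofPred_eq, not_or, not_lt] at hn
  linarith [h K K' hK0 hK0' i ω hn.1 hn.2]

lemma add (hS : IsBigOp μ L S) (hT : IsBigOp μ L T) : IsBigOp μ L (fun i ω => S i ω + T i ω) :=
  hS.of_combine hT (fun K K' => K + K') fun _ _ _ _ _ _ h1 h2 =>
    (abs_add_le _ _).trans (add_le_add h1 h2)

lemma mul (hS : IsBigOp μ L S) (hT : IsBigOp μ L T) : IsBigOp μ L (fun i ω => S i ω * T i ω) :=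
  hS.of_combine hT (fun K K' => K * K') fun _ _ hK _ _ _ h1 h2 => by
    rw [abs_mul]; exact mul_le_mul h1 h2 (abs_nonneg _) hK.le

lemma abs (hS : IsBigOp μ L S) : IsBigOp μ L (fun i ω => |S i ω|) := by
  simpa only [IsBigOp, abs_abs] using hS

lemma const (c : ℝ) : IsBigOp μ L (fun _ _ => c) := fun ε _ => ⟨|c|, by simp⟩

lemma const_mul (c : ℝ) (hS : IsBigOp μ L S) : IsBigOp μ L (fun i ω => c * S i ω) :=
  (IsBigOp.const c).mul hS

lemma pow (hS : IsBigOp μ L S) (n : ℕ) : IsBigOp μ L (fun i ω => S i ω ^ n) := by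
  induction n with
  | zero => simpa using IsBigOp.const 1
  | succ n ih => simpa only [pow_succ] using ih.mul hS

lemma mul_tendsto (hS : IsBigOp μ L S) (hT : TendstoInMeasure μ T L (fun _ => 0)) :
    TendstoInMeasure μ (fun i ω => S i ω * T i ω) L (fun _ => 0) := by
  rw [tendstoInMeasure_zero_iff] at *
  intro ε hε δ hδ
  obtain ⟨K, hK0, hK⟩ := hS.exists_pos (half_pos hδ)
  filter_upwards [hK, hT (ε / K) (by positivity) (δ / 2) (by positivity)] with i h1 h2
  refine (measure_mono ?_).trans ((measure_union_le_ofReal (by positivity) (by positivity)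
    h1 h2).trans_eq (by ring_nf))
  intro ω (hω : ε ≤ |S i ω * T i ω|)
  by_contra! hn
  simp only [Set.mem_union, Set.mem_ofPred_eq, not_or, not_lt, not_le] at hn
  rw [abs_mul] at hω
  have h3 : |T i ω| * K < ε := (lt_div_iff₀ hK0).1 hn.2
  nlinarith [mul_le_mul_of_nonneg_right hn.1 (abs_nonneg (T i ω))]

end IsBigOp

lemma tendstoInMeasure_const_zero {c : ι → ℝ} (hc : Tendsto c L (𝓝 0)) :
    TendstoInMeasure μ (fun i _ => c i) L (fun _ => 0) := by
  rw [tendstoInMeasure_zero_iff]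
  intro ε hε δ hδ
  filter_upwards [Metric.tendsto_nhds.1 hc ε hε] with i hi
  rw [Real.dist_eq, sub_zero] at hi
  have : {ω : Ω | ε ≤ |c i|} = ∅ := by
    ext ω; simp [hi]
  simp [this]

lemma MeasureTheory.TendstoInMeasure.const_mul_zero (c : ℝ)
    (hS : TendstoInMeasure μ S L (fun _ => 0)) :
    TendstoInMeasure μ (fun i ω => c * S i ω) L (fun _ => 0) :=
  (IsBigOp.const c).mul_tendsto hS

/-- Markov's inequality: a family bounded in `L¹` is bounded in probability. -/
lemma isBigOp_of_integral_abs_le {C : ℝ} (hint : ∀ᶠ i in L, Integrable (S i) μ)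
    (hC : ∀ᶠ i in L, ∫ ω, |S i ω| ∂μ ≤ C) : IsBigOp μ L S := by
  intro ε hε
  have hC' : 0 < max C 1 := by positivity
  refine ⟨max C 1 / ε, ?_⟩
  filter_upwards [hint, hC] with i hi hiC
  have h1 := mul_meas_ge_le_integral_of_nonneg (μ := μ) (f := fun ω => |S i ω|)
    (Eventually.of_forall fun ω => abs_nonneg _) hi.abs (max C 1 / ε)
  have h2 : max C 1 / ε * μ.real {ω | max C 1 / ε ≤ |S i ω|} ≤ max C 1 :=
    h1.trans (hiC.trans (le_max_left _ _))
  have h3 : μ.real {ω | max C 1 / ε ≤ |S i ω|} ≤ ε := by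
    rw [div_mul_eq_mul_div, div_le_iff₀ hε] at h2
    exact le_of_mul_le_mul_left h2 hC'
  have hfin : μ {ω | max C 1 / ε ≤ |S i ω|} ≠ ⊤ := by
    have := hi.measure_norm_ge_lt_top (ε := max C 1 / ε) (by positivity)
    simpa using this.ne
  calc μ {ω | max C 1 / ε < |S i ω|} ≤ μ {ω | max C 1 / ε ≤ |S i ω|} :=
        measure_mono fun ω (hω : max C 1 / ε < |S i ω|) => hω.le
    _ ≤ ENNReal.ofReal ε := by
        rw [← ENNReal.ofReal_toReal hfin]
        exact ENNReal.ofReal_le_ofReal h3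

lemma isBigOp_of_integral_sq_le [IsProbabilityMeasure μ] {C : ℝ}
    (hint : ∀ᶠ i in L, MemLp (S i) 2 μ)
    (hC : ∀ᶠ i in L, ∫ ω, S i ω ^ 2 ∂μ ≤ C) : IsBigOp μ L S := by
  refine isBigOp_of_integral_abs_le (C := C + 1) ?_ ?_
  · filter_upwards [hint] with i hi using hi.integrable one_le_two
  · filter_upwards [hint, hC] with i hi hiC
    calc ∫ ω, |S i ω| ∂μ ≤ ∫ ω, (S i ω ^ 2 + 1) ∂μ := by
          refine integral_mono (hi.integrable one_le_two).abs
            (hi.integrable_sq.add (integrable_const 1)) fun ω => ?_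
          simp only
          nlinarith [sq_abs (S i ω), sq_nonneg (|S i ω| - 1), abs_nonneg (S i ω)]
      _ ≤ C + 1 := by
          rw [integral_add hi.integrable_sq (integrable_const 1)]
          simpa using hiC

end StochasticOrder

/-! ### Moments of sums of independent variables -/

section Moments

variable {Ω : Type*} [MeasurableSpace Ω] {μ : Measure Ω}

/-- `f` is integrable with integral `v`. Stating both at once rules out the junk value `0` of the
integral, and lets moments be computed term by term. -/
def HasMean (μ : Measure Ω) (f : Ω → ℝ) (v : ℝ) : Prop := Integrable f μ ∧ ∫ ω, f ω ∂μ = v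

namespace HasMean

variable {f g : Ω → ℝ} {u v : ℝ}

lemma add (hf : HasMean μ f u) (hg : HasMean μ g v) :
    HasMean μ (fun ω => f ω + g ω) (u + v) :=
  ⟨hf.1.add hg.1, by rw [integral_add hf.1 hg.1, hf.2, hg.2]⟩

lemma const_mul (c : ℝ) (hf : HasMean μ f u) :
    HasMean μ (fun ω => c * f ω) (c * u) :=
  ⟨hf.1.const_mul c, by rw [integral_const_mul, hf.2]⟩

lemma congr (hf : HasMean μ f u) (h : ∀ ω, g ω = f ω) (huv : v = u) :
    HasMean μ g v := by
  rw [funext h, huv]; exact hf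

lemma eq (hf : HasMean μ f u) : ∫ ω, f ω ∂μ = u := hf.2

end HasMean

lemma MeasureTheory.Integrable.hasMean {f : Ω → ℝ} (hf : Integrable f μ) :
    HasMean μ f (∫ ω, f ω ∂μ) := ⟨hf, rfl⟩

/-- Convergence in probability to zero together with bounded third absolute moments forces the
second moments to tend to zero. -/
lemma MeasureTheory.TendstoInMeasure.tendsto_integral_sq [IsProbabilityMeasure μ]
    {κ : Type*} {L : Filter κ} {S : κ → Ω → ℝ} {C : ℝ}
    (hS : TendstoInMeasure μ S L (fun _ => 0)) (hint : ∀ᶠ i in L, MemLp (S i) 2 μ)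
    (hint3 : ∀ᶠ i in L, Integrable (fun ω => |S i ω| ^ 3) μ)
    (hC : ∀ᶠ i in L, ∫ ω, |S i ω| ^ 3 ∂μ ≤ C) :
    Tendsto (fun i => ∫ ω, S i ω ^ 2 ∂μ) L (𝓝 0) := by
  rw [tendstoInMeasure_zero_iff] at hS
  rw [Metric.tendsto_nhds]
  intro ε hε
  set K : ℝ := 4 * (|C| + 1) / ε with hK
  have hK0 : 0 < K := by positivity
  have ha0 : 0 < √(ε / 4) := Real.sqrt_pos.2 (by positivity)
  filter_upwards [hint, hint3, hC, hS (√(ε / 4)) ha0 (ε / (4 * K ^ 2)) (by positivity)]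
    with i hi hi3 hiC hiS
  set A : Set Ω := {ω | √(ε / 4) ≤ |S i ω|} with hA
  have hAm : NullMeasurableSet A μ := nullMeasurableSet_le aemeasurable_const
    (continuous_abs.measurable.comp_aemeasurable hi.aestronglyMeasurable.aemeasurable)
  have hAr : μ.real A ≤ ε / (4 * K ^ 2) := by
    have := ENNReal.toReal_mono ENNReal.ofReal_ne_top hiS
    rwa [ENNReal.toReal_ofReal (by positivity)] at this
  -- three regimes: `|S|` small, `|S|` between the threshold and `K`, and `|S| > K`
  have hpt : ∀ ω, S i ω ^ 2 ≤ ε / 4 + A.indicator (fun _ => K ^ 2) ω + |S i ω| ^ 3 / K := by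
    intro ω
    have h0 : 0 ≤ |S i ω| ^ 3 / K := by positivity
    by_cases hω : ω ∈ A
    · rw [Set.indicator_of_mem hω]
      rcases le_or_gt |S i ω| K with h | h
      · have : S i ω ^ 2 ≤ K ^ 2 := by rw [← sq_abs]; gcongr
        linarith
      · have : S i ω ^ 2 ≤ |S i ω| ^ 3 / K := by
          rw [le_div_iff₀ hK0, ← sq_abs, pow_succ |S i ω| 2]
          gcongr
        nlinarith [sq_nonneg K]
    · rw [Set.indicator_of_notMem hω]
      have h1 : |S i ω| < √(ε / 4) := not_le.1 hω
      have h2 : S i ω ^ 2 ≤ ε / 4 := by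
        rw [← sq_abs, ← Real.sq_sqrt (show (0 : ℝ) ≤ ε / 4 by positivity)]
        exact pow_le_pow_left₀ (abs_nonneg _) h1.le 2
      linarith
  have hind : Integrable (A.indicator fun _ => K ^ 2) μ :=
    (integrable_const _).integrableOn.integrable_indicator₀ hAm
  have hle : ∫ ω, S i ω ^ 2 ∂μ ≤ ε / 4 + μ.real A * K ^ 2 + (∫ ω, |S i ω| ^ 3 ∂μ) / K := by
    have hsum := ((Integrable.hasMean (integrable_const (ε / 4))).add
      (Integrable.hasMean hind)).add (Integrable.hasMean (hi3.div_const K))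
    refine (integral_mono hi.integrable_sq hsum.1 hpt).trans_eq ?_
    rw [hsum.2, integral_indicator₀ hAm, integral_div K fun ω => |S i ω| ^ 3]
    simp
  have h1 : μ.real A * K ^ 2 ≤ ε / 4 := by
    rw [le_div_iff₀ (by positivity)] at hAr
    linarith
  have h2 : (∫ ω, |S i ω| ^ 3 ∂μ) / K ≤ ε / 4 := by
    rw [div_le_iff₀ hK0]
    have : ε / 4 * K = |C| + 1 := by rw [hK]; field_simp
    rw [this]
    linarith [le_abs_self C]
  rw [Real.dist_eq, sub_zero, abs_of_nonneg (integral_nonneg fun ω => sq_nonneg _)]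
  linarith

lemma ProbabilityTheory.IndepFun.hasMean_mul {E F : Type*} [MeasurableSpace E] [MeasurableSpace F]
    {S : Ω → E} {T : Ω → F} (h : IndepFun S T μ) {φ : E → ℝ} {ψ : F → ℝ} (hφ : Measurable φ)
    (hψ : Measurable ψ) {u v : ℝ} (hu : HasMean μ (fun ω => φ (S ω)) u)
    (hv : HasMean μ (fun ω => ψ (T ω)) v) :
    HasMean μ (fun ω => φ (S ω) * ψ (T ω)) (u * v) := by
  have h' : IndepFun (fun ω => φ (S ω)) (fun ω => ψ (T ω)) μ := h.comp hφ hψ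
  refine ⟨h'.integrable_mul hu.1 hv.1, ?_⟩
  rw [h'.integral_fun_mul_eq_mul_integral hu.1.aestronglyMeasurable hv.1.aestronglyMeasurable,
    hu.2, hv.2]

lemma holderTriple_ofReal {p q r : ℝ} (hp : 0 < p) (hq : 0 < q) (hr : 0 < r)
    (h : p⁻¹ + q⁻¹ = r⁻¹) :
    ENNReal.HolderTriple (ENNReal.ofReal p) (ENNReal.ofReal q) (ENNReal.ofReal r) := by
  constructor
  rw [← ENNReal.ofReal_inv_of_pos hp, ← ENNReal.ofReal_inv_of_pos hq,
    ← ENNReal.ofReal_inv_of_pos hr, ← ENNReal.ofReal_add (by positivity) (by positivity), h]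

instance holderTriple_four_four_two : ENNReal.HolderTriple 4 4 2 := by
  simpa using holderTriple_ofReal (p := 4) (q := 4) (r := 2) (by norm_num) (by norm_num)
    (by norm_num) (by norm_num)

instance holderTriple_six_six_three : ENNReal.HolderTriple 6 6 3 := by
  simpa using holderTriple_ofReal (p := 6) (q := 6) (r := 3) (by norm_num) (by norm_num)
    (by norm_num) (by norm_num)

instance holderTriple_three_six_two : ENNReal.HolderTriple 3 6 2 := by
  simpa using holderTriple_ofReal (p := 3) (q := 6) (r := 2) (by norm_num) (by norm_num)
    (by norm_num) (by norm_num)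

lemma MeasureTheory.MemLp.mul_four {f g : Ω → ℝ} (hf : MemLp f 4 μ) (hg : MemLp g 4 μ) :
    MemLp (fun ω => f ω * g ω) 2 μ := hg.mul' hf

lemma MeasureTheory.MemLp.integrable_mul_four {f g h k : Ω → ℝ} (hf : MemLp f 4 μ)
    (hg : MemLp g 4 μ) (hh : MemLp h 4 μ) (hk : MemLp k 4 μ) :
    Integrable (fun ω => f ω * g ω * (h ω * k ω)) μ :=
  (MemLp.mul_four hf hg).integrable_mul (MemLp.mul_four hh hk)

lemma MeasureTheory.MemLp.mul_three_of_six {f g h : Ω → ℝ} (hf : MemLp f 6 μ) (hg : MemLp g 6 μ)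
    (hh : MemLp h 6 μ) : MemLp (fun ω => f ω * g ω * h ω) 2 μ := by
  have h1 : MemLp (fun ω => f ω * g ω) 3 μ := hg.mul' hf
  exact hh.mul' h1

lemma MeasureTheory.MemLp.integrable_pow_le [IsFiniteMeasure μ] {f : Ω → ℝ} {n : ℕ}
    (hf : MemLp f n μ) {k : ℕ} (hk : k ≤ n) :
    Integrable (fun ω => f ω ^ k) μ := by
  rcases Nat.eq_zero_or_pos k with rfl | hk0
  · simp
  have h1 : MemLp f k μ := hf.mono_exponent (by exact_mod_cast hk)
  have := h1.integrable_norm_pow hk0.ne'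
  refine (integrable_norm_iff (h1.aestronglyMeasurable.pow k)).1 ?_
  simpa using this

section Vector

variable {ι : Type*} {ξ : ℕ → Ω → ι → ℝ}

lemma aemeasurable_of_memLp [Finite ι] {p : ENNReal}
    (hLp : ∀ i j, MemLp (fun ω => ξ i ω j) p μ) (i : ℕ) : AEMeasurable (ξ i) μ :=
  aemeasurable_pi_lambda _ fun j => (hLp i j).aestronglyMeasurable.aemeasurable

lemma memLp_sum_coord {p : ENNReal} (hLp : ∀ i j, MemLp (fun ω => ξ i ω j) p μ) (s : Finset ℕ)
    (j : ι) : MemLp (fun ω => ∑ i ∈ s, ξ i ω j) p μ :=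
  memLp_finsetSum s fun i _ => hLp i j

lemma indepFun_sum_coord (hind : iIndepFun ξ μ) (hm : ∀ i, AEMeasurable (ξ i) μ)
    {s : Finset ℕ} {i : ℕ} (hi : i ∉ s) :
    IndepFun (fun ω j => ∑ k ∈ s, ξ k ω j) (ξ i) μ := by
  have h := hind.indepFun_finsetSum_of_notMem₀ hm hi
  have h2 : (∑ k ∈ s, ξ k) = fun ω j => ∑ k ∈ s, ξ k ω j := by
    ext ω j; simp [Finset.sum_apply]
  rwa [h2] at h

lemma integral_sum_coord (hLp : ∀ i j, MemLp (fun ω => ξ i ω j) 1 μ)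
    (h0 : ∀ i j, ∫ ω, ξ i ω j ∂μ = 0) (s : Finset ℕ) (a : ι) :
    HasMean μ (fun ω => ∑ i ∈ s, ξ i ω a) 0 := by
  refine ⟨integrable_finsetSum _ fun i _ => memLp_one_iff_integrable.1 (hLp i a), ?_⟩
  rw [integral_finsetSum _ fun i _ => memLp_one_iff_integrable.1 (hLp i a)]
  simp [h0]

lemma integral_sum_mul_sum [Finite ι] [IsProbabilityMeasure μ] (hind : iIndepFun ξ μ)
    (hLp : ∀ i j, MemLp (fun ω => ξ i ω j) 2 μ) (h0 : ∀ i j, ∫ ω, ξ i ω j ∂μ = 0)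
    {C : ι → ι → ℝ} (hC : ∀ i a b, ∫ ω, ξ i ω a * ξ i ω b ∂μ = C a b) (s : Finset ℕ) (a b : ι) :
    HasMean μ (fun ω => (∑ i ∈ s, ξ i ω a) * ∑ i ∈ s, ξ i ω b) (s.card * C a b) := by
  have hm := aemeasurable_of_memLp hLp
  have hL1 : ∀ i j, MemLp (fun ω => ξ i ω j) 1 μ := fun i j => (hLp i j).mono_exponent one_le_two
  induction s using Finset.induction_on with
  | empty => simp [HasMean]
  | insert i s hi ih =>
    have hS := indepFun_sum_coord hind hm hi
    have hx : ∀ a, HasMean μ (fun ω => ξ i ω a) 0 := fun a =>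
      ⟨(hL1 i a).integrable le_rfl, h0 i a⟩
    have hs : ∀ a, HasMean μ (fun ω => ∑ i ∈ s, ξ i ω a) 0 := integral_sum_coord hL1 h0 s
    have h1 := IndepFun.hasMean_mul hS (φ := fun x => x a) (ψ := fun x => x b)
      (measurable_pi_apply _) (measurable_pi_apply _) (hs a) (hx b)
    have h2 := IndepFun.hasMean_mul hS (φ := fun x => x b) (ψ := fun x => x a)
      (measurable_pi_apply _) (measurable_pi_apply _) (hs b) (hx a)
    have h3 : HasMean μ (fun ω => ξ i ω a * ξ i ω b) (C a b) :=
      ⟨(hLp i a).integrable_mul (hLp i b), hC i a b⟩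
    refine (((ih.add h1).add h2).add h3).congr (fun ω => ?_) ?_
    · simp only [Finset.sum_insert hi]; ring
    · rw [Finset.card_insert_of_notMem hi]; push_cast; ring

/-- The mixed fourth moment of sums of independent centred vectors: the Gaussian pairings enter
with weight `n(n-1)` and the diagonal with weight `n`. -/
lemma integral_sum_mul_sum_mul_sum_mul_sum [Finite ι] [IsProbabilityMeasure μ]
    (hind : iIndepFun ξ μ)
    (hLp : ∀ i j, MemLp (fun ω => ξ i ω j) 4 μ) (h0 : ∀ i j, ∫ ω, ξ i ω j ∂μ = 0)
    {C : ι → ι → ℝ} (hC : ∀ i a b, ∫ ω, ξ i ω a * ξ i ω b ∂μ = C a b) (a b c d : ι) {κ : ℝ}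
    (hκ : ∀ i, ∫ ω, ξ i ω a * ξ i ω b * (ξ i ω c * ξ i ω d) ∂μ = κ) (s : Finset ℕ) :
    HasMean μ (fun ω => (∑ i ∈ s, ξ i ω a) * (∑ i ∈ s, ξ i ω b) *
        ((∑ i ∈ s, ξ i ω c) * ∑ i ∈ s, ξ i ω d))
      (s.card * (s.card - 1) * (C a b * C c d + C a c * C b d + C a d * C b c)
        + s.card * κ) := by
  have hm := aemeasurable_of_memLp hLp
  have hL2 : ∀ i j, MemLp (fun ω => ξ i ω j) 2 μ := fun i j =>
    (hLp i j).mono_exponent (by norm_num)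
  have hL1 : ∀ i j, MemLp (fun ω => ξ i ω j) 1 μ := fun i j =>
    (hLp i j).mono_exponent (by norm_num)
  induction s using Finset.induction_on with
  | empty => simp [HasMean]
  | insert i s hi ih =>
    have hS := indepFun_sum_coord hind hm hi
    have hxi : ∀ a, HasMean μ (fun ω => ξ i ω a) 0 := fun a =>
      ⟨(hL1 i a).integrable le_rfl, h0 i a⟩
    have hs : ∀ a, HasMean μ (fun ω => ∑ i ∈ s, ξ i ω a) 0 := integral_sum_coord hL1 h0 s
    have hxx : ∀ a b, HasMean μ (fun ω => ξ i ω a * ξ i ω b) (C a b) := fun a b =>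
      ⟨(hL2 i a).integrable_mul (hL2 i b), hC i a b⟩
    have hss := integral_sum_mul_sum hind hL2 h0 hC s
    have hI3 : ∀ f g h : Ω → ℝ, MemLp f 4 μ → MemLp g 4 μ → MemLp h 4 μ →
        Integrable (fun ω => f ω * g ω * h ω) μ := fun f g h hf hg hh =>
      (MemLp.mul_four hf hg).integrable_mul
        (hh.mono_exponent (show (2 : ENNReal) ≤ 4 by norm_num))
    have h31 : ∀ a b c d, HasMean μ (fun ω => ((∑ i ∈ s, ξ i ω a) * (∑ i ∈ s, ξ i ω b) *
        (∑ i ∈ s, ξ i ω c)) * ξ i ω d) 0 := fun a b c d => by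
      simpa using IndepFun.hasMean_mul hS (φ := fun x => x a * x b * x c) (ψ := fun x => x d)
        (by fun_prop) (by fun_prop)
        (Integrable.hasMean (hI3 _ _ _ (memLp_sum_coord hLp s a) (memLp_sum_coord hLp s b)
          (memLp_sum_coord hLp s c))) (hxi d)
    have h13 : ∀ a b c d, HasMean μ (fun ω => (∑ i ∈ s, ξ i ω a) * (ξ i ω b * ξ i ω c *
        ξ i ω d)) 0 := fun a b c d => by
      simpa using IndepFun.hasMean_mul hS (φ := fun x => x a) (ψ := fun x => x b * x c * x d)
        (by fun_prop) (by fun_prop) (hs a)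
        (Integrable.hasMean (hI3 _ _ _ (hLp i b) (hLp i c) (hLp i d)))
    have h22 : ∀ a b c d, HasMean μ (fun ω => ((∑ i ∈ s, ξ i ω a) * (∑ i ∈ s, ξ i ω b)) *
        (ξ i ω c * ξ i ω d)) (s.card * C a b * C c d) := fun a b c d =>
      IndepFun.hasMean_mul hS (φ := fun x => x a * x b) (ψ := fun x => x c * x d)
        (by fun_prop) (by fun_prop) (hss a b) (hxx c d)
    have h04 : HasMean μ (fun ω => ξ i ω a * ξ i ω b * (ξ i ω c * ξ i ω d)) κ :=
      ⟨MemLp.integrable_mul_four (hLp i a) (hLp i b) (hLp i c) (hLp i d), hκ i⟩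
    have h3 := (((h31 a b c d).add (h31 a b d c)).add (h31 a c d b)).add (h31 b c d a)
    have h1 := (((h13 a b c d).add (h13 b a c d)).add (h13 c a b d)).add (h13 d a b c)
    have h2 := (((((h22 a b c d).add (h22 c d a b)).add (h22 a c b d)).add (h22 b d a c)).add
      (h22 a d b c)).add (h22 b c a d)
    refine ((((ih.add h3).add h1).add h2).add h04).congr (fun ω => ?_) ?_
    · simp only [Finset.sum_insert hi]; ring
    · rw [Finset.card_insert_of_notMem hi]; push_cast; ring

/-- Sums over disjoint blocks of an independent sequence are independent. -/
lemma indepFun_sum_sum (hind : iIndepFun ξ μ) (hm : ∀ i, AEMeasurable (ξ i) μ)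
    {s t : Finset ℕ} (hst : Disjoint s t) :
    IndepFun (fun ω j => ∑ k ∈ s, ξ k ω j) (fun ω j => ∑ k ∈ t, ξ k ω j) μ := by
  have h := hind.indepFun_finset₀ s t hst hm
  have hmeas : ∀ u : Finset ℕ, Measurable fun (x : u → ι → ℝ) j => ∑ k, x k j := fun u => by
    fun_prop
  have h2 := h.comp (hmeas s) (hmeas t)
  have h3 : ∀ u : Finset ℕ, (fun ω j => ∑ k ∈ u, ξ k ω j) =
      (fun (x : u → ι → ℝ) j => ∑ k, x k j) ∘ fun ω (i : u) => ξ i ω := fun u => by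
    ext ω j
    simp only [Function.comp]
    rw [← Finset.sum_coe_sort u]
  rw [h3 s, h3 t]
  exact h2

end Vector

/-- Sixth moments of sums of independent centred variables grow at most like the cube of the
number of summands. -/
lemma integral_sum_pow_six_le [IsProbabilityMeasure μ] {X : ℕ → Ω → ℝ} (hind : iIndepFun X μ)
    (hLp : ∀ i, MemLp (X i) 6 μ) (h0 : ∀ i, ∫ ω, X i ω ∂μ = 0) {B : ℝ}
    (hB : ∀ i, ∀ k ≤ 6, |∫ ω, X i ω ^ k ∂μ| ≤ B) :
    ∃ C : ℝ, ∀ s : Finset ℕ, ∫ ω, (∑ i ∈ s, X i ω) ^ 6 ∂μ ≤ C * s.card ^ 3 := by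
  have hB0 : 0 ≤ B := (abs_nonneg _).trans (hB 0 0 (by norm_num))
  have key : ∀ s : Finset ℕ,
      |∫ ω, (∑ i ∈ s, X i ω) ^ 2 ∂μ| ≤ B * s.card ∧ |∫ ω, (∑ i ∈ s, X i ω) ^ 3 ∂μ| ≤ B * s.card ∧
      |∫ ω, (∑ i ∈ s, X i ω) ^ 4 ∂μ| ≤ (3 * B ^ 2 + B) * s.card ^ 2 ∧
      |∫ ω, (∑ i ∈ s, X i ω) ^ 6 ∂μ| ≤
        (15 * (3 * B ^ 2 + B) * B + 35 * B ^ 2 + B) * s.card ^ 3 := by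
    intro s
    induction s using Finset.induction_on with
    | empty => simp
    | insert i s hi ih =>
      have hS : IndepFun (fun ω => ∑ k ∈ s, X k ω) (X i) μ := by
        have h := hind.indepFun_finsetSum_of_notMem₀
          (fun i => (hLp i).aestronglyMeasurable.aemeasurable) hi
        have h2 : (∑ k ∈ s, X k) = fun ω => ∑ k ∈ s, X k ω := by ext ω; simp
        rwa [h2] at h
      have hLs : MemLp (fun ω => ∑ k ∈ s, X k ω) (6 : ℕ) μ := memLp_finsetSum s fun i _ => hLp i
      set S : Ω → ℝ := fun ω => ∑ k ∈ s, X k ω with hSdef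
      set M : ℕ → ℝ := fun p => ∫ ω, S ω ^ p ∂μ with hM
      set m : ℕ → ℝ := fun p => ∫ ω, X i ω ^ p ∂μ with hm
      have hI : ∀ p ≤ 6, ∀ q ≤ 6, HasMean μ (fun ω => S ω ^ p * X i ω ^ q) (M p * m q) :=
        fun p hp q hq => IndepFun.hasMean_mul hS (φ := fun x => x ^ p) (ψ := fun x => x ^ q)
          (by fun_prop) (by fun_prop)
          (Integrable.hasMean (MemLp.integrable_pow_le hLs hp))
          (Integrable.hasMean (MemLp.integrable_pow_le (n := 6) (hLp i) hq))
      have hM0 : M 0 = 1 := by simp [hM]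
      have hm0 : m 0 = 1 := by simp [hm]
      have hm1 : m 1 = 0 := by simpa [hm] using h0 i
      have hM1 : M 1 = 0 := by
        simp only [hM, hSdef, pow_one]
        rw [integral_finsetSum _ fun j _ => (hLp j).integrable (by norm_num)]
        simp [h0]
      have hexp : ∀ n ≤ 6, ∫ ω, (∑ k ∈ insert i s, X k ω) ^ n ∂μ =
          ∑ p ∈ Finset.range (n + 1), M p * m (n - p) * (n.choose p) := by
        intro n hn
        have : ∀ ω, (∑ k ∈ insert i s, X k ω) ^ n =
            ∑ p ∈ Finset.range (n + 1), S ω ^ p * X i ω ^ (n - p) * (n.choose p) := fun ω => by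
          rw [Finset.sum_insert hi, add_comm, add_pow]
        simp only [this]
        rw [integral_finsetSum]
        · refine Finset.sum_congr rfl fun p hp => ?_
          rw [Finset.mem_range] at hp
          rw [integral_mul_const, (hI p (by omega) (n - p) (by omega)).eq]
        · intro p hp
          rw [Finset.mem_range] at hp
          exact (hI p (by omega) (n - p) (by omega)).1.mul_const _
      obtain ⟨i2, i3, i4, i6⟩ := ih
      change |M 2| ≤ _ at i2
      change |M 3| ≤ _ at i3
      change |M 4| ≤ _ at i4
      change |M 6| ≤ _ at i6
      have b : ∀ k ≤ 6, |m k| ≤ B := hB i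
      have b2 := b 2 (by norm_num)
      have b3 := b 3 (by norm_num)
      have b4 := b 4 (by norm_num)
      have b6 := b 6 (by norm_num)
      rw [hexp 2 (by norm_num), hexp 3 (by norm_num), hexp 4 (by norm_num), hexp 6 (by norm_num),
        Finset.card_insert_of_notMem hi]
      simp only [Finset.sum_range_succ, Finset.sum_range_zero, hM0, hm0, hM1, hm1, Nat.choose]
      norm_num only [Nat.sub_zero, mul_one, one_mul, mul_zero, zero_mul, add_zero, zero_add, hm0,
        hm1, Nat.cast_ofNat, Nat.cast_one, Nat.cast_add]
      set n : ℝ := (s.card : ℝ) with hn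
      have hn0 : 0 ≤ n := by positivity
      have hmul : ∀ {x y a c : ℝ}, |x| ≤ a → |y| ≤ c → |x * y| ≤ a * c := fun {x y a c} hx hy => by
        rw [abs_mul]; exact mul_le_mul hx hy (abs_nonneg _) ((abs_nonneg _).trans hx)
      have p22 := hmul i2 b2
      have p24 := hmul i2 b4
      have p33 := hmul i3 b3
      have p42 := hmul i4 b2
      rw [abs_le] at i2 i3 i4 i6 b2 b3 b4 b6 p22 p24 p33 p42
      refine ⟨abs_le.2 ⟨?_, ?_⟩, abs_le.2 ⟨?_, ?_⟩, abs_le.2 ⟨?_, ?_⟩, abs_le.2 ⟨?_, ?_⟩⟩ <;>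
        linarith [mul_nonneg hB0 hn0,
        mul_nonneg (mul_nonneg hB0 hB0) hn0, mul_nonneg (mul_nonneg hB0 hB0) hB0,
        mul_nonneg (mul_nonneg hB0 hB0) (mul_nonneg hn0 hn0), mul_nonneg hB0 hB0,
        mul_nonneg (mul_nonneg (mul_nonneg hB0 hB0) hB0) hn0, mul_nonneg hB0 (mul_nonneg hn0 hn0),
        mul_nonneg (mul_nonneg (mul_nonneg hB0 hB0) hB0) (mul_nonneg hn0 hn0)]
  exact ⟨_, fun s => (le_abs_self _).trans (key s).2.2.2⟩

end Moments

/-! ### Regular models: derivatives, the score and the information -/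

section Taylor

/-- Taylor's formula with a crude remainder, for a function given together with its successive
derivatives `D 0, D 1, …` on a ball. -/
lemma abs_sub_taylor_sum_le {a r B : ℝ} (n : ℕ) {D : ℕ → ℝ → ℝ}
    (hD : ∀ k < n, ∀ x ∈ Metric.ball a r, HasDerivAt (D k) (D (k + 1) x) x)
    (hB : ∀ x ∈ Metric.ball a r, |D n x| ≤ B) {x : ℝ} (hx : x ∈ Metric.ball a r) :
    |D 0 x - ∑ k ∈ Finset.range n, D k a * (x - a) ^ k / (k.factorial : ℝ)| ≤
      B * |x - a| ^ n := by
  induction n generalizing D x with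
  | zero => simpa using hB x hx
  | succ n ih =>
    have ha : a ∈ Metric.ball a r := by
      rw [Metric.mem_ball] at hx
      simpa using dist_nonneg.trans_lt hx
    have hseg : segment ℝ a x ⊆ Metric.ball a r := (convex_ball a r).segment_subset ha hx
    have hB0 : 0 ≤ B := (abs_nonneg _).trans (hB a ha)
    have hder : ∀ y ∈ Metric.ball a r, HasDerivAt
        (fun y => D 0 y - ∑ k ∈ Finset.range (n + 1), D k a * (y - a) ^ k / (k.factorial : ℝ))
        (D 1 y - ∑ k ∈ Finset.range n, D (k + 1) a * (y - a) ^ k / (k.factorial : ℝ)) y := by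
      intro y hy
      refine (hD 0 (Nat.succ_pos n) y hy).sub ?_
      have h1 : ∀ k ∈ Finset.range (n + 1), HasDerivAt
          (fun y => D k a * (y - a) ^ k / (k.factorial : ℝ))
          (D k a * (k * (y - a) ^ (k - 1)) / (k.factorial : ℝ)) y := fun k _ => by
        have := ((((hasDerivAt_id y).sub_const a).pow k).const_mul (D k a)).div_const
          (k.factorial : ℝ)
        simpa using this
      have h2 := HasDerivAt.fun_sum h1
      rw [Finset.sum_range_succ'] at h2
      simp only [Nat.cast_zero, zero_mul, mul_zero, zero_div, add_zero, Nat.add_sub_cancel] at h2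
      convert h2 using 1
      refine Finset.sum_congr rfl fun k _ => ?_
      rw [Nat.factorial_succ]
      push_cast
      have : (k.factorial : ℝ) ≠ 0 := by positivity
      field_simp
    have hbound : ∀ y ∈ segment ℝ a x,
        ‖D 1 y - ∑ k ∈ Finset.range n, D (k + 1) a * (y - a) ^ k / (k.factorial : ℝ)‖ ≤
          B * |x - a| ^ n := by
      intro y hy
      refine (ih (D := fun k => D (k + 1)) (fun k hk => hD (k + 1) (by omega)) hB
        (hseg hy)).trans ?_
      have : ‖y - a‖ ≤ ‖x - a‖ := norm_sub_le_of_mem_segment hy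
      exact mul_le_mul_of_nonneg_left (pow_le_pow_left₀ (abs_nonneg _) this n) hB0
    have := (convex_segment a x).norm_image_sub_le_of_norm_hasDerivWithin_le
      (fun y hy => (hder y (hseg hy)).hasDerivWithinAt) hbound (left_mem_segment ℝ a x)
      (right_mem_segment ℝ a x)
    rw [Real.norm_eq_abs, Real.norm_eq_abs] at this
    have h0 : D 0 a - ∑ k ∈ Finset.range (n + 1), D k a * (a - a) ^ k / (k.factorial : ℝ) = 0 := by
      rw [Finset.sum_range_succ']
      simp
    rw [h0, sub_zero] at this
    refine this.trans_eq ?_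
    ring

end Taylor

namespace ParametricModel

variable {𝒵 : Type*} [MeasurableSpace 𝒵] {M : ParametricModel 𝒵}

lemma dlog_zero (z : 𝒵) (θ : ℝ) : M.dlog 0 z θ = Real.log (M.f z θ) := by
  simp [dlog]

/-- The `k`-th derivative in `θ` of the density, `k ≤ 3`, in terms of those of the log density. The
value at `k > 3` is that at `k = 3` and has no meaning. -/
noncomputable def densityDeriv (M : ParametricModel 𝒵) (z : 𝒵) : ℕ → ℝ → ℝ
  | 0, θ => M.f z θ
  | 1, θ => M.f z θ * M.dlog 1 z θ
  | 2, θ => M.f z θ * (M.dlog 2 z θ + M.dlog 1 z θ ^ 2)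
  | _, θ => M.f z θ * (M.dlog 3 z θ + 3 * M.dlog 1 z θ * M.dlog 2 z θ + M.dlog 1 z θ ^ 3)

namespace Regular

lemma θ₀_mem (hM : M.Regular) : M.θ₀ ∈ M.Θ := interior_subset hM.mem_interior

lemma isProbabilityMeasure_law (hM : M.Regular) : IsProbabilityMeasure M.law := by
  constructor
  rw [law, withDensity_apply _ MeasurableSet.univ, Measure.restrict_univ]
  exact hM.lintegral_density _ hM.θ₀_mem

/-- The envelope may be taken nonnegative and in `L¹⁶`. -/
lemma exists_envelope (hM : M.Regular) : ∃ B : 𝒵 → ℝ, (∀ z, 0 ≤ B z) ∧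
    (∀ z, ∀ θ ∈ M.Θ, ∀ k ≤ 7, |M.dlog k z θ| ≤ B z) ∧ MemLp B 16 M.law := by
  have := hM.isProbabilityMeasure_law
  obtain ⟨B, hB, Q, hQ, hint⟩ := hM.envelope
  have hB0 : ∀ z, 0 ≤ B z := fun z => (abs_nonneg _).trans (hB z _ hM.θ₀_mem 0 (by norm_num))
  refine ⟨B, hB0, hB, ?_⟩
  have hmeas : AEStronglyMeasurable B M.law := by
    have h1 : AEMeasurable (fun z => (B z ^ Q) ^ Q⁻¹) M.law := hint.aemeasurable.pow_const _
    have h2 : (fun z => (B z ^ Q) ^ Q⁻¹) = B := by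
      ext z; exact Real.rpow_rpow_inv (hB0 z) (by linarith)
    rw [h2] at h1
    exact h1.aestronglyMeasurable
  have hp : (ENNReal.ofReal Q).toReal = Q := ENNReal.toReal_ofReal (by linarith)
  have hLp : MemLp B (ENNReal.ofReal Q) M.law := by
    rw [← integrable_norm_rpow_iff hmeas (by simp; linarith) ENNReal.ofReal_ne_top, hp]
    refine hint.congr (Eventually.of_forall fun z => ?_)
    simp only [Real.norm_eq_abs, abs_of_nonneg (hB0 z)]
  refine hLp.mono_exponent ?_
  rw [show (16 : ENNReal) = ENNReal.ofReal 16 by simp]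
  exact ENNReal.ofReal_le_ofReal hQ.le

lemma memLp_dlog (hM : M.Regular) {k : ℕ} (hk : k ≤ 7) {θ : ℝ} (hθ : θ ∈ M.Θ) :
    MemLp (fun z => M.dlog k z θ) 16 M.law := by
  obtain ⟨B, hB0, hB, hLp⟩ := hM.exists_envelope
  refine hLp.mono (hM.measurable_dlog θ hθ k hk).aestronglyMeasurable
    (Eventually.of_forall fun z => ?_)
  rw [Real.norm_eq_abs, Real.norm_eq_abs]
  exact (hB z θ hθ k hk).trans (le_abs_self _)

lemma integrable_dlog (hM : M.Regular) {k : ℕ} (hk : k ≤ 7) {θ : ℝ} (hθ : θ ∈ M.Θ) :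
    Integrable (fun z => M.dlog k z θ) M.law :=
  have := hM.isProbabilityMeasure_law
  (hM.memLp_dlog hk hθ).integrable (by norm_num)

lemma hasDerivAt_dlog (hM : M.Regular) (z : 𝒵) {k : ℕ} (hk : k < 7) {θ : ℝ}
    (hθ : θ ∈ interior M.Θ) : HasDerivAt (M.dlog k z) (M.dlog (k + 1) z θ) θ := by
  set φ : ℝ → ℝ := fun t => Real.log (M.f z t) with hφ
  have hcongr : ∀ j, ∀ t ∈ interior M.Θ,
      M.dlog j z t = iteratedDerivWithin j φ (interior M.Θ) t := by
    intro j t ht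
    have : M.Θ =ᶠ[𝓝 t] interior M.Θ := by
      filter_upwards [isOpen_interior.mem_nhds ht] with x hx
      exact propext ⟨fun _ => hx, fun h => interior_subset h⟩
    rw [dlog, iteratedDerivWithin, iteratedDerivWithin, iteratedFDerivWithin_congr_set this]
  have hcd : ContDiffOn ℝ 7 φ (interior M.Θ) := (hM.contDiffOn_log z).mono interior_subset
  have hd : DifferentiableAt ℝ (iteratedDerivWithin k φ (interior M.Θ)) θ :=
    ((hcd.differentiableOn_iteratedDerivWithin (by exact_mod_cast hk)
      isOpen_interior.uniqueDiffOn) θ hθ).differentiableAt (isOpen_interior.mem_nhds hθ)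
  have h2 : M.dlog k z =ᶠ[𝓝 θ] iteratedDerivWithin k φ (interior M.Θ) := by
    filter_upwards [isOpen_interior.mem_nhds hθ] with x hx using hcongr k x hx
  have h3 := hd.hasDerivAt.congr_of_eventuallyEq h2
  rwa [← derivWithin_of_isOpen isOpen_interior hθ, ← iteratedDerivWithin_succ,
    ← hcongr _ _ hθ] at h3

lemma integral_law (hM : M.Regular) (g : 𝒵 → ℝ) :
    ∫ z, g z ∂M.law = ∫ z, M.f z M.θ₀ * g z ∂M.ν := by
  rw [law, integral_withDensity_eq_integral_toReal_smul
    (hM.measurable_density _ hM.θ₀_mem).ennreal_ofReal (by simp)]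
  refine integral_congr_ae (Eventually.of_forall fun z => ?_)
  simp [ENNReal.toReal_ofReal (hM.density_pos z _ hM.θ₀_mem).le]

lemma integrable_law_iff (hM : M.Regular) (g : 𝒵 → ℝ) :
    Integrable g M.law ↔ Integrable (fun z => M.f z M.θ₀ * g z) M.ν := by
  rw [law, integrable_withDensity_iff_integrable_smul'
    (hM.measurable_density _ hM.θ₀_mem).ennreal_ofReal (by simp)]
  simp [ENNReal.toReal_ofReal (hM.density_pos _ _ hM.θ₀_mem).le]

lemma hasMean_density (hM : M.Regular) {θ : ℝ} (hθ : θ ∈ M.Θ) :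
    HasMean M.ν (fun z => M.f z θ) 1 := by
  have hnn : 0 ≤ᵐ[M.ν] fun z => M.f z θ := Eventually.of_forall fun z => (hM.density_pos z θ hθ).le
  have hm := (hM.measurable_density θ hθ).aestronglyMeasurable (μ := M.ν)
  refine ⟨⟨hm, ?_⟩, ?_⟩
  · rw [hasFiniteIntegral_iff_ofReal hnn, hM.lintegral_density θ hθ]
    simp
  · rw [integral_eq_lintegral_of_nonneg_ae hnn hm, hM.lintegral_density θ hθ]
    simp

/-- Strict positivity of the Kullback–Leibler divergence from `f(·, θ₀)`. -/
lemma integral_log_lt (hM : M.Regular) {θ : ℝ} (hθ : θ ∈ M.Θ) (hne : θ ≠ M.θ₀) :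
    ∫ z, M.dlog 0 z θ ∂M.law < ∫ z, M.dlog 0 z M.θ₀ ∂M.law := by
  have := hM.isProbabilityMeasure_law
  have hpos : ∀ z, 0 < M.f z θ / M.f z M.θ₀ := fun z =>
    div_pos (hM.density_pos z θ hθ) (hM.density_pos z _ hM.θ₀_mem)
  have hmul : (fun z => M.f z M.θ₀ * (M.f z θ / M.f z M.θ₀)) = fun z => M.f z θ := by
    ext z
    exact mul_div_cancel₀ _ (hM.density_pos z _ hM.θ₀_mem).ne'
  have hr : HasMean M.law (fun z => M.f z θ / M.f z M.θ₀) 1 := by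
    refine ⟨(hM.integrable_law_iff _).2 ?_, ?_⟩
    · rw [hmul]; exact (hM.hasMean_density hθ).1
    · rw [hM.integral_law, hmul]; exact (hM.hasMean_density hθ).2
  have hlog : ∀ z, Real.log (M.f z θ / M.f z M.θ₀) = M.dlog 0 z θ - M.dlog 0 z M.θ₀ := fun z => by
    rw [dlog_zero, dlog_zero, Real.log_div (hM.density_pos z θ hθ).ne'
      (hM.density_pos z _ hM.θ₀_mem).ne']
  have hi1 := hM.integrable_dlog (k := 0) (by norm_num) hθ
  have hi0 := hM.integrable_dlog (k := 0) (by norm_num) hM.θ₀_mem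
  set g : 𝒵 → ℝ := fun z => M.f z θ / M.f z M.θ₀ - 1 - (M.dlog 0 z θ - M.dlog 0 z M.θ₀) with hg
  have hg0 : 0 ≤ g := fun z => by
    have := Real.log_le_sub_one_of_pos (hpos z)
    rw [hlog] at this
    simp only [hg, Pi.zero_apply]
    linarith
  obtain ⟨hgi, hgv⟩ : HasMean M.law g
      (∫ z, M.dlog 0 z M.θ₀ ∂M.law - ∫ z, M.dlog 0 z θ ∂M.law) := by
    refine (((hr.add (Integrable.hasMean (integrable_const (-1)))).add
      ((Integrable.hasMean hi1).const_mul (-1))).add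
        (Integrable.hasMean hi0)).congr (fun z => ?_) ?_
    · simp only [hg]; ring
    · simp; ring
  have hge : 0 ≤ ∫ z, g z ∂M.law := integral_nonneg hg0
  refine lt_of_le_of_ne (by linarith) fun heq => hM.identified θ hθ hne ?_
  have h0 : g =ᵐ[M.law] 0 := (integral_eq_zero_iff_of_nonneg hg0 hgi).1 (by linarith)
  filter_upwards [h0] with z hz
  by_contra hzne
  have h1 : M.f z θ / M.f z M.θ₀ ≠ 1 := fun h =>
    hzne ((div_eq_one_iff_eq (hM.density_pos z _ hM.θ₀_mem).ne').1 h)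
  have h2 := Real.log_lt_sub_one_of_pos (hpos z) h1
  rw [hlog] at h2
  simp only [hg, Pi.zero_apply] at hz
  linarith

lemma hasDerivAt_densityDeriv (hM : M.Regular) (z : 𝒵) {k : ℕ} (hk : k < 3) {θ : ℝ}
    (hθ : θ ∈ interior M.Θ) : HasDerivAt (densityDeriv M z k) (densityDeriv M z (k + 1) θ) θ := by
  have h1 := hM.hasDerivAt_dlog z (k := 1) (by norm_num) hθ
  have h2 := hM.hasDerivAt_dlog z (k := 2) (by norm_num) hθ
  have hf : HasDerivAt (M.f z) (M.f z θ * M.dlog 1 z θ) θ := by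
    have h0 := (hM.hasDerivAt_dlog z (k := 0) (by norm_num) hθ).exp
    have hexp : ∀ t ∈ M.Θ, Real.exp (M.dlog 0 z t) = M.f z t := fun t ht => by
      rw [dlog_zero, Real.exp_log (hM.density_pos z t ht)]
    rw [hexp θ (interior_subset hθ)] at h0
    refine h0.congr_of_eventuallyEq ?_
    filter_upwards [isOpen_interior.mem_nhds hθ] with t ht
    exact (hexp t (interior_subset ht)).symm
  interval_cases k
  · exact hf
  · refine (hf.mul h1).congr_deriv ?_
    simp only [densityDeriv]; ring
  · refine (hf.mul (h2.add (h1.pow 2))).congr_deriv ?_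
    simp only [densityDeriv]
    norm_num; ring

lemma iteratedDeriv_two_density (hM : M.Regular) (z : 𝒵) {θ : ℝ} (hθ : θ ∈ interior M.Θ) :
    iteratedDeriv 2 (M.f z) θ = densityDeriv M z 2 θ := by
  rw [iteratedDeriv_succ, iteratedDeriv_one]
  refine (HasDerivAt.congr_of_eventuallyEq
    (hM.hasDerivAt_densityDeriv z (k := 1) (by norm_num) hθ) ?_).deriv
  filter_upwards [isOpen_interior.mem_nhds hθ] with t ht
  exact (hM.hasDerivAt_densityDeriv z (k := 0) (by norm_num) ht).deriv

lemma exists_ball_subset (hM : M.Regular) : ∃ r > 0, Metric.ball M.θ₀ r ⊆ interior M.Θ :=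
  Metric.isOpen_iff.1 isOpen_interior _ hM.mem_interior

/-- The first two derivatives of the density at `θ₀` integrate to zero: the total mass is constant
in `θ`, and second-order difference quotients are dominated. -/
lemma integral_densityDeriv (hM : M.Regular) :
    HasMean M.ν (fun z => densityDeriv M z 1 M.θ₀) 0 ∧
      HasMean M.ν (fun z => densityDeriv M z 2 M.θ₀) 0 := by
  have := hM.isProbabilityMeasure_law
  obtain ⟨H, hH, hdom⟩ := hM.dominated
  obtain ⟨r₁, hr₁, hball⟩ := hM.exists_ball_subset
  obtain ⟨r₂, hr₂, hdom⟩ := Metric.eventually_nhds_iff_ball.1 hdom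
  set r := min r₁ r₂ with hr
  have hr0 : 0 < r := lt_min hr₁ hr₂
  have hball : Metric.ball M.θ₀ r ⊆ interior M.Θ :=
    (Metric.ball_subset_ball (min_le_left _ _)).trans hball
  have hdom : ∀ θ ∈ Metric.ball M.θ₀ r, ∀ z, |densityDeriv M z 2 θ| ≤ H z := fun θ hθ z => by
    rw [← hM.iteratedDeriv_two_density z (hball hθ)]
    exact hdom θ (Metric.ball_subset_ball (min_le_right _ _) hθ) z
  obtain ⟨B, hB0, hB, -⟩ := hM.exists_envelope
  have hmem : ∀ h : ℝ, |h| < r → M.θ₀ + h ∈ Metric.ball M.θ₀ r := fun h hh => by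
    simpa [Metric.mem_ball, Real.dist_eq] using hh
  set R : ℝ → 𝒵 → ℝ := fun h z => M.f z (M.θ₀ + h) - M.f z M.θ₀ - densityDeriv M z 1 M.θ₀ * h
    with hR
  have hRle : ∀ h, |h| < r → ∀ z, |R h z| ≤ H z * h ^ 2 := fun h hh z => by
    have := abs_sub_taylor_sum_le 2 (D := densityDeriv M z)
      (fun k hk x hx => hM.hasDerivAt_densityDeriv z (by omega) (hball hx))
      (fun x hx => hdom x hx z) (hmem h hh)
    simpa [Finset.sum_range_succ, densityDeriv, ← sub_sub, hR] using this
  have hRle3 : ∀ h, |h| < r → ∀ z, |R h z - densityDeriv M z 2 M.θ₀ / 2 * h ^ 2| ≤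
      Real.exp (B z) * (B z + 3 * B z * B z + B z ^ 3) * |h| ^ 3 := fun h hh z => by
    have := abs_sub_taylor_sum_le 3 (D := densityDeriv M z)
      (B := Real.exp (B z) * (B z + 3 * B z * B z + B z ^ 3))
      (fun k hk x hx => hM.hasDerivAt_densityDeriv z (by omega) (hball hx))
      (fun x hx => ?_) (hmem h hh)
    · refine le_trans (le_of_eq ?_) (this.trans_eq ?_)
      · simp [Finset.sum_range_succ, densityDeriv, hR]
        ring_nf
      · simp
    · have hxΘ := interior_subset (hball hx)
      have b0 := hB z x hxΘ 0 (by norm_num)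
      have b1 := hB z x hxΘ 1 (by norm_num)
      have b2 := hB z x hxΘ 2 (by norm_num)
      have b3 := hB z x hxΘ 3 (by norm_num)
      have hfle : |M.f z x| ≤ Real.exp (B z) := by
        rw [abs_of_pos (hM.density_pos z x hxΘ), ← Real.exp_log (hM.density_pos z x hxΘ),
          ← dlog_zero]
        exact Real.exp_le_exp.2 ((le_abs_self _).trans b0)
      simp only [densityDeriv]
      rw [abs_mul]
      refine mul_le_mul hfle ((abs_add_three _ _ _).trans ?_) (abs_nonneg _) (Real.exp_pos _).le
      rw [abs_mul, abs_mul, abs_pow, abs_of_pos (show (0 : ℝ) < 3 by norm_num)]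
      have := hB0 z
      gcongr
  have hi1 : Integrable (fun z => densityDeriv M z 1 M.θ₀) M.ν :=
    (hM.integrable_law_iff _).1 (hM.integrable_dlog (k := 1) (by norm_num) hM.θ₀_mem)
  have hi2 : Integrable (fun z => densityDeriv M z 2 M.θ₀) M.ν := by
    refine (hM.integrable_law_iff _).1 ((hM.integrable_dlog (by norm_num) hM.θ₀_mem).add ?_)
    exact ((hM.memLp_dlog (k := 1) (by norm_num) hM.θ₀_mem).mono_exponent
      (by norm_num)).integrable_sq
  have hRi : ∀ h, |h| < r → HasMean M.ν (R h)
      (-(∫ z, densityDeriv M z 1 M.θ₀ ∂M.ν) * h) := fun h hh => by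
    have ha := hM.hasMean_density (interior_subset (hball (hmem h hh)))
    have hb := hM.hasMean_density hM.θ₀_mem
    refine ((ha.add (hb.const_mul (-1))).add
      ((Integrable.hasMean hi1).const_mul (-h))).congr (fun z => ?_) ?_
    · simp only [hR]; ring
    · ring
  -- `h_n = r / (n + 2)` is a null sequence of admissible increments
  set hs : ℕ → ℝ := fun n => r / (n + 2) with hhs
  have hs_pos : ∀ n, 0 < hs n := fun n => by positivity
  have hs_lt : ∀ n, |hs n| < r := fun n => by
    rw [abs_of_pos (hs_pos n), hhs, div_lt_iff₀ (by positivity)]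
    have : (0 : ℝ) ≤ n := by positivity
    nlinarith
  have hs_tendsto : Tendsto hs atTop (𝓝 0) :=
    Tendsto.div_atTop tendsto_const_nhds (tendsto_atTop_add_const_right _ _
      tendsto_natCast_atTop_atTop)
  have hzero : ∫ z, densityDeriv M z 1 M.θ₀ ∂M.ν = 0 := by
    have hle : ∀ n, |∫ z, densityDeriv M z 1 M.θ₀ ∂M.ν| ≤ (∫ z, H z ∂M.ν) * hs n := fun n => by
      have h1 := hRi _ (hs_lt n)
      have h2 : |∫ z, R (hs n) z ∂M.ν| ≤ ∫ z, H z * hs n ^ 2 ∂M.ν :=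
        (abs_integral_le_integral_abs).trans (integral_mono h1.1.abs (hH.mul_const _)
          fun z => hRle _ (hs_lt n) z)
      rw [h1.2, integral_mul_const, abs_mul, abs_neg, abs_of_pos (hs_pos n), pow_two,
        ← mul_assoc] at h2
      exact le_of_mul_le_mul_right h2 (hs_pos n)
    have hlim : Tendsto (fun n => (∫ z, H z ∂M.ν) * hs n) atTop (𝓝 0) := by
      simpa using hs_tendsto.const_mul (∫ z, H z ∂M.ν)
    exact abs_eq_zero.1 (le_antisymm (ge_of_tendsto' hlim hle) (abs_nonneg _))
  refine ⟨⟨hi1, hzero⟩, hi2, ?_⟩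
  have hlim : Tendsto (fun n => ∫ z, R (hs n) z / hs n ^ 2 ∂M.ν) atTop
      (𝓝 (∫ z, densityDeriv M z 2 M.θ₀ / 2 ∂M.ν)) := by
    refine tendsto_integral_of_dominated_convergence H
      (fun n => ((hRi _ (hs_lt n)).1.div_const _).aestronglyMeasurable) hH
      (fun n => Eventually.of_forall fun z => ?_) (Eventually.of_forall fun z => ?_)
    · rw [Real.norm_eq_abs, abs_div, abs_of_pos (pow_pos (hs_pos n) 2),
        div_le_iff₀ (pow_pos (hs_pos n) 2)]
      exact hRle _ (hs_lt n) z
    · rw [tendsto_iff_norm_sub_tendsto_zero]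
      set K := Real.exp (B z) * (B z + 3 * B z * B z + B z ^ 3) with hK
      have hlim : Tendsto (fun n => K * hs n) atTop (𝓝 0) := by
        simpa using hs_tendsto.const_mul K
      refine squeeze_zero (fun n => norm_nonneg _) (fun n => ?_) hlim
      have h1 := hRle3 _ (hs_lt n) z
      have hp := hs_pos n
      rw [Real.norm_eq_abs, show R (hs n) z / hs n ^ 2 - densityDeriv M z 2 M.θ₀ / 2 =
        (R (hs n) z - densityDeriv M z 2 M.θ₀ / 2 * hs n ^ 2) / hs n ^ 2 by field_simp, abs_div,
        abs_of_pos (pow_pos hp 2), div_le_iff₀ (pow_pos hp 2)]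
      rw [abs_of_pos hp] at h1
      exact h1.trans_eq (by ring)
  have h0 : ∀ n, ∫ z, R (hs n) z / hs n ^ 2 ∂M.ν = 0 := fun n => by
    rw [integral_div, (hRi _ (hs_lt n)).2, hzero]; simp
  simp only [h0, integral_div] at hlim
  have := tendsto_nhds_unique hlim tendsto_const_nhds
  linarith

/-- The score is centred. -/
lemma integral_score (hM : M.Regular) : ∫ z, M.dlog 1 z M.θ₀ ∂M.law = 0 := by
  rw [hM.integral_law]
  exact hM.integral_densityDeriv.1.2

/-- The information identity `E[ℓ²] = -E[ℓ^θ]`. -/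
lemma integral_score_sq (hM : M.Regular) : ∫ z, M.dlog 1 z M.θ₀ ^ 2 ∂M.law = M.info := by
  have := hM.isProbabilityMeasure_law
  have h1 := hM.integrable_dlog (k := 2) (by norm_num) hM.θ₀_mem
  have h2 : Integrable (fun z => M.dlog 1 z M.θ₀ ^ 2) M.law :=
    ((hM.memLp_dlog (k := 1) (by norm_num) hM.θ₀_mem).mono_exponent (by norm_num)).integrable_sq
  have h := hM.integral_densityDeriv.2.2
  simp only [densityDeriv] at h
  rw [← hM.integral_law, integral_add h1 h2] at h
  rw [info]
  linarith

end Regular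
end ParametricModel

/-! ### Samples and consistency -/

section Sampling

lemma scaledSum_sub_const {𝒵 Ω : Type*} {Z : ℕ → Ω → 𝒵} (g : 𝒵 → ℝ) (c : ℝ)
    {s : Finset ℕ} (hs : s.Nonempty) (ω : Ω) :
    scaledSum Z (fun z => g z - c) s ω = scaledSum Z g s ω - √(s.card : ℝ) * c := by
  have h0 : 0 < √(s.card : ℝ) := Real.sqrt_pos.2 (by exact_mod_cast hs.card_pos)
  have h1 : (s.card : ℝ) = √(s.card : ℝ) * √(s.card : ℝ) :=
    (Real.mul_self_sqrt (by positivity)).symm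
  simp only [scaledSum, Finset.sum_sub_distrib, Finset.sum_const, nsmul_eq_mul]
  rw [mul_sub, ← mul_assoc]
  congr 2
  rw [inv_mul_eq_div, div_eq_iff h0.ne']
  exact h1

variable {𝒵 Ω : Type*} [MeasurableSpace 𝒵] [MeasurableSpace Ω] {μ : Measure Ω}
  {P : Measure 𝒵} {Z : ℕ → Ω → 𝒵}

/-- `Z 0, Z 1, …` are independent observations with distribution `P`. -/
structure IsIIDSample (μ : Measure Ω) (Z : ℕ → Ω → 𝒵) (P : Measure 𝒵) : Prop where
  measurable : ∀ i, Measurable (Z i)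
  iIndepFun : iIndepFun Z μ
  map_eq : ∀ i, μ.map (Z i) = P

/-- The filter on finite index sets `s` along which `|s| → ∞`. Limits along it hold uniformly over
all samples of a given size, hence for the halves of a sample as well as for the whole. -/
def sampleFilter : Filter (Finset ℕ) := comap Finset.card atTop

lemma tendsto_sampleFilter {κ : Type*} {L : Filter κ} {g : κ → Finset ℕ} :
    Tendsto g L sampleFilter ↔ Tendsto (fun k => (g k).card) L atTop := tendsto_comap_iff

lemma tendsto_sqrt_card : Tendsto (fun s : Finset ℕ => √(s.card : ℝ)) sampleFilter atTop :=
  Real.tendsto_sqrt_atTop.comp (tendsto_natCast_atTop_atTop.comp tendsto_comap)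

lemma eventually_nonempty : ∀ᶠ s : Finset ℕ in sampleFilter, s.Nonempty := by
  have : Tendsto Finset.card sampleFilter atTop := tendsto_comap
  filter_upwards [this.eventually_ge_atTop 1] with s hs
  exact Finset.card_pos.1 hs

namespace IsIIDSample

variable (hI : IsIIDSample μ Z P)
include hI

lemma measurePreserving (i : ℕ) : MeasurePreserving (Z i) μ P := ⟨hI.measurable i, hI.map_eq i⟩

lemma memLp_comp {g : 𝒵 → ℝ} {p : ENNReal} (hg : MemLp g p P) (i : ℕ) :
    MemLp (fun ω => g (Z i ω)) p μ := hg.comp_measurePreserving (hI.measurePreserving i)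

lemma integral_comp {g : 𝒵 → ℝ} (hg : AEStronglyMeasurable g P) (i : ℕ) :
    ∫ ω, g (Z i ω) ∂μ = ∫ z, g z ∂P := by
  rw [← hI.map_eq i] at hg ⊢
  exact (integral_map (hI.measurable i).aemeasurable hg).symm

lemma hasMean_comp {g : 𝒵 → ℝ} (hg : Integrable g P) (i : ℕ) :
    HasMean μ (fun ω => g (Z i ω)) (∫ z, g z ∂P) :=
  ⟨(hI.measurePreserving i).integrable_comp_of_integrable hg,
    hI.integral_comp hg.aestronglyMeasurable i⟩

lemma iIndepFun_comp {E : Type*} [MeasurableSpace E] {g : ℕ → 𝒵 → E}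
    (hg : ∀ i, AEMeasurable (g i) P) : ProbabilityTheory.iIndepFun (fun i ω => g i (Z i ω)) μ :=
  hI.iIndepFun.comp₀ g (fun i => (hI.measurable i).aemeasurable)
    fun i => by rw [hI.map_eq i]; exact hg i

lemma memLp_scaledSum {g : 𝒵 → ℝ} {p : ENNReal} (hg : MemLp g p P) (s : Finset ℕ) :
    MemLp (scaledSum Z g s) p μ :=
  (memLp_finsetSum s fun i _ => hI.memLp_comp hg i).const_mul _

variable [IsProbabilityMeasure μ]

lemma integral_scaledSum_mul {g h : 𝒵 → ℝ} (hg : MemLp g 2 P) (hh : MemLp h 2 P)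
    (hg0 : ∫ z, g z ∂P = 0) (hh0 : ∫ z, h z ∂P = 0) {s : Finset ℕ} (hs : s.Nonempty) :
    HasMean μ (fun ω => scaledSum Z g s ω * scaledSum Z h s ω) (∫ z, g z * h z ∂P) := by
  set G : Bool → 𝒵 → ℝ := fun b => if b then g else h with hG
  have hGL : ∀ b, MemLp (G b) 2 P := fun b => by cases b <;> simp [hG, hg, hh]
  have hG0 : ∀ b, ∫ z, G b z ∂P = 0 := fun b => by cases b <;> simp [hG, hg0, hh0]
  have hind := hI.iIndepFun_comp (g := fun _ z b => G b z) fun _ =>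
    aemeasurable_pi_lambda _ fun b => (hGL b).aestronglyMeasurable.aemeasurable
  have h1 := integral_sum_mul_sum hind (fun i b => hI.memLp_comp (hGL b) i)
    (fun i b => by rw [hI.integral_comp (hGL b).aestronglyMeasurable, hG0])
    (C := fun a b => ∫ z, G a z * G b z ∂P)
    (fun i a b => hI.integral_comp (g := fun z => G a z * G b z)
      ((hGL a).aestronglyMeasurable.mul (hGL b).aestronglyMeasurable) i) s true false
  have hc : (0 : ℝ) < s.card := by exact_mod_cast hs.card_pos
  refine (h1.const_mul (s.card : ℝ)⁻¹).congr (fun ω => ?_) ?_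
  · have : (s.card : ℝ)⁻¹ = (√(s.card : ℝ))⁻¹ * (√(s.card : ℝ))⁻¹ := by
      rw [← mul_inv, Real.mul_self_sqrt hc.le]
    simp only [scaledSum, hG, this]
    simp only [if_true, Bool.false_eq_true, if_false]
    ring
  · field_simp
    simp [hG]

lemma isBigOp_scaledSum {g : 𝒵 → ℝ} (hg : MemLp g 2 P) (hg0 : ∫ z, g z ∂P = 0) :
    IsBigOp μ sampleFilter (fun s => scaledSum Z g s) := by
  refine isBigOp_of_integral_sq_le (C := ∫ z, g z * g z ∂P)
    (Eventually.of_forall fun s => hI.memLp_scaledSum hg s) ?_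
  filter_upwards [eventually_nonempty] with s hs
  simp only [pow_two]
  exact (hI.integral_scaledSum_mul hg hg hg0 hg0 hs).2.le

lemma isProbabilityMeasure : IsProbabilityMeasure P := by
  rw [← hI.map_eq 0]
  exact Measure.isProbabilityMeasure_map (hI.measurable 0).aemeasurable

lemma isBigOp_scaledSum_centred {g : 𝒵 → ℝ} (hg : MemLp g 2 P) :
    IsBigOp μ sampleFilter (fun s => scaledSum Z (fun z => g z - ∫ z', g z' ∂P) s) := by
  have := hI.isProbabilityMeasure
  refine hI.isBigOp_scaledSum (hg.sub (memLp_const _)) ?_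
  rw [integral_sub (hg.integrable one_le_two) (integrable_const _)]
  simp

/-- Uniform weak law: a sum of observations with negative mean is eventually negative with high
probability. -/
lemma tendsto_measure_sum_nonneg {h : 𝒵 → ℝ} (hh : MemLp h 2 P) (hneg : ∫ z, h z ∂P < 0) :
    Tendsto (fun s : Finset ℕ => μ {ω | 0 ≤ ∑ i ∈ s, h (Z i ω)}) sampleFilter (𝓝 0) := by
  rw [ENNReal.tendsto_nhds_zero]
  intro δ hδ
  rcases eq_or_ne δ ⊤ with rfl | htop
  · simp
  obtain ⟨K, hK⟩ := hI.isBigOp_scaledSum_centred hh δ.toReal (ENNReal.toReal_pos hδ.ne' htop)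
  rw [ENNReal.ofReal_toReal htop] at hK
  filter_upwards [hK, eventually_nonempty,
    tendsto_sqrt_card.eventually_gt_atTop (K / -∫ z, h z ∂P)] with s h1 hs h2
  refine (measure_mono ?_).trans h1
  intro ω (hω : 0 ≤ ∑ i ∈ s, h (Z i ω))
  change K < |scaledSum Z (fun z => h z - ∫ z', h z' ∂P) s ω|
  rw [scaledSum_sub_const _ _ hs]
  rw [div_lt_iff₀ (by linarith)] at h2
  have : 0 ≤ scaledSum Z h s ω := mul_nonneg (by positivity) hω
  exact lt_of_lt_of_le (by linarith) (le_abs_self _)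

end IsIIDSample

end Sampling

namespace ParametricModel

variable {𝒵 Ω : Type*} [MeasurableSpace 𝒵] [MeasurableSpace Ω] {M : ParametricModel 𝒵}

/-- Wald's device: near `θ' ≠ θ₀` the log likelihood ratio is dominated by one function of the
observation with negative mean. The supremum over a neighbourhood is taken along a dense sequence of
parameters, to keep it measurable. -/
lemma Regular.exists_dominating (hM : M.Regular) {θ' : ℝ} (hθ' : θ' ∈ M.Θ) (hne : θ' ≠ M.θ₀) :
    ∃ δ > 0, ∃ h : 𝒵 → ℝ, MemLp h 2 M.law ∧ ∫ z, h z ∂M.law < 0 ∧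
      ∀ z, ∀ θ ∈ M.Θ, dist θ θ' < δ → M.dlog 0 z θ - M.dlog 0 z M.θ₀ ≤ h z := by
  have := hM.isProbabilityMeasure_law
  obtain ⟨B, hB0, hB, hBL⟩ := hM.exists_envelope
  have hBL2 : MemLp B 2 M.law := hBL.mono_exponent (by norm_num)
  have : Nonempty M.Θ := ⟨⟨θ', hθ'⟩⟩
  set d : ℕ → M.Θ := TopologicalSpace.denseSeq M.Θ with hd
  have hcont : ∀ z, ContinuousOn (M.dlog 0 z) M.Θ := fun z =>
    (hM.contDiffOn_log z).continuousOn.congr fun θ _ => dlog_zero z θ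
  have hmeas : ∀ θ ∈ M.Θ, Measurable fun z => M.dlog 0 z θ := fun θ hθ => by
    simp only [dlog_zero]
    exact (hM.measurable_density θ hθ).log
  set η : ℕ → ℝ := fun k => 1 / ((k : ℝ) + 1) with hη
  have hη0 : ∀ k, 0 < η k := fun k => by positivity
  set t : ℕ → ℕ → 𝒵 → ℝ := fun k n z =>
    if dist (d n : ℝ) θ' < η k then M.dlog 0 z (d n) else M.dlog 0 z θ' with ht
  have htB : ∀ k n z, |t k n z| ≤ B z := fun k n z => by
    simp only [ht]
    split_ifs
    · exact hB z _ (d n).2 0 (by norm_num)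
    · exact hB z _ hθ' 0 (by norm_num)
  have hbdd : ∀ k z, BddAbove (Set.range fun n => t k n z) := fun k z =>
    ⟨B z, by rintro _ ⟨n, rfl⟩; exact (le_abs_self _).trans (htB k n z)⟩
  set G : ℕ → 𝒵 → ℝ := fun k z => ⨆ n, t k n z with hG
  have hGB : ∀ k z, |G k z| ≤ B z := fun k z => abs_le.2
    ⟨(abs_le.1 (htB k 0 z)).1.trans (le_ciSup (hbdd k z) 0),
      ciSup_le fun n => (le_abs_self _).trans (htB k n z)⟩
  have hGm : ∀ k, Measurable (G k) := fun k => Measurable.iSup fun n => by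
    simp only [ht]
    split_ifs
    · exact hmeas _ (d n).2
    · exact hmeas _ hθ'
  have hGlim : ∀ z, Tendsto (fun k => G k z) atTop (𝓝 (M.dlog 0 z θ')) := fun z => by
    rw [Metric.tendsto_atTop]
    intro ε hε
    obtain ⟨δ, hδ, hclose⟩ := Metric.continuousOn_iff.1 (hcont z) θ' hθ' (ε / 2) (by positivity)
    have hηlim : ∀ᶠ k in atTop, η k < δ :=
      tendsto_one_div_add_atTop_nhds_zero_nat.eventually_lt_const hδ
    obtain ⟨N, hN⟩ := eventually_atTop.1 hηlim
    refine ⟨N, fun k hk => ?_⟩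
    have hterm : ∀ n, |t k n z - M.dlog 0 z θ'| ≤ ε / 2 := fun n => by
      simp only [ht]
      split_ifs with hc
      · exact (hclose _ (d n).2 (hc.trans (hN k hk))).le
      · simp; positivity
    rw [Real.dist_eq]
    refine lt_of_le_of_lt (abs_le.2 ⟨?_, ?_⟩) (half_lt_self hε)
    · linarith [(abs_le.1 (hterm 0)).1, le_ciSup (hbdd k z) 0]
    · have : G k z ≤ M.dlog 0 z θ' + ε / 2 := ciSup_le fun n => by
        linarith [(abs_le.1 (hterm n)).2]
      linarith
  have hlim := tendsto_integral_of_dominated_convergence (μ := M.law) B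
    (fun k => (hGm k).aestronglyMeasurable) (hBL2.integrable one_le_two)
    (fun k => Eventually.of_forall fun z => hGB k z) (Eventually.of_forall hGlim)
  obtain ⟨k, hk⟩ := (hlim.eventually_lt_const (hM.integral_log_lt hθ' hne)).exists
  have hGL : MemLp (G k) 2 M.law := hBL2.mono (hGm k).aestronglyMeasurable
    (Eventually.of_forall fun z => (hGB k z).trans (le_abs_self _))
  have h0L : MemLp (fun z => M.dlog 0 z M.θ₀) 2 M.law :=
    (hM.memLp_dlog (k := 0) (by norm_num) hM.θ₀_mem).mono_exponent (by norm_num)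
  refine ⟨η k, hη0 k, fun z => G k z - M.dlog 0 z M.θ₀, hGL.sub h0L, ?_, fun z θ hθ hdist => ?_⟩
  · rw [integral_sub (hGL.integrable one_le_two) (h0L.integrable one_le_two)]
    linarith
  · have hle : M.dlog 0 z θ ≤ G k z := by
      by_contra! hlt
      have hc : Continuous fun x : M.Θ => M.dlog 0 z x :=
        continuousOn_iff_continuous_domRestrict.1 (hcont z)
      have hopen : IsOpen {x : M.Θ | dist (x : ℝ) θ' < η k ∧ G k z < M.dlog 0 z x} :=
        (isOpen_lt (continuous_subtype_val.dist continuous_const) continuous_const).inter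
          (isOpen_lt continuous_const hc)
      obtain ⟨n, hn⟩ := (TopologicalSpace.denseRange_denseSeq M.Θ).exists_mem_open hopen
        ⟨⟨θ, hθ⟩, hdist, hlt⟩
      have h1 : t k n z ≤ G k z := le_ciSup (hbdd k z) n
      simp only [ht] at h1
      rw [if_pos hn.1] at h1
      exact absurd hn.2 (not_lt.2 h1)
    linarith

/-- Consistency of the maximum likelihood estimators, uniformly over samples of a given size. -/
theorem Regular.tendstoInMeasure_mle (hM : M.Regular) {μ : Measure Ω} [IsProbabilityMeasure μ]
    {Z : ℕ → Ω → 𝒵} (hI : IsIIDSample μ Z M.law) {θhat : Finset ℕ → Ω → ℝ}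
    (hθhat : ∀ s : Finset ℕ, s.Nonempty → M.IsMLE μ Z s (θhat s)) :
    TendstoInMeasure μ (fun s ω => θhat s ω - M.θ₀) sampleFilter (fun _ => 0) := by
  rw [tendstoInMeasure_iff_norm]
  intro r hr
  set A : Set ℝ := M.Θ \ Metric.ball M.θ₀ r with hA
  have hcomp : IsCompact A := hM.isCompact.diff Metric.isOpen_ball
  have key : Tendsto (fun s => μ {ω | θhat s ω ∈ A}) sampleFilter (𝓝 0) := by
    refine hcomp.induction_on (p := fun A => Tendsto (fun s => μ {ω | θhat s ω ∈ A})
      sampleFilter (𝓝 0)) (by simpa using tendsto_const_nhds) ?_ ?_ ?_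
    · intro A₁ A₂ h12 h2
      exact tendsto_of_tendsto_of_tendsto_of_le_of_le tendsto_const_nhds h2 (fun _ => zero_le)
        fun s => measure_mono fun ω hω => h12 hω
    · intro A₁ A₂ h1 h2
      have h3 := h1.add h2
      rw [add_zero] at h3
      exact tendsto_of_tendsto_of_tendsto_of_le_of_le tendsto_const_nhds h3 (fun _ => zero_le)
        fun s => measure_union_le _ _
    · intro θ' hθ'
      have hne : θ' ≠ M.θ₀ := fun h => hθ'.2 (by rw [h]; exact Metric.mem_ball_self hr)
      obtain ⟨δ, hδ, h, hL, hneg, hdom⟩ := hM.exists_dominating hθ'.1 hne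
      refine ⟨Metric.ball θ' δ ∩ A, inter_mem (mem_nhdsWithin_of_mem_nhds
        (Metric.ball_mem_nhds _ hδ)) self_mem_nhdsWithin, ?_⟩
      refine tendsto_of_tendsto_of_tendsto_of_le_of_le' tendsto_const_nhds
        (hI.tendsto_measure_sum_nonneg hL hneg) (Eventually.of_forall fun _ => zero_le) ?_
      filter_upwards [eventually_nonempty] with s hs
      refine measure_mono_ae ?_
      filter_upwards [hθhat s hs] with ω hω hmem
      have hmax := hω.1 hM.θ₀_mem
      simp only [Set.mem_ofPred_eq, ← dlog_zero] at hmax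
      have hc : (0 : ℝ) < (s.card : ℝ)⁻¹ := inv_pos.2 (by exact_mod_cast hs.card_pos)
      have hmax' := le_of_mul_le_mul_left hmax hc
      have hsum : ∑ i ∈ s, (M.dlog 0 (Z i ω) (θhat s ω) - M.dlog 0 (Z i ω) M.θ₀) ≤
          ∑ i ∈ s, h (Z i ω) := Finset.sum_le_sum fun i _ => hdom _ _ hω.2 hmem.1
      rw [Finset.sum_sub_distrib] at hsum
      change 0 ≤ ∑ i ∈ s, h (Z i ω)
      linarith
  refine tendsto_of_tendsto_of_tendsto_of_le_of_le' tendsto_const_nhds key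
    (Eventually.of_forall fun _ => zero_le) ?_
  filter_upwards [eventually_nonempty] with s hs
  refine measure_mono_ae ?_
  filter_upwards [hθhat s hs] with ω hω hmem
  refine ⟨hω.2, fun hball => ?_⟩
  have h1 : r ≤ ‖θhat s ω - M.θ₀ - 0‖ := hmem
  rw [Metric.mem_ball, Real.dist_eq] at hball
  rw [sub_zero, Real.norm_eq_abs] at h1
  linarith

end ParametricModel

/-! ### Inversion of the score equation -/

section Inversion

/-- A root `δ` of the expanded score equation is bounded when `e` and `e δ` are small: the linear
term `-I δ` dominates all terms of higher order. -/
lemma exists_bound_root {I : ℝ} (hI : 0 < I) (Q₁ Q₂ K : ℝ) (hK : 0 < K) :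
    ∃ η > 0, η ≤ 1 ∧ ∀ e U V W T δ ρ : ℝ, 0 < e → e ≤ η → |e * δ| ≤ η → |U| ≤ K → |V| ≤ K →
      |W| ≤ K → |T| ≤ K → |ρ| ≤ K →
      U + (-I + e * V) * δ + 1 / 2 * (Q₁ + e * W) * (e * δ ^ 2)
        + 1 / 6 * (Q₂ + e * T) * (e ^ 2 * δ ^ 3) + ρ * (e ^ 3 * δ ^ 4) = 0 →
      |δ| ≤ 2 * K / I := by
  set S : ℝ := 4 * K + |Q₁| + |Q₂| with hS
  have hS0 : 0 < S := by positivity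
  set η : ℝ := min 1 (I / (2 * S)) with hη
  have hη0 : 0 < η := lt_min one_pos (by positivity)
  have hη1 : η ≤ 1 := min_le_left _ _
  have hηS : η * S ≤ I / 2 := by
    have : η ≤ I / (2 * S) := min_le_right _ _
    rw [le_div_iff₀ (by positivity)] at this
    linarith
  refine ⟨η, hη0, hη1, fun e U V W T δ ρ he heη heδ hU hV hW hT hρ heq => ?_⟩
  have he1 : e ≤ 1 := heη.trans hη1
  set c : ℝ := e * V + 1 / 2 * (Q₁ + e * W) * (e * δ) + 1 / 6 * (Q₂ + e * T) * (e * δ) ^ 2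
    + ρ * (e * δ) ^ 3 with hc
  have hcle : |c| ≤ η * S := by
    have hx1 : |e * δ| ≤ 1 := heδ.trans hη1
    have hx2 : |e * δ| ^ 2 ≤ η := by
      rw [pow_two]; nlinarith [abs_nonneg (e * δ)]
    have hx3 : |e * δ| ^ 3 ≤ η := by
      rw [pow_succ]; nlinarith [abs_nonneg (e * δ), pow_nonneg (abs_nonneg (e * δ)) 2]
    have b1 : |e * V| ≤ η * K := by
      rw [abs_mul, abs_of_pos he]; gcongr
    have bb : ∀ q w : ℝ, |w| ≤ K → |q + e * w| ≤ |q| + K := fun q w hw => by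
      refine (abs_add_le _ _).trans (by
        rw [abs_mul, abs_of_pos he]; nlinarith [abs_nonneg w])
    have b2 : |1 / 2 * (Q₁ + e * W) * (e * δ)| ≤ (|Q₁| + K) * η := by
      rw [abs_mul, abs_mul, abs_of_pos (show (0 : ℝ) < 1 / 2 by norm_num)]
      refine mul_le_mul ?_ heδ (abs_nonneg _) (by positivity)
      linarith [bb Q₁ W hW, abs_nonneg (Q₁ + e * W)]
    have b3 : |1 / 6 * (Q₂ + e * T) * (e * δ) ^ 2| ≤ (|Q₂| + K) * η := by
      rw [abs_mul, abs_mul, abs_of_pos (show (0 : ℝ) < 1 / 6 by norm_num), abs_pow]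
      refine mul_le_mul ?_ hx2 (by positivity) (by positivity)
      linarith [bb Q₂ T hT, abs_nonneg (Q₂ + e * T)]
    have b4 : |ρ * (e * δ) ^ 3| ≤ K * η := by
      rw [abs_mul, abs_pow]
      exact mul_le_mul hρ hx3 (by positivity) hK.le
    calc |c| ≤ η * K + (|Q₁| + K) * η + (|Q₂| + K) * η + K * η :=
          (abs_add_le _ _).trans (add_le_add ((abs_add_le _ _).trans
            (add_le_add ((abs_add_le _ _).trans (add_le_add b1 b2)) b3)) b4)
      _ = η * S := by rw [hS]; ring
  have h1 : I * δ = U + δ * c := by rw [hc]; linear_combination -heq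
  have h2 : I * |δ| ≤ K + |δ| * (I / 2) := by
    calc I * |δ| = |I * δ| := by rw [abs_mul, abs_of_pos hI]
      _ ≤ |U| + |δ| * |c| := by rw [h1, ← abs_mul]; exact abs_add_le _ _
      _ ≤ K + |δ| * (I / 2) := by
        have := hcle.trans hηS
        gcongr
  rw [le_div_iff₀ hI]
  linarith

/-- The root is expanded by substituting the score equation into itself three times:
`δ = a₁ + e r₁`, `r₁ = a₂ + e r₂` and `r₂ = a₃ + e r₃`, with explicit polynomial remainders. -/
lemma root_sub_expansion_eq {I : ℝ} (hI : I ≠ 0) {Q₁ Q₂ e U V W T δ ρ a₁ a₂ r₁ r₂ r₃ : ℝ}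
    (heq : U + (-I + e * V) * δ + 1 / 2 * (Q₁ + e * W) * (e * δ ^ 2)
        + 1 / 6 * (Q₂ + e * T) * (e ^ 2 * δ ^ 3) + ρ * (e ^ 3 * δ ^ 4) = 0)
    (h1 : I * a₁ = U) (h2 : I * a₂ = V * a₁ + 1 / 2 * Q₁ * a₁ ^ 2)
    (hr₁ : I * r₁ = V * δ + 1 / 2 * Q₁ * δ ^ 2 + e * (1 / 2 * W * δ ^ 2 + 1 / 6 * Q₂ * δ ^ 3)
      + e ^ 2 * (1 / 6 * T * δ ^ 3 + ρ * δ ^ 4))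
    (hr₂ : I * r₂ = V * r₁ + 1 / 2 * Q₁ * (r₁ * (δ + a₁)) + 1 / 2 * W * δ ^ 2 + 1 / 6 * Q₂ * δ ^ 3
      + e * (1 / 6 * T * δ ^ 3 + ρ * δ ^ 4))
    (hr₃ : I * r₃ = V * r₂ + 1 / 2 * Q₁ * (a₂ * r₁ + 2 * a₁ * r₂ + e * (r₁ * r₂))
      + 1 / 2 * W * (r₁ * (δ + a₁)) + 1 / 6 * Q₂ * (r₁ * (δ ^ 2 + δ * a₁ + a₁ ^ 2))
      + 1 / 6 * T * δ ^ 3 + ρ * δ ^ 4) :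
    δ - (I⁻¹ * U + (1 / 2 * I⁻¹ ^ 3 * Q₁ * U ^ 2 + I⁻¹ ^ 2 * U * V) * e
      + (1 / 6 * I⁻¹ ^ 4 * Q₂ * U ^ 3 + 1 / 2 * I⁻¹ ^ 5 * Q₁ ^ 2 * U ^ 3
        + 3 / 2 * I⁻¹ ^ 4 * Q₁ * U ^ 2 * V + 1 / 2 * I⁻¹ ^ 3 * U ^ 2 * W
        + I⁻¹ ^ 3 * U * V ^ 2) * e ^ 2) = e ^ 3 * r₃ := by
  have e1 : δ = a₁ + e * r₁ := by
    refine mul_left_cancel₀ hI ?_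
    linear_combination -heq - h1 - e * hr₁
  have e2 : r₁ = a₂ + e * r₂ := by
    refine mul_left_cancel₀ hI ?_
    linear_combination hr₁ - h2 - e * hr₂ + (V + 1 / 2 * Q₁ * (δ + a₁)) * e1
  obtain ⟨a₃, h3⟩ : ∃ a₃, I * a₃ = V * a₂ + Q₁ * a₁ * a₂ + 1 / 2 * W * a₁ ^ 2
      + 1 / 6 * Q₂ * a₁ ^ 3 := ⟨_, mul_div_cancel₀ _ hI⟩
  have e3 : r₂ = a₃ + e * r₃ := by
    refine mul_left_cancel₀ hI ?_
    linear_combination hr₂ - h3 - e * hr₃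
      + (V + 1 / 2 * Q₁ * (2 * a₁ + e * r₁)) * e2
      + (1 / 2 * Q₁ * r₁ + 1 / 2 * W * (δ + a₁) + 1 / 6 * Q₂ * (δ ^ 2 + δ * a₁ + a₁ ^ 2)) * e1
  have h1' : a₁ = I⁻¹ * U := by rw [← h1]; field_simp
  have h2' : a₂ = I⁻¹ * (V * a₁ + 1 / 2 * Q₁ * a₁ ^ 2) := by rw [← h2]; field_simp
  have h3' : a₃ = I⁻¹ * (V * a₂ + Q₁ * a₁ * a₂ + 1 / 2 * W * a₁ ^ 2 + 1 / 6 * Q₂ * a₁ ^ 3) := by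
    rw [← h3]; field_simp
  rw [h2', h1'] at h3'
  rw [h1'] at h2' e1
  linear_combination e1 + e * e2 + e ^ 2 * e3 + e ^ 2 * h3' + e * h2'

/-- Inversion of the stochastic Taylor expansion of the score equation. With `e = n^{-1/2}` and
`δ = √n (θ̂ - θ₀)`, a root `δ` of the expanded equation, with coefficients bounded by `K` and with
`e` and `e δ` small, agrees with the third-order polynomial in `e` up to `O(e³)`. -/
lemma exists_bound_root_sub_expansion {I : ℝ} (hI : 0 < I) (Q₁ Q₂ K : ℝ) (hK : 0 < K) :
    ∃ η > 0, ∃ C : ℝ, ∀ e U V W T δ ρ : ℝ, 0 < e → e ≤ η → |e * δ| ≤ η → |U| ≤ K → |V| ≤ K →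
      |W| ≤ K → |T| ≤ K → |ρ| ≤ K →
      U + (-I + e * V) * δ + 1 / 2 * (Q₁ + e * W) * (e * δ ^ 2)
        + 1 / 6 * (Q₂ + e * T) * (e ^ 2 * δ ^ 3) + ρ * (e ^ 3 * δ ^ 4) = 0 →
      |δ - (I⁻¹ * U + (1 / 2 * I⁻¹ ^ 3 * Q₁ * U ^ 2 + I⁻¹ ^ 2 * U * V) * e
        + (1 / 6 * I⁻¹ ^ 4 * Q₂ * U ^ 3 + 1 / 2 * I⁻¹ ^ 5 * Q₁ ^ 2 * U ^ 3
          + 3 / 2 * I⁻¹ ^ 4 * Q₁ * U ^ 2 * V + 1 / 2 * I⁻¹ ^ 3 * U ^ 2 * W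
          + I⁻¹ ^ 3 * U * V ^ 2) * e ^ 2)| ≤ C * e ^ 3 := by
  obtain ⟨η, hη0, hη1, hroot⟩ := exists_bound_root hI Q₁ Q₂ K hK
  -- the last remainder is continuous in the bounded quantities `p = (e, U, V, W, T, δ, ρ)`
  let a₁ : (Fin 7 → ℝ) → ℝ := fun p => I⁻¹ * p 1
  let a₂ : (Fin 7 → ℝ) → ℝ := fun p => I⁻¹ * (p 2 * a₁ p + 1 / 2 * Q₁ * a₁ p ^ 2)
  let r₁ : (Fin 7 → ℝ) → ℝ := fun p => I⁻¹ * (p 2 * p 5 + 1 / 2 * Q₁ * p 5 ^ 2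
    + p 0 * (1 / 2 * p 3 * p 5 ^ 2 + 1 / 6 * Q₂ * p 5 ^ 3)
    + p 0 ^ 2 * (1 / 6 * p 4 * p 5 ^ 3 + p 6 * p 5 ^ 4))
  let r₂ : (Fin 7 → ℝ) → ℝ := fun p => I⁻¹ * (p 2 * r₁ p + 1 / 2 * Q₁ * (r₁ p * (p 5 + a₁ p))
    + 1 / 2 * p 3 * p 5 ^ 2 + 1 / 6 * Q₂ * p 5 ^ 3
    + p 0 * (1 / 6 * p 4 * p 5 ^ 3 + p 6 * p 5 ^ 4))
  let r₃ : (Fin 7 → ℝ) → ℝ := fun p => I⁻¹ * (p 2 * r₂ p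
    + 1 / 2 * Q₁ * (a₂ p * r₁ p + 2 * a₁ p * r₂ p + p 0 * (r₁ p * r₂ p))
    + 1 / 2 * p 3 * (r₁ p * (p 5 + a₁ p))
    + 1 / 6 * Q₂ * (r₁ p * (p 5 ^ 2 + p 5 * a₁ p + a₁ p ^ 2))
    + 1 / 6 * p 4 * p 5 ^ 3 + p 6 * p 5 ^ 4)
  have c1 : Continuous a₁ := by unfold a₁; fun_prop
  have c2 : Continuous a₂ := by unfold a₂; fun_prop
  have d1 : Continuous r₁ := by unfold r₁; fun_prop
  have d2 : Continuous r₂ := by unfold r₂; fun_prop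
  have hcont : Continuous r₃ := by unfold r₃; fun_prop
  set D : ℝ := 1 + K + 2 * K / I with hD
  have hKI : 0 < 2 * K / I := by positivity
  obtain ⟨C, hC⟩ := (isCompact_Icc (a := fun _ : Fin 7 => -D)
    (b := fun _ => D)).exists_bound_of_continuousOn hcont.continuousOn
  refine ⟨η, hη0, C, fun e U V W T δ ρ he heη heδ hU hV hW hT hρ heq => ?_⟩
  have hδ := hroot e U V W T δ ρ he heη heδ hU hV hW hT hρ heq
  have he1 : |e| ≤ 1 := (abs_of_pos he).trans_le (heη.trans hη1)
  have hpD : ∀ i, |(![e, U, V, W, T, δ, ρ] : Fin 7 → ℝ) i| ≤ D := by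
    intro i
    fin_cases i <;> simp <;> linarith
  have h3 := hC ![e, U, V, W, T, δ, ρ]
    ⟨fun i => (abs_le.1 (hpD i)).1, fun i => (abs_le.1 (hpD i)).2⟩
  rw [root_sub_expansion_eq hI.ne' heq (mul_inv_cancel_left₀ hI.ne' _)
    (mul_inv_cancel_left₀ hI.ne' _) (mul_inv_cancel_left₀ hI.ne' _)
    (mul_inv_cancel_left₀ hI.ne' _) (mul_inv_cancel_left₀ hI.ne' _), abs_mul,
    abs_of_pos (pow_pos he 3), mul_comm]
  exact mul_le_mul_of_nonneg_right h3 (by positivity)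

end Inversion

/-! ### The third-order expansion of the estimator -/

namespace ParametricModel

variable {𝒵 Ω : Type*} [MeasurableSpace 𝒵] [MeasurableSpace Ω] {M : ParametricModel 𝒵}

namespace Regular

lemma memLp_U (hM : M.Regular) : MemLp M.U 16 M.law := hM.memLp_dlog (by norm_num) hM.θ₀_mem

lemma memLp_V (hM : M.Regular) : MemLp M.V 16 M.law :=
  have := hM.isProbabilityMeasure_law
  (hM.memLp_dlog (by norm_num) hM.θ₀_mem).sub (memLp_const _)

lemma memLp_W (hM : M.Regular) : MemLp M.W 16 M.law :=
  have := hM.isProbabilityMeasure_law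
  (hM.memLp_dlog (by norm_num) hM.θ₀_mem).sub (memLp_const _)

lemma integral_U (hM : M.Regular) : ∫ z, M.U z ∂M.law = 0 := hM.integral_score

lemma integral_V (hM : M.Regular) : ∫ z, M.V z ∂M.law = 0 := by
  have := hM.isProbabilityMeasure_law
  simp only [V]
  rw [integral_sub (hM.integrable_dlog (by norm_num) hM.θ₀_mem) (integrable_const _)]
  simp

lemma integral_W (hM : M.Regular) : ∫ z, M.W z ∂M.law = 0 := by
  have := hM.isProbabilityMeasure_law
  simp only [W]
  rw [integral_sub (hM.integrable_dlog (by norm_num) hM.θ₀_mem) (integrable_const _)]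
  simp

/-- The score equation at an interior maximum likelihood estimate. -/
lemma sum_score_eq_zero (hM : M.Regular) {s : Finset ℕ} (hs : s.Nonempty) {z : ℕ → 𝒵} {t : ℝ}
    (ht : t ∈ interior M.Θ)
    (hmax : IsMaxOn (fun θ => (s.card : ℝ)⁻¹ * ∑ i ∈ s, Real.log (M.f (z i) θ)) M.Θ t) :
    ∑ i ∈ s, M.dlog 1 (z i) t = 0 := by
  have hloc := hmax.isLocalMax (mem_interior_iff_mem_nhds.1 ht)
  have hd : HasDerivAt (fun θ => (s.card : ℝ)⁻¹ * ∑ i ∈ s, Real.log (M.f (z i) θ))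
      ((s.card : ℝ)⁻¹ * ∑ i ∈ s, M.dlog 1 (z i) t) t := by
    simp only [← dlog_zero]
    exact (HasDerivAt.fun_sum fun i _ => hM.hasDerivAt_dlog (z i) (by norm_num) ht).const_mul _
  have hc : (s.card : ℝ)⁻¹ ≠ 0 := inv_ne_zero (by exact_mod_cast hs.card_pos.ne')
  exact (mul_eq_zero.1 (hloc.hasDerivAt_eq_zero hd)).resolve_left hc

/-- The expansion of the score equation in terms of the normalised sums, with `e = n^{-1/2}`,
`δ = √n (t - θ₀)` and a remainder coefficient `ρ` controlled by the average of the envelope. -/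
lemma exists_expanded_score (hM : M.Regular) {B : 𝒵 → ℝ}
    (hB : ∀ z, ∀ θ ∈ M.Θ, ∀ k ≤ 7, |M.dlog k z θ| ≤ B z) {r : ℝ}
    (hr : Metric.ball M.θ₀ r ⊆ interior M.Θ) {Ω : Type*} (Z : ℕ → Ω → 𝒵)
    {s : Finset ℕ} (hs : s.Nonempty) {ω : Ω} {t e : ℝ} (ht : t ∈ Metric.ball M.θ₀ r)
    (he : e = (√(s.card : ℝ))⁻¹)
    (hscore : ∑ i ∈ s, M.dlog 1 (Z i ω) t = 0) :
    ∃ ρ : ℝ, |ρ| ≤ |(s.card : ℝ)⁻¹ * ∑ i ∈ s, B (Z i ω)| ∧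
      scaledSum Z M.U s ω
        + (-M.info + e * scaledSum Z M.V s ω) * (√(s.card : ℝ) * (t - M.θ₀))
        + 1 / 2 * (M.Q₁ + e * scaledSum Z M.W s ω) * (e * (√(s.card : ℝ) * (t - M.θ₀)) ^ 2)
        + 1 / 6 * (M.Q₂ + e * scaledSum Z (fun z => M.dlog 4 z M.θ₀ - M.Q₂) s ω)
          * (e ^ 2 * (√(s.card : ℝ) * (t - M.θ₀)) ^ 3)
        + ρ * (e ^ 3 * (√(s.card : ℝ) * (t - M.θ₀)) ^ 4) = 0 := by
  set h : ℝ := t - M.θ₀ with hh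
  set n : ℝ := (s.card : ℝ) with hn
  have hn0 : 0 < n := by rw [hn]; exact_mod_cast hs.card_pos
  have hq0 : 0 < √n := Real.sqrt_pos.2 hn0
  have hqq : √n * √n = n := Real.mul_self_sqrt hn0.le
  set R : 𝒵 → ℝ := fun z => M.dlog 1 z t - (M.U z + M.dlog 2 z M.θ₀ * h
    + M.dlog 3 z M.θ₀ * h ^ 2 / 2 + M.dlog 4 z M.θ₀ * h ^ 3 / 6) with hR
  have hRle : ∀ z, |R z| ≤ B z * |h| ^ 4 := fun z => by
    have := abs_sub_taylor_sum_le 4 (D := fun k => M.dlog (k + 1) z)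
      (fun k hk x hx => hM.hasDerivAt_dlog z (by omega) (hr hx))
      (fun x hx => hB z x (interior_subset (hr hx)) 5 (by norm_num)) ht
    simpa [Finset.sum_range_succ, Nat.factorial, hR, U] using this
  have hsumR : |∑ i ∈ s, R (Z i ω)| ≤ (∑ i ∈ s, B (Z i ω)) * |h| ^ 4 := by
    rw [Finset.sum_mul]
    exact (Finset.abs_sum_le_sum_abs _ _).trans (Finset.sum_le_sum fun i _ => hRle _)
  -- for `h = 0` the remainder vanishes, and the junk value `0 / 0 = 0` is the right coefficient
  refine ⟨n⁻¹ * (∑ i ∈ s, R (Z i ω)) / h ^ 4, ?_, ?_⟩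
  · rcases eq_or_ne h 0 with h0 | h0
    · rw [h0, zero_pow four_ne_zero, div_zero, abs_zero]
      exact abs_nonneg _
    · rw [abs_div, abs_mul, abs_mul, div_le_iff₀ (by positivity), mul_assoc]
      refine mul_le_mul_of_nonneg_left (hsumR.trans ?_) (abs_nonneg _)
      rw [abs_pow]
      exact mul_le_mul_of_nonneg_right (le_abs_self _) (by positivity)
  have hρ : n⁻¹ * (∑ i ∈ s, R (Z i ω)) / h ^ 4 * h ^ 4 = n⁻¹ * ∑ i ∈ s, R (Z i ω) := by
    rcases eq_or_ne h 0 with h0 | h0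
    · have : ∑ i ∈ s, R (Z i ω) = 0 := by simpa [h0] using hsumR
      simp [this]
    · rw [div_mul_cancel₀ _ (pow_ne_zero 4 h0)]
  set ρ : ℝ := n⁻¹ * (∑ i ∈ s, R (Z i ω)) / h ^ 4 with hρdef
  have hsum : ∑ i ∈ s, R (Z i ω) = -(∑ i ∈ s, M.U (Z i ω) + (∑ i ∈ s, M.dlog 2 (Z i ω) M.θ₀) * h
      + (∑ i ∈ s, M.dlog 3 (Z i ω) M.θ₀) * h ^ 2 / 2
      + (∑ i ∈ s, M.dlog 4 (Z i ω) M.θ₀) * h ^ 3 / 6) := by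
    simp only [hR, Finset.sum_sub_distrib, Finset.sum_add_distrib, hscore, Finset.sum_mul,
      Finset.sum_div]
    ring
  have hav : ∀ g : 𝒵 → ℝ, ∀ c : ℝ,
      √n * (c + e * scaledSum Z (fun z => g z - c) s ω) = (√n)⁻¹ * ∑ i ∈ s, g (Z i ω) :=
    fun g c => by
      rw [scaledSum_sub_const _ _ hs, he, ← hn, scaledSum, ← hn]
      field_simp
      ring
  have hV : √n * (-M.info + e * scaledSum Z M.V s ω) =
      (√n)⁻¹ * ∑ i ∈ s, M.dlog 2 (Z i ω) M.θ₀ := by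
    rw [← hav (fun z => M.dlog 2 z M.θ₀) (-M.info)]
    simp only [info, neg_neg]
    rfl
  have hW : √n * (M.Q₁ + e * scaledSum Z M.W s ω) =
      (√n)⁻¹ * ∑ i ∈ s, M.dlog 3 (Z i ω) M.θ₀ := by
    rw [← hav (fun z => M.dlog 3 z M.θ₀) M.Q₁]; rfl
  have hT := hav (fun z => M.dlog 4 z M.θ₀) M.Q₂
  have hU : scaledSum Z M.U s ω = (√n)⁻¹ * ∑ i ∈ s, M.U (Z i ω) := rfl
  have heq1 : e * √n = 1 := by rw [he]; exact inv_mul_cancel₀ hq0.ne'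
  have hinv : n⁻¹ * √n = (√n)⁻¹ := by
    rw [inv_mul_eq_div, ← hqq, Real.sqrt_mul_self hq0.le, div_mul_cancel_left₀ hq0.ne']
  calc _ = scaledSum Z M.U s ω + √n * (-M.info + e * scaledSum Z M.V s ω) * h
        + 1 / 2 * (√n * (M.Q₁ + e * scaledSum Z M.W s ω)) * h ^ 2 * (e * √n)
        + 1 / 6 * (√n * (M.Q₂ + e * scaledSum Z (fun z => M.dlog 4 z M.θ₀ - M.Q₂) s ω)) * h ^ 3
          * (e * √n) ^ 2
        + √n * (ρ * h ^ 4) * (e * √n) ^ 3 := by ring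
    _ = 0 := by
        rw [hV, hW, hT, hU, hρ, hsum, heq1, ← hinv]; ring

/-- The third-order expansion of maximum likelihood estimators, uniformly over samples of a given
size. -/
theorem expansion_mle (hM : M.Regular) {μ : Measure Ω} [IsProbabilityMeasure μ]
    {Z : ℕ → Ω → 𝒵} (hI : IsIIDSample μ Z M.law) {θhat : Finset ℕ → Ω → ℝ}
    (hθhat : ∀ s : Finset ℕ, s.Nonempty → M.IsMLE μ Z s (θhat s)) :
    TendstoInMeasure μ (fun s ω => (s.card : ℝ) * (√(s.card : ℝ) * (θhat s ω - M.θ₀)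
      - (M.A₁ Z s ω + M.A₂ Z s ω / √(s.card : ℝ) + M.A₃ Z s ω / (s.card : ℝ))))
      sampleFilter (fun _ => 0) := by
  have := hM.isProbabilityMeasure_law
  obtain ⟨B, hB0, hB, hBL⟩ := hM.exists_envelope
  obtain ⟨r, hr0, hr⟩ := hM.exists_ball_subset
  have hle : (2 : ENNReal) ≤ 16 := by norm_num
  have oU := hI.isBigOp_scaledSum (hM.memLp_U.mono_exponent hle) hM.integral_U
  have oV := hI.isBigOp_scaledSum (hM.memLp_V.mono_exponent hle) hM.integral_V
  have oW := hI.isBigOp_scaledSum (hM.memLp_W.mono_exponent hle) hM.integral_W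
  have oT : IsBigOp μ sampleFilter
      (fun s => scaledSum Z (fun z => M.dlog 4 z M.θ₀ - M.Q₂) s) :=
    hI.isBigOp_scaledSum_centred
      ((hM.memLp_dlog (k := 4) (by norm_num) hM.θ₀_mem).mono_exponent hle)
  have oB : IsBigOp μ sampleFilter (fun s ω => (s.card : ℝ)⁻¹ * ∑ i ∈ s, B (Z i ω)) := by
    have hBi : ∀ i, HasMean μ (fun ω => B (Z i ω)) (∫ z, B z ∂M.law) :=
      hI.hasMean_comp (hBL.integrable (by norm_num))
    refine isBigOp_of_integral_abs_le (C := ∫ z, B z ∂M.law) (Eventually.of_forall fun s =>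
      (integrable_finsetSum _ fun i _ => (hBi i).1).const_mul _) ?_
    filter_upwards [eventually_nonempty] with s hs
    have habs : ∀ ω, |(s.card : ℝ)⁻¹ * ∑ i ∈ s, B (Z i ω)| = (s.card : ℝ)⁻¹ * ∑ i ∈ s, B (Z i ω) :=
      fun ω => abs_of_nonneg (mul_nonneg (by positivity) (Finset.sum_nonneg fun i _ => hB0 _))
    simp only [habs]
    rw [integral_const_mul, integral_finsetSum _ fun i _ => (hBi i).1]
    have hc : (s.card : ℝ) ≠ 0 := by exact_mod_cast hs.card_pos.ne'
    simp only [(hBi _).2, Finset.sum_const, nsmul_eq_mul]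
    rw [inv_mul_cancel_left₀ hc]
  have oAll := (((oU.abs.add oV.abs).add oW.abs).add oT.abs).add oB.abs
  rw [tendstoInMeasure_zero_iff]
  intro ε hε δ hδ
  obtain ⟨K, hK0, hK⟩ := oAll.exists_pos (half_pos hδ)
  obtain ⟨η, hη0, C, hC⟩ := exists_bound_root_sub_expansion hM.info_pos M.Q₁ M.Q₂ K hK0
  have hcons := tendstoInMeasure_zero_iff.1 (hM.tendstoInMeasure_mle hI hθhat) (min η r)
    (lt_min hη0 hr0) (δ / 2) (half_pos hδ)
  filter_upwards [hK, hcons, eventually_nonempty, tendsto_sqrt_card.eventually_ge_atTop η⁻¹,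
    tendsto_sqrt_card.eventually_gt_atTop (C / ε)] with s h1 h2 hs hlarge hlarge2
  have hbad := measure_union_le_ofReal (by positivity) (by positivity) h1 h2
  rw [add_halves] at hbad
  refine (measure_mono_ae ?_).trans hbad
  filter_upwards [hθhat s hs] with ω hmle hω
  have hω' : ε ≤ |(s.card : ℝ) * (√(s.card : ℝ) * (θhat s ω - M.θ₀)
      - (M.A₁ Z s ω + M.A₂ Z s ω / √(s.card : ℝ) + M.A₃ Z s ω / (s.card : ℝ)))| := hω
  by_contra hn
  replace hn : ω ∉ {ω | _} ∪ {ω | _} := hn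
  simp only [Set.mem_union, Set.mem_ofPred_eq, not_or, not_lt, not_le] at hn
  obtain ⟨hnK, hnθ⟩ := hn
  have hpos : ∀ x : ℝ, 0 ≤ |x| := abs_nonneg
  rw [abs_of_nonneg (by positivity)] at hnK
  have hn0 : (0 : ℝ) < s.card := by exact_mod_cast hs.card_pos
  have hq0 : 0 < √(s.card : ℝ) := Real.sqrt_pos.2 hn0
  have hball : θhat s ω ∈ Metric.ball M.θ₀ r := by
    rw [Metric.mem_ball, Real.dist_eq]
    exact hnθ.trans_le (min_le_right _ _)
  have hscore := hM.sum_score_eq_zero hs (z := fun i => Z i ω) (hr hball) hmle.1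
  obtain ⟨ρ, hρ, heq⟩ := hM.exists_expanded_score hB hr Z hs hball rfl hscore
  have hb := hC (√(s.card : ℝ))⁻¹ (scaledSum Z M.U s ω) (scaledSum Z M.V s ω)
    (scaledSum Z M.W s ω) (scaledSum Z (fun z => M.dlog 4 z M.θ₀ - M.Q₂) s ω)
    (√(s.card : ℝ) * (θhat s ω - M.θ₀)) ρ (inv_pos.2 hq0) (inv_le_of_inv_le₀ hη0 hlarge)
    (by rw [inv_mul_cancel_left₀ hq0.ne']; exact hnθ.le.trans (min_le_left _ _))
    (by linarith [hpos (scaledSum Z M.V s ω), hpos (scaledSum Z M.W s ω),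
      hpos (scaledSum Z (fun z => M.dlog 4 z M.θ₀ - M.Q₂) s ω),
      hpos ((s.card : ℝ)⁻¹ * ∑ i ∈ s, B (Z i ω))])
    (by linarith [hpos (scaledSum Z M.U s ω), hpos (scaledSum Z M.W s ω),
      hpos (scaledSum Z (fun z => M.dlog 4 z M.θ₀ - M.Q₂) s ω),
      hpos ((s.card : ℝ)⁻¹ * ∑ i ∈ s, B (Z i ω))])
    (by linarith [hpos (scaledSum Z M.V s ω), hpos (scaledSum Z M.U s ω),
      hpos (scaledSum Z (fun z => M.dlog 4 z M.θ₀ - M.Q₂) s ω),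
      hpos ((s.card : ℝ)⁻¹ * ∑ i ∈ s, B (Z i ω))])
    (by linarith [hpos (scaledSum Z M.V s ω), hpos (scaledSum Z M.W s ω),
      hpos (scaledSum Z M.U s ω), hpos ((s.card : ℝ)⁻¹ * ∑ i ∈ s, B (Z i ω))])
    (by linarith [hpos (scaledSum Z M.V s ω), hpos (scaledSum Z M.W s ω),
      hpos (scaledSum Z (fun z => M.dlog 4 z M.θ₀ - M.Q₂) s ω), hpos (scaledSum Z M.U s ω)])
    heq
  have hform : M.A₁ Z s ω + M.A₂ Z s ω / √(s.card : ℝ) + M.A₃ Z s ω / (s.card : ℝ) =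
      M.A₁ Z s ω + M.A₂ Z s ω * (√(s.card : ℝ))⁻¹ + M.A₃ Z s ω * (√(s.card : ℝ))⁻¹ ^ 2 := by
    rw [div_eq_mul_inv, div_eq_mul_inv, inv_pow, Real.sq_sqrt hn0.le]
  rw [hform, abs_mul, abs_of_pos hn0] at hω'
  have hb' := hω'.trans (mul_le_mul_of_nonneg_left hb hn0.le)
  have hne : (s.card : ℝ) * (C * (√(s.card : ℝ))⁻¹ ^ 3) = C / √(s.card : ℝ) := by
    nth_rewrite 1 [← Real.sq_sqrt hn0.le]
    field_simp
  rw [hne, le_div_iff₀ hq0] at hb'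
  rw [div_lt_iff₀ hε] at hlarge2
  linarith

end Regular
end ParametricModel

/-! ### Moments of the terms of the expansion -/

section Sums

variable {𝒵 Ω : Type*}

lemma scaledSum_const_mul (Z : ℕ → Ω → 𝒵) (c : ℝ) (g : 𝒵 → ℝ) (s : Finset ℕ) (ω : Ω) :
    scaledSum Z (fun z => c * g z) s ω = c * scaledSum Z g s ω := by
  simp only [scaledSum, ← Finset.mul_sum]; ring

lemma scaledSum_add (Z : ℕ → Ω → 𝒵) (g h : 𝒵 → ℝ) (s : Finset ℕ) (ω : Ω) :
    scaledSum Z (fun z => g z + h z) s ω = scaledSum Z g s ω + scaledSum Z h s ω := by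
  simp only [scaledSum, Finset.sum_add_distrib]; ring

lemma card_half₁ (m : ℕ) : (half₁ m).card = m := Finset.card_range m

lemma card_half₂ (m : ℕ) : (half₂ m).card = m := by simp [half₂]; omega

lemma card_wholeSample (n : ℕ) : (wholeSample n).card = n := Finset.card_range n

lemma nonempty_half₁ {m : ℕ} (hm : 1 ≤ m) : (half₁ m).Nonempty :=
  Finset.card_pos.1 (by rw [card_half₁]; omega)

lemma nonempty_half₂ {m : ℕ} (hm : 1 ≤ m) : (half₂ m).Nonempty :=
  Finset.card_pos.1 (by rw [card_half₂]; omega)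

lemma nonempty_wholeSample {n : ℕ} (hn : 1 ≤ n) : (wholeSample n).Nonempty :=
  Finset.card_pos.1 (by rw [card_wholeSample]; omega)

lemma disjoint_halves (m : ℕ) : Disjoint (half₁ m) (half₂ m) := by
  rw [Finset.disjoint_left]
  intro i h1 h2
  simp only [half₁, half₂, Finset.mem_range, Finset.mem_Ico] at h1 h2
  omega

lemma sum_wholeSample (m : ℕ) (x : ℕ → ℝ) :
    ∑ i ∈ wholeSample (2 * m), x i = ∑ i ∈ half₁ m, x i + ∑ i ∈ half₂ m, x i :=
  (Finset.sum_range_add_sum_Ico x (by omega)).symm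

lemma sqrt_two_mul_cast (m : ℕ) : √((2 * m : ℕ) : ℝ) = √2 * √(m : ℝ) := by
  push_cast
  exact Real.sqrt_mul (by norm_num) _

lemma scaledSum_wholeSample (Z : ℕ → Ω → 𝒵) (g : 𝒵 → ℝ) (m : ℕ) (ω : Ω) :
    scaledSum Z g (wholeSample (2 * m)) ω =
      (√2)⁻¹ * (scaledSum Z g (half₁ m) ω + scaledSum Z g (half₂ m) ω) := by
  simp only [scaledSum, sum_wholeSample, card_half₁, card_half₂, card_wholeSample,
    sqrt_two_mul_cast, mul_inv]
  ring

end Sums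

namespace IsIIDSample

variable {𝒵 Ω : Type*} [MeasurableSpace 𝒵] [MeasurableSpace Ω] {μ : Measure Ω}
  {P : Measure 𝒵} {Z : ℕ → Ω → 𝒵} (hI : IsIIDSample μ Z P)
include hI

/-- The fourth mixed moment of normalised sums, possibly with random-walk signs `ε i = ±1`: Gaussian
pairings up to a correction of order `1 / n`. -/
lemma integral_signed_prod_four [IsProbabilityMeasure μ] {g h k l : 𝒵 → ℝ} (hg : MemLp g 4 P)
    (hh : MemLp h 4 P) (hk : MemLp k 4 P) (hl : MemLp l 4 P) (hg0 : ∫ z, g z ∂P = 0)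
    (hh0 : ∫ z, h z ∂P = 0) (hk0 : ∫ z, k z ∂P = 0) (hl0 : ∫ z, l z ∂P = 0) (ε : ℕ → ℝ)
    (hε : ∀ i, ε i * ε i = 1) {s : Finset ℕ} (hs : s.Nonempty) :
    HasMean μ (fun ω => ((√(s.card : ℝ))⁻¹ * ∑ i ∈ s, ε i * g (Z i ω)) *
        ((√(s.card : ℝ))⁻¹ * ∑ i ∈ s, ε i * h (Z i ω)) *
        (((√(s.card : ℝ))⁻¹ * ∑ i ∈ s, ε i * k (Z i ω)) *
          ((√(s.card : ℝ))⁻¹ * ∑ i ∈ s, ε i * l (Z i ω))))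
      (((∫ z, g z * h z ∂P) * (∫ z, k z * l z ∂P) + (∫ z, g z * k z ∂P) * (∫ z, h z * l z ∂P)
          + (∫ z, g z * l z ∂P) * (∫ z, h z * k z ∂P)) +
        ((∫ z, g z * h z * (k z * l z) ∂P) -
          ((∫ z, g z * h z ∂P) * (∫ z, k z * l z ∂P) + (∫ z, g z * k z ∂P) * (∫ z, h z * l z ∂P)
          + (∫ z, g z * l z ∂P) * (∫ z, h z * k z ∂P))) / s.card) := by
  set G : Fin 4 → 𝒵 → ℝ := ![g, h, k, l] with hG
  have hGL : ∀ b, MemLp (G b) 4 P := fun b => by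
    fin_cases b <;> simp [hG, hg, hh, hk, hl]
  have hG0 : ∀ b, ∫ z, G b z ∂P = 0 := fun b => by
    fin_cases b <;> simp [hG, hg0, hh0, hk0, hl0]
  have hind := hI.iIndepFun_comp (g := fun i z b => ε i * G b z) fun i =>
    aemeasurable_pi_lambda _ fun b => (hGL b).aestronglyMeasurable.aemeasurable.const_mul _
  have h1 := integral_sum_mul_sum_mul_sum_mul_sum hind
    (fun i b => (hI.memLp_comp (hGL b) i).const_mul (ε i))
    (fun i b => by
      rw [integral_const_mul, hI.integral_comp (hGL b).aestronglyMeasurable, hG0, mul_zero])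
    (C := fun a b => ∫ z, G a z * G b z ∂P)
    (fun i a b => by
      rw [← hI.integral_comp (g := fun z => G a z * G b z)
        ((hGL a).aestronglyMeasurable.mul (hGL b).aestronglyMeasurable) i]
      refine integral_congr_ae (Eventually.of_forall fun ω => ?_)
      simp only
      linear_combination (G a (Z i ω) * G b (Z i ω)) * hε i) 0 1 2 3
    (κ := ∫ z, g z * h z * (k z * l z) ∂P)
    (fun i => by
      rw [← hI.integral_comp (g := fun z => g z * h z * (k z * l z))
        ((hg.aestronglyMeasurable.mul hh.aestronglyMeasurable).mul
          (hk.aestronglyMeasurable.mul hl.aestronglyMeasurable)) i]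
      refine integral_congr_ae (Eventually.of_forall fun ω => ?_)
      simp only [hG, Matrix.cons_val]
      linear_combination (g (Z i ω) * h (Z i ω) * (k (Z i ω) * l (Z i ω)) * (ε i * ε i + 1)) *
        hε i) s
  have hc : (0 : ℝ) < s.card := by exact_mod_cast hs.card_pos
  refine (h1.const_mul ((s.card : ℝ)⁻¹ ^ 2)).congr (fun ω => ?_) ?_
  · have : (s.card : ℝ)⁻¹ = (√(s.card : ℝ))⁻¹ * (√(s.card : ℝ))⁻¹ := by
      rw [← mul_inv, Real.mul_self_sqrt hc.le]
    simp only [hG, this, Matrix.cons_val]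
    ring
  · simp only [hG, Matrix.cons_val]
    field_simp
    ring

lemma integral_prod_four [IsProbabilityMeasure μ] {g h k l : 𝒵 → ℝ} (hg : MemLp g 4 P)
    (hh : MemLp h 4 P) (hk : MemLp k 4 P) (hl : MemLp l 4 P) (hg0 : ∫ z, g z ∂P = 0)
    (hh0 : ∫ z, h z ∂P = 0) (hk0 : ∫ z, k z ∂P = 0) (hl0 : ∫ z, l z ∂P = 0) :
    ∃ G K : ℝ, ∀ s : Finset ℕ, s.Nonempty → HasMean μ (fun ω => scaledSum Z g s ω *
      scaledSum Z h s ω * (scaledSum Z k s ω * scaledSum Z l s ω)) (G + K / s.card) := by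
  have key := fun (s : Finset ℕ) (hs : s.Nonempty) =>
    hI.integral_signed_prod_four hg hh hk hl hg0 hh0 hk0 hl0 (fun _ => 1) (by simp) hs
  simp only [one_mul] at key
  exact ⟨_, _, key⟩

lemma indepFun_scaledSum {ι : Type*} [Finite ι] {G : ι → 𝒵 → ℝ} (hG : ∀ j, AEMeasurable (G j) P)
    {s t : Finset ℕ} (hst : Disjoint s t) :
    IndepFun (fun ω j => scaledSum Z (G j) s ω) (fun ω j => scaledSum Z (G j) t ω) μ := by
  have hGm : AEMeasurable (fun z j => G j z) P := aemeasurable_pi_lambda _ hG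
  have h1 := indepFun_sum_sum (hI.iIndepFun_comp (g := fun _ z j => G j z) fun _ => hGm)
    (fun i => hGm.comp_quasiMeasurePreserving (hI.measurePreserving i).quasiMeasurePreserving) hst
  exact h1.comp (φ := fun x j => (√(s.card : ℝ))⁻¹ * x j) (ψ := fun x j => (√(t.card : ℝ))⁻¹ * x j)
    (by fun_prop) (by fun_prop)

lemma integral_scaledSum {g : 𝒵 → ℝ} (hg : Integrable g P) (hg0 : ∫ z, g z ∂P = 0)
    (s : Finset ℕ) : HasMean μ (fun ω => scaledSum Z g s ω) 0 := by
  have hi := hI.hasMean_comp hg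
  have : HasMean μ (fun ω => ∑ i ∈ s, g (Z i ω)) 0 := by
    refine ⟨integrable_finsetSum _ fun i _ => (hi i).1, ?_⟩
    rw [integral_finsetSum _ fun i _ => (hi i).1]
    simp [(hi _).2, hg0]
  simpa [scaledSum] using this.const_mul (√(s.card : ℝ))⁻¹

lemma memLp_scaledSum_sub {g : 𝒵 → ℝ} {p : ENNReal}
    (hg : MemLp g p P) (m : ℕ) :
    MemLp (fun ω => scaledSum Z g (half₁ m) ω - scaledSum Z g (half₂ m) ω) p μ :=
  (hI.memLp_scaledSum hg _).sub (hI.memLp_scaledSum hg _)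

/-- Sixth moments of normalised sums are bounded uniformly in the sample size. -/
lemma exists_integral_scaledSum_pow_six_le [IsProbabilityMeasure μ]
    {g : 𝒵 → ℝ} (hg : MemLp g 6 P) (hg0 : ∫ z, g z ∂P = 0) :
    ∃ C : ℝ, ∀ s : Finset ℕ, s.Nonempty → ∫ ω, scaledSum Z g s ω ^ 6 ∂μ ≤ C := by
  have hpow : ∀ i k, ∫ ω, g (Z i ω) ^ k ∂μ = ∫ z, g z ^ k ∂P := fun i k =>
    hI.integral_comp (g := fun z => g z ^ k) (hg.aestronglyMeasurable.pow k) i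
  obtain ⟨C, hC⟩ := integral_sum_pow_six_le (μ := μ) (X := fun i ω => g (Z i ω))
    (B := ∑ k ∈ Finset.range 7, |∫ z, g z ^ k ∂P|)
    (hI.iIndepFun_comp fun _ => hg.aestronglyMeasurable.aemeasurable)
    (fun i => hI.memLp_comp hg i)
    (fun i => by rw [hI.integral_comp hg.aestronglyMeasurable, hg0])
    (fun i k hk => by
      rw [hpow]
      exact Finset.single_le_sum (f := fun k => |∫ z, g z ^ k ∂P|) (fun _ _ => abs_nonneg _)
        (Finset.mem_range.2 (by omega)))
  refine ⟨C, fun s hs => ?_⟩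
  have hc : (0 : ℝ) < s.card := by exact_mod_cast hs.card_pos
  have h6 : (√(s.card : ℝ))⁻¹ ^ 6 = ((s.card : ℝ) ^ 3)⁻¹ := by
    rw [inv_pow, show 6 = 2 * 3 by rfl, pow_mul, Real.sq_sqrt hc.le]
  simp only [scaledSum, mul_pow]
  rw [integral_const_mul, h6, inv_mul_le_iff₀ (by positivity), mul_comm]
  exact hC s

end IsIIDSample

namespace ParametricModel

variable {𝒵 Ω : Type*} [MeasurableSpace 𝒵] {M : ParametricModel 𝒵}

lemma A₁_eq (Z : ℕ → Ω → 𝒵) (s : Finset ℕ) (ω : Ω) : M.A₁ Z s ω = scaledSum Z M.X s ω :=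
  (scaledSum_const_mul Z _ _ s ω).symm

lemma scaledSum_Y (Z : ℕ → Ω → 𝒵) (s : Finset ℕ) (ω : Ω) : scaledSum Z M.Y s ω =
    1 / 2 * M.info⁻¹ ^ 2 * M.Q₁ * scaledSum Z M.U s ω + M.info⁻¹ * scaledSum Z M.V s ω := by
  rw [← scaledSum_const_mul, ← scaledSum_const_mul, ← scaledSum_add]; rfl

/-- The second-order term is the product of the normalised sums of `X` and `Y`. -/
lemma A₂_eq (Z : ℕ → Ω → 𝒵) (s : Finset ℕ) (ω : Ω) :
    M.A₂ Z s ω = scaledSum Z M.X s ω * scaledSum Z M.Y s ω := by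
  rw [← A₁_eq, scaledSum_Y, A₁, A₂]; ring

lemma A₂SS_eq (Z : ℕ → Ω → 𝒵) (m : ℕ) (ω : Ω) :
    M.A₂SS Z m ω = scaledSum Z M.X (half₁ m) ω * scaledSum Z M.Y (half₂ m) ω
      + scaledSum Z M.X (half₂ m) ω * scaledSum Z M.Y (half₁ m) ω := by
  have h2 : (√2)⁻¹ * (√2)⁻¹ = (1 / 2 : ℝ) := by
    rw [← mul_inv, Real.mul_self_sqrt (by norm_num)]; norm_num
  simp only [A₂SS, A₂_eq, scaledSum_wholeSample]
  linear_combination (2 * (scaledSum Z M.X (half₁ m) ω + scaledSum Z M.X (half₂ m) ω)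
    * (scaledSum Z M.Y (half₁ m) ω + scaledSum Z M.Y (half₂ m) ω)) * h2

namespace Regular

lemma memLp_X (hM : M.Regular) : MemLp M.X 16 M.law := hM.memLp_U.const_mul _

lemma memLp_Y (hM : M.Regular) : MemLp M.Y 16 M.law :=
  (hM.memLp_U.const_mul _).add (hM.memLp_V.const_mul _)

lemma integral_X (hM : M.Regular) : ∫ z, M.X z ∂M.law = 0 := by
  simp only [X]
  rw [integral_const_mul, hM.integral_U, mul_zero]

lemma integral_Y (hM : M.Regular) : ∫ z, M.Y z ∂M.law = 0 := by
  have := hM.isProbabilityMeasure_law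
  simp only [Y]
  rw [integral_add ((hM.memLp_U.integrable (by norm_num)).const_mul _)
    ((hM.memLp_V.integrable (by norm_num)).const_mul _), integral_const_mul, integral_const_mul,
    hM.integral_U, hM.integral_V]
  simp

lemma integral_X_sq (hM : M.Regular) : ∫ z, M.X z * M.X z ∂M.law = M.info⁻¹ := by
  have h : ∀ z, M.X z * M.X z = M.info⁻¹ ^ 2 * M.dlog 1 z M.θ₀ ^ 2 := fun z => by
    simp only [X, U]; ring
  simp only [h]
  rw [integral_const_mul, hM.integral_score_sq]
  have := hM.info_pos.ne'
  field_simp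

/-- `b₀ = E[X Y]`, since the score is centred. -/
lemma integral_X_mul_Y (hM : M.Regular) : ∫ z, M.X z * M.Y z ∂M.law = M.b₀ := by
  have := hM.isProbabilityMeasure_law
  have hU : MemLp (fun z => M.dlog 1 z M.θ₀) 2 M.law :=
    (hM.memLp_dlog (by norm_num) hM.θ₀_mem).mono_exponent (by norm_num)
  have hV : MemLp (fun z => M.dlog 2 z M.θ₀) 2 M.law :=
    (hM.memLp_dlog (by norm_num) hM.θ₀_mem).mono_exponent (by norm_num)
  have h1 : HasMean M.law (fun z => M.dlog 1 z M.θ₀ ^ 2) _ :=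
    Integrable.hasMean hU.integrable_sq
  have h2 : HasMean M.law (fun z => M.dlog 1 z M.θ₀ * M.dlog 2 z M.θ₀) _ :=
    Integrable.hasMean (hU.integrable_mul hV)
  have h3 : HasMean M.law (fun z => M.dlog 1 z M.θ₀) 0 :=
    ⟨hU.integrable one_le_two, hM.integral_score⟩
  have hne := hM.info_pos.ne'
  refine HasMean.eq ((((h1.const_mul (1 / 2 * M.info⁻¹ ^ 3 * M.Q₁)).add
    (h2.const_mul (M.info⁻¹ ^ 2))).add (h3.const_mul (-(M.info⁻¹ ^ 2 *
      ∫ z, M.dlog 2 z M.θ₀ ∂M.law)))).congr (fun z => ?_) ?_)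
  · simp only [X, Y, U, V]; ring
  · rw [b₀]; field_simp; ring

variable [MeasurableSpace Ω] {μ : Measure Ω} {Z : ℕ → Ω → 𝒵}

lemma memLp_A₁ (hM : M.Regular) (hI : IsIIDSample μ Z M.law) (s : Finset ℕ) :
    MemLp (M.A₁ Z s) 2 μ := by
  have := hM.isProbabilityMeasure_law
  have h := hI.memLp_scaledSum (hM.memLp_X.mono_exponent (q := 16) (p := 2) (by norm_num)) s
  rwa [show M.A₁ Z s = scaledSum Z M.X s from funext fun ω => A₁_eq Z s ω]

lemma memLp_A₂ (hM : M.Regular) (hI : IsIIDSample μ Z M.law) (s : Finset ℕ) :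
    MemLp (M.A₂ Z s) 2 μ := by
  have := hM.isProbabilityMeasure_law
  rw [show M.A₂ Z s = fun ω => scaledSum Z M.X s ω * scaledSum Z M.Y s ω from
    funext fun ω => A₂_eq Z s ω]
  exact MemLp.mul_four (hI.memLp_scaledSum (hM.memLp_X.mono_exponent (by norm_num)) s)
    (hI.memLp_scaledSum (hM.memLp_Y.mono_exponent (by norm_num)) s)

lemma memLp_A₃ (hM : M.Regular) (hI : IsIIDSample μ Z M.law) (s : Finset ℕ) :
    MemLp (M.A₃ Z s) 2 μ := by
  have := hM.isProbabilityMeasure_law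
  have hle : (6 : ENNReal) ≤ 16 := by norm_num
  have hU := hI.memLp_scaledSum (hM.memLp_U.mono_exponent hle) s
  have hV := hI.memLp_scaledSum (hM.memLp_V.mono_exponent hle) s
  have hW := hI.memLp_scaledSum (hM.memLp_W.mono_exponent hle) s
  have h := ((((MemLp.mul_three_of_six hU hU hU).const_mul
    (1 / 6 * M.info⁻¹ ^ 4 * M.Q₂ + 1 / 2 * M.info⁻¹ ^ 5 * M.Q₁ ^ 2)).add
    ((MemLp.mul_three_of_six hU hU hV).const_mul (3 / 2 * M.info⁻¹ ^ 4 * M.Q₁))).add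
    ((MemLp.mul_three_of_six hU hU hW).const_mul (1 / 2 * M.info⁻¹ ^ 3))).add
    ((MemLp.mul_three_of_six hU hV hV).const_mul (M.info⁻¹ ^ 3))
  convert h using 1
  ext ω
  simp only [A₃, Pi.add_apply]
  ring

lemma memLp_A₂SS (hM : M.Regular) (hI : IsIIDSample μ Z M.law) (m : ℕ) :
    MemLp (M.A₂SS Z m) 2 μ :=
  ((hM.memLp_A₂ hI _).const_mul 2).sub ((hM.memLp_A₂ hI _).add (hM.memLp_A₂ hI _))

lemma memLp_A₃SS (hM : M.Regular) (hI : IsIIDSample μ Z M.law) (m : ℕ) :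
    MemLp (M.A₃SS Z m) 2 μ :=
  ((hM.memLp_A₃ hI _).const_mul 2).sub
    (((hM.memLp_A₃ hI _).add (hM.memLp_A₃ hI _)).const_mul (√2))

lemma indepFun_XY (hM : M.Regular) (hI : IsIIDSample μ Z M.law) (m : ℕ) :
    IndepFun (fun ω j => scaledSum Z ((![M.X, M.Y] : Fin 2 → 𝒵 → ℝ) j) (half₁ m) ω)
      (fun ω j => scaledSum Z ((![M.X, M.Y] : Fin 2 → 𝒵 → ℝ) j) (half₂ m) ω) μ := by
  refine hI.indepFun_scaledSum (fun j => ?_) (disjoint_halves m)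
  fin_cases j
  · exact hM.memLp_X.aestronglyMeasurable.aemeasurable
  · exact hM.memLp_Y.aestronglyMeasurable.aemeasurable

variable [IsProbabilityMeasure μ]

lemma integral_XX (hM : M.Regular) (hI : IsIIDSample μ Z M.law) {s : Finset ℕ}
    (hs : s.Nonempty) :
    HasMean μ (fun ω => scaledSum Z M.X s ω * scaledSum Z M.X s ω) M.info⁻¹ := by
  have := hM.isProbabilityMeasure_law
  rw [← hM.integral_X_sq]
  exact hI.integral_scaledSum_mul (hM.memLp_X.mono_exponent (by norm_num))
    (hM.memLp_X.mono_exponent (by norm_num)) hM.integral_X hM.integral_X hs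

lemma integral_YY (hM : M.Regular) (hI : IsIIDSample μ Z M.law) {s : Finset ℕ}
    (hs : s.Nonempty) :
    HasMean μ (fun ω => scaledSum Z M.Y s ω * scaledSum Z M.Y s ω)
      (∫ z, M.Y z * M.Y z ∂M.law) :=
  have := hM.isProbabilityMeasure_law
  hI.integral_scaledSum_mul (hM.memLp_Y.mono_exponent (by norm_num))
    (hM.memLp_Y.mono_exponent (by norm_num)) hM.integral_Y hM.integral_Y hs

lemma integral_XY (hM : M.Regular) (hI : IsIIDSample μ Z M.law) {s : Finset ℕ}
    (hs : s.Nonempty) :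
    HasMean μ (fun ω => scaledSum Z M.X s ω * scaledSum Z M.Y s ω) M.b₀ := by
  have := hM.isProbabilityMeasure_law
  rw [← hM.integral_X_mul_Y]
  exact hI.integral_scaledSum_mul (hM.memLp_X.mono_exponent (by norm_num))
    (hM.memLp_Y.mono_exponent (by norm_num)) hM.integral_X hM.integral_Y hs

lemma integral_A₂ (hM : M.Regular) (hI : IsIIDSample μ Z M.law) {s : Finset ℕ}
    (hs : s.Nonempty) : HasMean μ (M.A₂ Z s) M.b₀ :=
  (hM.integral_XY hI hs).congr (fun ω => A₂_eq Z s ω) rfl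

lemma upsilon_eq (hM : M.Regular) :
    M.Upsilon = M.info⁻¹ * (∫ z, M.Y z * M.Y z ∂M.law) + M.b₀ ^ 2 := by
  rw [Upsilon, ← hM.integral_X_sq, ← hM.integral_X_mul_Y]
  simp only [pow_two]

lemma variance_A₁ (hM : M.Regular) (hI : IsIIDSample μ Z M.law) {s : Finset ℕ}
    (hs : s.Nonempty) : variance (M.A₁ Z s) μ = M.info⁻¹ := by
  have := hM.isProbabilityMeasure_law
  have h0 := hI.integral_scaledSum (hM.memLp_X.integrable (by norm_num)) hM.integral_X s
  rw [variance_eq_sub (hM.memLp_A₁ hI s)]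
  have h1 : ∫ ω, (M.A₁ Z s ^ 2) ω ∂μ = M.info⁻¹ := by
    rw [← (hM.integral_XX hI hs).eq]
    simp only [Pi.pow_apply, A₁_eq, pow_two]
  have h2 : ∫ ω, M.A₁ Z s ω ∂μ = 0 := by simpa only [A₁_eq] using h0.eq
  rw [h1, h2]
  ring

/-- `E[A₁ A₃]` is a constant plus a term of exact order `1 / n`. -/
lemma integral_A₁_mul_A₃ (hM : M.Regular) (hI : IsIIDSample μ Z M.law) :
    ∃ G K : ℝ, ∀ s : Finset ℕ, s.Nonempty →
      HasMean μ (fun ω => M.A₁ Z s ω * M.A₃ Z s ω) (G + K / s.card) := by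
  have := hM.isProbabilityMeasure_law
  have hle : (4 : ENNReal) ≤ 16 := by norm_num
  have hU := hM.memLp_U.mono_exponent hle
  have hV := hM.memLp_V.mono_exponent hle
  have hW := hM.memLp_W.mono_exponent hle
  obtain ⟨G₁, K₁, h₁⟩ := hI.integral_prod_four hU hU hU hU hM.integral_U hM.integral_U
    hM.integral_U hM.integral_U
  obtain ⟨G₂, K₂, h₂⟩ := hI.integral_prod_four hU hU hU hV hM.integral_U hM.integral_U
    hM.integral_U hM.integral_V
  obtain ⟨G₃, K₃, h₃⟩ := hI.integral_prod_four hU hU hU hW hM.integral_U hM.integral_U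
    hM.integral_U hM.integral_W
  obtain ⟨G₄, K₄, h₄⟩ := hI.integral_prod_four hU hU hV hV hM.integral_U hM.integral_U
    hM.integral_V hM.integral_V
  set c₁ := M.info⁻¹ * (1 / 6 * M.info⁻¹ ^ 4 * M.Q₂ + 1 / 2 * M.info⁻¹ ^ 5 * M.Q₁ ^ 2) with hc₁
  set c₂ := M.info⁻¹ * (3 / 2 * M.info⁻¹ ^ 4 * M.Q₁) with hc₂
  set c₃ := M.info⁻¹ * (1 / 2 * M.info⁻¹ ^ 3) with hc₃
  set c₄ := M.info⁻¹ * M.info⁻¹ ^ 3 with hc₄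
  refine ⟨c₁ * G₁ + c₂ * G₂ + c₃ * G₃ + c₄ * G₄, c₁ * K₁ + c₂ * K₂ + c₃ * K₃ + c₄ * K₄,
    fun s hs => ?_⟩
  refine (((((h₁ s hs).const_mul c₁).add ((h₂ s hs).const_mul c₂)).add
    ((h₃ s hs).const_mul c₃)).add ((h₄ s hs).const_mul c₄)).congr (fun ω => ?_) (by ring)
  simp only [A₁, A₃, hc₁, hc₂, hc₃, hc₄]
  ring

lemma variance_A₂SS (hM : M.Regular) (hI : IsIIDSample μ Z M.law) {m : ℕ} (hm : 1 ≤ m) :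
    variance (M.A₂SS Z m) μ = 2 * M.Upsilon := by
  have := hM.isProbabilityMeasure_law
  have hind := hM.indepFun_XY hI m
  have hs := nonempty_half₁ hm
  have ht := nonempty_half₂ hm
  have X0 := hI.integral_scaledSum (hM.memLp_X.integrable (by norm_num)) hM.integral_X
  have Y0 := hI.integral_scaledSum (hM.memLp_Y.integrable (by norm_num)) hM.integral_Y
  have e1 := IndepFun.hasMean_mul hind (φ := fun x => x 0) (ψ := fun x => x 1)
    (by fun_prop) (by fun_prop) (X0 _) (Y0 _)
  have e2 := IndepFun.hasMean_mul hind (φ := fun x => x 1) (ψ := fun x => x 0)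
    (by fun_prop) (by fun_prop) (Y0 _) (X0 _)
  have f1 := IndepFun.hasMean_mul hind (φ := fun x => x 0 * x 0) (ψ := fun x => x 1 * x 1)
    (by fun_prop) (by fun_prop) (hM.integral_XX hI hs) (hM.integral_YY hI ht)
  have f2 := IndepFun.hasMean_mul hind (φ := fun x => x 0 * x 1) (ψ := fun x => x 0 * x 1)
    (by fun_prop) (by fun_prop) (hM.integral_XY hI hs) (hM.integral_XY hI ht)
  have f3 := IndepFun.hasMean_mul hind (φ := fun x => x 1 * x 1) (ψ := fun x => x 0 * x 0)
    (by fun_prop) (by fun_prop) (hM.integral_YY hI hs) (hM.integral_XX hI ht)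
  have hmean : HasMean μ (M.A₂SS Z m) 0 := by
    refine (e1.add e2).congr (fun ω => ?_) (by simp)
    rw [A₂SS_eq]; simp; ring
  have hsq : HasMean μ (fun ω => (M.A₂SS Z m ^ 2) ω) (2 * M.Upsilon) := by
    refine ((f1.add (f2.const_mul 2)).add f3).congr (fun ω => ?_) ?_
    · rw [Pi.pow_apply, A₂SS_eq]; simp; ring
    · rw [hM.upsilon_eq]; ring
  rw [variance_eq_sub (hM.memLp_A₂SS hI m), hmean.eq, hsq.eq]
  ring

lemma integral_A₁_mul_A₂SS (hM : M.Regular) (hI : IsIIDSample μ Z M.law) {m : ℕ} (hm : 1 ≤ m) :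
    ∫ ω, M.A₁ Z (wholeSample (2 * m)) ω * M.A₂SS Z m ω ∂μ = 0 := by
  have := hM.isProbabilityMeasure_law
  have hind := hM.indepFun_XY hI m
  have hs := nonempty_half₁ hm
  have ht := nonempty_half₂ hm
  have X0 := hI.integral_scaledSum (hM.memLp_X.integrable (by norm_num)) hM.integral_X
  have Y0 := hI.integral_scaledSum (hM.memLp_Y.integrable (by norm_num)) hM.integral_Y
  have f1 := IndepFun.hasMean_mul hind (φ := fun x => x 0 * x 0) (ψ := fun x => x 1)
    (by fun_prop) (by fun_prop) (hM.integral_XX hI hs) (Y0 _)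
  have f2 := IndepFun.hasMean_mul hind (φ := fun x => x 0 * x 1) (ψ := fun x => x 0)
    (by fun_prop) (by fun_prop) (hM.integral_XY hI hs) (X0 _)
  have f3 := IndepFun.hasMean_mul hind (φ := fun x => x 0) (ψ := fun x => x 0 * x 1)
    (by fun_prop) (by fun_prop) (X0 _) (hM.integral_XY hI ht)
  have f4 := IndepFun.hasMean_mul hind (φ := fun x => x 1) (ψ := fun x => x 0 * x 0)
    (by fun_prop) (by fun_prop) (Y0 _) (hM.integral_XX hI ht)
  refine HasMean.eq (((((f1.add f2).add f3).add f4).const_mul (√2)⁻¹).congr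
    (fun ω => ?_) (by simp))
  rw [A₂SS_eq, A₁_eq, scaledSum_wholeSample]
  simp only [Matrix.cons_val]
  ring

lemma integral_A₁_mul_A₃SS (hM : M.Regular) (hI : IsIIDSample μ Z M.law) :
    ∃ K : ℝ, ∀ m : ℕ, 1 ≤ m →
      ∫ ω, M.A₁ Z (wholeSample (2 * m)) ω * M.A₃SS Z m ω ∂μ = K / m := by
  have := hM.isProbabilityMeasure_law
  obtain ⟨G, K, h⟩ := hM.integral_A₁_mul_A₃ hI
  refine ⟨-K, fun m hm => ?_⟩
  have hind : IndepFun (fun ω j => scaledSum Z ((![M.U, M.V, M.W] : Fin 3 → 𝒵 → ℝ) j) (half₁ m) ω)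
      (fun ω j => scaledSum Z ((![M.U, M.V, M.W] : Fin 3 → 𝒵 → ℝ) j) (half₂ m) ω) μ := by
    refine hI.indepFun_scaledSum (fun j => ?_) (disjoint_halves m)
    fin_cases j
    · exact hM.memLp_U.aestronglyMeasurable.aemeasurable
    · exact hM.memLp_V.aestronglyMeasurable.aemeasurable
    · exact hM.memLp_W.aestronglyMeasurable.aemeasurable
  have X0 : ∀ s, HasMean μ (M.A₁ Z s) 0 := fun s =>
    (hI.integral_scaledSum (hM.memLp_X.integrable (by norm_num)) hM.integral_X s).congr
      (fun ω => A₁_eq Z s ω) rfl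
  have hA₃ : ∀ s, HasMean μ (M.A₃ Z s) (∫ ω, M.A₃ Z s ω ∂μ) := fun s =>
    Integrable.hasMean ((hM.memLp_A₃ hI s).integrable one_le_two)
  set φ₁ : (Fin 3 → ℝ) → ℝ := fun x => M.info⁻¹ * x 0 with hφ₁
  set φ₃ : (Fin 3 → ℝ) → ℝ := fun x => 1 / 6 * M.info⁻¹ ^ 4 * M.Q₂ * x 0 ^ 3
    + 1 / 2 * M.info⁻¹ ^ 5 * M.Q₁ ^ 2 * x 0 ^ 3 + 3 / 2 * M.info⁻¹ ^ 4 * M.Q₁ * x 0 ^ 2 * x 1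
    + 1 / 2 * M.info⁻¹ ^ 3 * x 0 ^ 2 * x 2 + M.info⁻¹ ^ 3 * x 0 * x 1 ^ 2 with hφ₃
  have c1 : HasMean μ (fun ω => M.A₁ Z (half₁ m) ω * M.A₃ Z (half₂ m) ω)
      (0 * ∫ ω, M.A₃ Z (half₂ m) ω ∂μ) :=
    IndepFun.hasMean_mul hind (φ := φ₁) (ψ := φ₃) (by fun_prop) (by fun_prop) (X0 _) (hA₃ _)
  have c2 : HasMean μ (fun ω => M.A₃ Z (half₁ m) ω * M.A₁ Z (half₂ m) ω)
      ((∫ ω, M.A₃ Z (half₁ m) ω ∂μ) * 0) :=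
    IndepFun.hasMean_mul hind (φ := φ₃) (ψ := φ₁) (by fun_prop) (by fun_prop) (hA₃ _) (X0 _)
  have h1 := h _ (nonempty_half₁ hm)
  have h2 := h _ (nonempty_half₂ hm)
  have hw := h _ (nonempty_wholeSample (show 1 ≤ 2 * m by omega))
  rw [card_half₁] at h1
  rw [card_half₂] at h2
  rw [card_wholeSample] at hw
  have hsqrt : √2 * (√2)⁻¹ = (1 : ℝ) := mul_inv_cancel₀ (by positivity)
  refine HasMean.eq (((hw.const_mul 2).add ((((h1.add h2).add c1).add c2).const_mul
    (-1))).congr (fun ω => ?_) ?_)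
  · have hA1 : M.A₁ Z (wholeSample (2 * m)) ω =
        (√2)⁻¹ * (M.A₁ Z (half₁ m) ω + M.A₁ Z (half₂ m) ω) := by
      simp only [A₁_eq, scaledSum_wholeSample]
    rw [A₃SS]
    linear_combination (-(√2 * (M.A₃ Z (half₁ m) ω + M.A₃ Z (half₂ m) ω))) * hA1
      - ((M.A₃ Z (half₁ m) ω + M.A₃ Z (half₂ m) ω) *
        (M.A₁ Z (half₁ m) ω + M.A₁ Z (half₂ m) ω)) * hsqrt
  · have : (m : ℝ) ≠ 0 := by exact_mod_cast (by omega : m ≠ 0)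
    push_cast
    field_simp
    ring

end Regular
end ParametricModel

/-! ### The split-sample estimator and its bias estimate -/

namespace ParametricModel

variable {𝒵 Ω : Type*} [MeasurableSpace 𝒵] {M : ParametricModel 𝒵}

/-- The remainder of the third-order expansion of the estimator `θhat s`, on the scale of
`HasThirdOrderExpansion`. -/
noncomputable def expansionRem (M : ParametricModel 𝒵) (Z : ℕ → Ω → 𝒵) (θhat : Finset ℕ → Ω → ℝ)
    (s : Finset ℕ) (ω : Ω) : ℝ :=
  (s.card : ℝ) * (√(s.card : ℝ) * (θhat s ω - M.θ₀)
    - (M.A₁ Z s ω + M.A₂ Z s ω / √(s.card : ℝ) + M.A₃ Z s ω / (s.card : ℝ)))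

lemma mul_sub_expansion_eq {q x a b c : ℝ} (hq : 0 < q) :
    q ^ 2 * (q * x - (a + b / q + c / q ^ 2)) = q ^ 3 * x - q ^ 2 * a - q * b - c := by
  field_simp
  ring

lemma expansionRem_eq {Z : ℕ → Ω → 𝒵} {θhat : Finset ℕ → Ω → ℝ} {s : Finset ℕ} {q : ℝ}
    (hq : 0 < q) (hs : (s.card : ℝ) = q ^ 2) (ω : Ω) :
    expansionRem M Z θhat s ω = q ^ 3 * (θhat s ω - M.θ₀) - q ^ 2 * M.A₁ Z s ω
      - q * M.A₂ Z s ω - M.A₃ Z s ω := by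
  rw [expansionRem, hs, Real.sqrt_sq hq.le, mul_sub_expansion_eq hq]

lemma A₁_wholeSample (Z : ℕ → Ω → 𝒵) (m : ℕ) (ω : Ω) : M.A₁ Z (wholeSample (2 * m)) ω =
    (√2)⁻¹ * (M.A₁ Z (half₁ m) ω + M.A₁ Z (half₂ m) ω) := by
  simp only [A₁_eq, scaledSum_wholeSample]

/-- The remainder of the split-sample expansion is a linear combination of the remainders for the
whole sample and the halves. -/
lemma splitEstimator_rem_eq {Z : ℕ → Ω → 𝒵} {θhat : Finset ℕ → Ω → ℝ} {m : ℕ} (hm : 1 ≤ m)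
    (ω : Ω) : ((2 * m : ℕ) : ℝ) * (√((2 * m : ℕ) : ℝ) * (splitEstimator θhat m ω - M.θ₀)
      - (M.A₁ Z (wholeSample (2 * m)) ω + M.A₂SS Z m ω / √((2 * m : ℕ) : ℝ)
        + M.A₃SS Z m ω / ((2 * m : ℕ) : ℝ))) =
    2 * expansionRem M Z θhat (wholeSample (2 * m)) ω
      + -√2 * (expansionRem M Z θhat (half₁ m) ω + expansionRem M Z θhat (half₂ m) ω) := by
  set q : ℝ := √(m : ℝ) with hq
  have hq0 : 0 < q := Real.sqrt_pos.2 (by exact_mod_cast hm)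
  have hqm : (m : ℝ) = q ^ 2 := (Real.sq_sqrt (by positivity)).symm
  have h20 : 0 < √2 := by positivity
  have h22 : √2 ^ 2 = (2 : ℝ) := Real.sq_sqrt (by norm_num)
  have hn : ((2 * m : ℕ) : ℝ) = (√2 * q) ^ 2 := by push_cast; rw [mul_pow, h22, hqm]
  rw [expansionRem_eq (s := half₁ m) hq0 (by rw [card_half₁, hqm]),
    expansionRem_eq (s := half₂ m) hq0 (by rw [card_half₂, hqm]),
    expansionRem_eq (s := wholeSample (2 * m)) (q := √2 * q) (by positivity)
      (by rw [card_wholeSample, hn]), hn,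
    Real.sqrt_sq (by positivity), mul_sub_expansion_eq (by positivity), A₁_wholeSample,
    splitEstimator, A₂SS, A₃SS]
  have h2i : (√2)⁻¹ = √2 / 2 := by rw [inv_eq_one_div, div_eq_div_iff h20.ne' two_ne_zero]; linarith
  rw [h2i]
  generalize √2 = c at *
  linear_combination (-(1 / 2 : ℝ) * c * q ^ 3 * (θhat (half₁ m) ω + θhat (half₂ m) ω - 2 * M.θ₀)
    + 1 / 2 * c * q ^ 2 * (M.A₁ Z (half₁ m) ω + M.A₁ Z (half₂ m) ω)) * h22

/-- The split-sample bias estimate agrees with its cross-product form up to third-order terms and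
remainders, divided by the root of the sample size. -/
lemma splitBias_sub_eq {Z : ℕ → Ω → 𝒵} {θhat : Finset ℕ → Ω → ℝ} {m : ℕ} (hm : 1 ≤ m) (ω : Ω) :
    (splitBias θhat m ω - M.b₀) -
        1 / 2 * (scaledSum Z M.X (half₁ m) ω * scaledSum Z M.Y (half₁ m) ω
          + scaledSum Z M.X (half₂ m) ω * scaledSum Z M.Y (half₂ m) ω - 2 * M.b₀
          - (scaledSum Z M.X (half₁ m) ω * scaledSum Z M.Y (half₂ m) ω
            + scaledSum Z M.X (half₂ m) ω * scaledSum Z M.Y (half₁ m) ω)) =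
      (expansionRem M Z θhat (half₁ m) ω + M.A₃ Z (half₁ m) ω) * (√((half₁ m).card : ℝ))⁻¹
      + (expansionRem M Z θhat (half₂ m) ω + M.A₃ Z (half₂ m) ω) * (√((half₂ m).card : ℝ))⁻¹
      + (-1) * ((expansionRem M Z θhat (wholeSample (2 * m)) ω + M.A₃ Z (wholeSample (2 * m)) ω)
        * (√((wholeSample (2 * m)).card : ℝ))⁻¹) := by
  set q : ℝ := √(m : ℝ) with hq
  have hq0 : 0 < q := Real.sqrt_pos.2 (by exact_mod_cast hm)
  have hqm : (m : ℝ) = q ^ 2 := (Real.sq_sqrt (by positivity)).symm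
  have h20 : 0 < √2 := by positivity
  have h22 : √2 ^ 2 = (2 : ℝ) := Real.sq_sqrt (by norm_num)
  have hn : ((2 * m : ℕ) : ℝ) = (√2 * q) ^ 2 := by push_cast; rw [mul_pow, h22, hqm]
  rw [expansionRem_eq (s := half₁ m) hq0 (by rw [card_half₁, hqm]),
    expansionRem_eq (s := half₂ m) hq0 (by rw [card_half₂, hqm]),
    expansionRem_eq (s := wholeSample (2 * m)) (q := √2 * q) (by positivity)
      (by rw [card_wholeSample, hn]),
    card_half₁, card_half₂, card_wholeSample, splitBias, hn, Real.sqrt_sq (by positivity),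
    A₁_wholeSample, A₂_eq, A₂_eq, A₂_eq, scaledSum_wholeSample, scaledSum_wholeSample, ← hq]
  have hdiv : ∀ p x a b c : ℝ, 0 < p →
      (p ^ 3 * x - p ^ 2 * a - p * b - c + c) * p⁻¹ = p ^ 2 * x - p * a - b := by
    intro p x a b c hp
    field_simp
    ring
  rw [hdiv _ _ _ _ _ hq0, hdiv _ _ _ _ _ hq0, hdiv _ _ _ _ _ (by positivity)]
  have h2i : (√2)⁻¹ = √2 / 2 := by rw [inv_eq_one_div, div_eq_div_iff h20.ne' two_ne_zero]; linarith
  rw [h2i]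
  generalize √2 = c at *
  linear_combination (1 / 2 * q ^ 2 * (θhat (half₁ m) ω + θhat (half₂ m) ω - 2 * M.θ₀)
    - 1 / 2 * q * (M.A₁ Z (half₁ m) ω + M.A₁ Z (half₂ m) ω)
    - 1 / 4 * (scaledSum Z M.X (half₁ m) ω + scaledSum Z M.X (half₂ m) ω)
      * (scaledSum Z M.Y (half₁ m) ω + scaledSum Z M.Y (half₂ m) ω)) * h22

lemma tendsto_half₁ : Tendsto half₁ atTop sampleFilter := by
  rw [tendsto_sampleFilter]
  simp only [card_half₁]
  exact tendsto_id

lemma tendsto_half₂ : Tendsto half₂ atTop sampleFilter := by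
  rw [tendsto_sampleFilter]
  simp only [card_half₂]
  exact tendsto_id

lemma tendsto_wholeSample : Tendsto wholeSample atTop sampleFilter := by
  rw [tendsto_sampleFilter]
  simp only [card_wholeSample]
  exact tendsto_id

lemma tendsto_wholeSample_two_mul :
    Tendsto (fun m => wholeSample (2 * m)) atTop sampleFilter :=
  tendsto_wholeSample.comp (tendsto_id.const_mul_atTop' two_pos)

/-- The cross-product form of the split-sample bias estimate is the product of the normalised
differences of the half-sample sums of `X` and `Y`. -/
noncomputable def biasProduct (M : ParametricModel 𝒵) (Z : ℕ → Ω → 𝒵) (m : ℕ) (ω : Ω) : ℝ :=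
  1 / 2 * ((scaledSum Z M.X (half₁ m) ω - scaledSum Z M.X (half₂ m) ω) *
    (scaledSum Z M.Y (half₁ m) ω - scaledSum Z M.Y (half₂ m) ω))

namespace Regular

variable [MeasurableSpace Ω] {μ : Measure Ω} {Z : ℕ → Ω → 𝒵}

lemma memLp_biasProduct (hM : M.Regular) (hI : IsIIDSample μ Z M.law) (m : ℕ) :
    MemLp (biasProduct M Z m) 3 μ := by
  have := hM.isProbabilityMeasure_law
  have hle : (6 : ENNReal) ≤ 16 := by norm_num
  have h : MemLp (fun ω => (scaledSum Z M.X (half₁ m) ω - scaledSum Z M.X (half₂ m) ω) *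
      (scaledSum Z M.Y (half₁ m) ω - scaledSum Z M.Y (half₂ m) ω)) 3 μ :=
    (hI.memLp_scaledSum_sub (hM.memLp_Y.mono_exponent hle) m).mul'
      (hI.memLp_scaledSum_sub (hM.memLp_X.mono_exponent hle) m)
  exact h.const_mul _

variable [IsProbabilityMeasure μ]

lemma isBigOp_X (hM : M.Regular) (hI : IsIIDSample μ Z M.law) :
    IsBigOp μ sampleFilter (fun s => scaledSum Z M.X s) :=
  have := hM.isProbabilityMeasure_law
  hI.isBigOp_scaledSum (hM.memLp_X.mono_exponent (by norm_num)) hM.integral_X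

lemma isBigOp_Y (hM : M.Regular) (hI : IsIIDSample μ Z M.law) :
    IsBigOp μ sampleFilter (fun s => scaledSum Z M.Y s) :=
  have := hM.isProbabilityMeasure_law
  hI.isBigOp_scaledSum (hM.memLp_Y.mono_exponent (by norm_num)) hM.integral_Y

lemma isBigOp_A₃ (hM : M.Regular) (hI : IsIIDSample μ Z M.law) :
    IsBigOp μ sampleFilter (fun s => M.A₃ Z s) := by
  have := hM.isProbabilityMeasure_law
  have hle : (2 : ENNReal) ≤ 16 := by norm_num
  have oU := hI.isBigOp_scaledSum (hM.memLp_U.mono_exponent hle) hM.integral_U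
  have oV := hI.isBigOp_scaledSum (hM.memLp_V.mono_exponent hle) hM.integral_V
  have oW := hI.isBigOp_scaledSum (hM.memLp_W.mono_exponent hle) hM.integral_W
  refine IsBigOp.congr (((((oU.pow 3).const_mul
    (1 / 6 * M.info⁻¹ ^ 4 * M.Q₂ + 1 / 2 * M.info⁻¹ ^ 5 * M.Q₁ ^ 2)).add
    (((oU.pow 2).mul oV).const_mul (3 / 2 * M.info⁻¹ ^ 4 * M.Q₁))).add
    (((oU.pow 2).mul oW).const_mul (1 / 2 * M.info⁻¹ ^ 3))).add
    ((oU.mul (oV.pow 2)).const_mul (M.info⁻¹ ^ 3))) fun s ω => ?_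
  simp only [A₃]
  ring

lemma tendstoInMeasure_splitBias_sub (hM : M.Regular) (hI : IsIIDSample μ Z M.law)
    {θhat : Finset ℕ → Ω → ℝ}
    (hθhat : ∀ s : Finset ℕ, s.Nonempty → M.IsMLE μ Z s (θhat s)) :
    TendstoInMeasure μ
      (fun m ω => (splitBias θhat m ω - M.b₀) -
        1 / 2 * (scaledSum Z M.X (half₁ m) ω * scaledSum Z M.Y (half₁ m) ω
          + scaledSum Z M.X (half₂ m) ω * scaledSum Z M.Y (half₂ m) ω - 2 * M.b₀
          - (scaledSum Z M.X (half₁ m) ω * scaledSum Z M.Y (half₂ m) ω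
            + scaledSum Z M.X (half₂ m) ω * scaledSum Z M.Y (half₁ m) ω)))
      atTop (fun _ => 0) := by
  have hrem : TendstoInMeasure μ (expansionRem M Z θhat) sampleFilter (fun _ => 0) :=
    hM.expansion_mle hI hθhat
  have hc : Tendsto (fun s : Finset ℕ => (√(s.card : ℝ))⁻¹) sampleFilter (𝓝 0) :=
    tendsto_sqrt_card.inv_tendsto_atTop
  have h0 := (hrem.isBigOp.add (hM.isBigOp_A₃ hI)).mul_tendsto
    (tendstoInMeasure_const_zero (μ := μ) hc)
  have h := ((h0.comp tendsto_half₁).add_tendsto_zero (h0.comp tendsto_half₂)).add_tendsto_zero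
    ((h0.comp tendsto_wholeSample_two_mul).const_mul_zero (-1))
  refine h.congr_zero ?_
  filter_upwards [eventually_ge_atTop 1] with m hm ω
  exact splitBias_sub_eq hm ω

/-- Third absolute moments of the centred bias product are bounded. -/
lemma exists_integral_biasProduct_sub_le (hM : M.Regular) (hI : IsIIDSample μ Z M.law) :
    ∃ C : ℝ, ∀ m : ℕ, 1 ≤ m →
      ∫ ω, |biasProduct M Z m ω - M.b₀| ^ 3 ∂μ ≤ C := by
  have := hM.isProbabilityMeasure_law
  have hle : (6 : ENNReal) ≤ 16 := by norm_num
  have hX := hM.memLp_X.mono_exponent hle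
  have hY := hM.memLp_Y.mono_exponent hle
  obtain ⟨C₁, h₁⟩ := hI.exists_integral_scaledSum_pow_six_le hX hM.integral_X
  obtain ⟨C₂, h₂⟩ := hI.exists_integral_scaledSum_pow_six_le hY hM.integral_Y
  have hint : ∀ {g : 𝒵 → ℝ}, MemLp g 6 M.law → ∀ s,
      HasMean μ (fun ω => scaledSum Z g s ω ^ 6) (∫ ω, scaledSum Z g s ω ^ 6 ∂μ) :=
    fun hg s => Integrable.hasMean
      (MemLp.integrable_pow_le (n := 6) (hI.memLp_scaledSum hg s) le_rfl)
  refine ⟨8 * (C₁ + C₁ + C₂ + C₂) + 4 * |M.b₀| ^ 3, fun m hm => ?_⟩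
  have hsum := (((((hint hX (half₁ m)).add (hint hX (half₂ m))).add (hint hY (half₁ m))).add
    (hint hY (half₂ m))).const_mul 8).add (Integrable.hasMean
      (integrable_const (μ := μ) (4 * |M.b₀| ^ 3)))
  have hD : MemLp (fun ω => biasProduct M Z m ω - M.b₀) (3 : ℕ) μ :=
    (hM.memLp_biasProduct hI m).sub (memLp_const _)
  have hpt : ∀ a b c d e : ℝ, |1 / 2 * ((a - b) * (c - d)) - e| ^ 3 ≤
      8 * (a ^ 6 + b ^ 6 + c ^ 6 + d ^ 6) + 4 * |e| ^ 3 := by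
    intro a b c d e
    have s1 : ∀ x y : ℝ, (x - y) ^ 6 ≤ 32 * (x ^ 6 + y ^ 6) := fun x y => by
      have := Even.add_pow_le (show Even 6 by decide) (a := x) (b := -y)
      norm_num [← sub_eq_add_neg, Even.neg_pow (show Even 6 by decide)] at this
      exact this
    have s2 : |1 / 2 * ((a - b) * (c - d)) - e| ^ 3 ≤
        4 * (|1 / 2 * ((a - b) * (c - d))| ^ 3 + |e| ^ 3) := by
      refine (pow_le_pow_left₀ (abs_nonneg _) (abs_sub _ _) 3).trans ?_
      have := add_pow_le (abs_nonneg (1 / 2 * ((a - b) * (c - d)))) (abs_nonneg e) 3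
      norm_num at this ⊢
      exact this
    have s3 : |1 / 2 * ((a - b) * (c - d))| ^ 3 ≤ 1 / 16 * ((a - b) ^ 6 + (c - d) ^ 6) := by
      rw [abs_mul, abs_mul, abs_of_pos (show (0 : ℝ) < 1 / 2 by norm_num), mul_pow, mul_pow]
      have e1 : (a - b) ^ 6 = (|a - b| ^ 3) ^ 2 := by
        rw [← pow_mul, Even.pow_abs (by decide)]
      have e2 : (c - d) ^ 6 = (|c - d| ^ 3) ^ 2 := by
        rw [← pow_mul, Even.pow_abs (by decide)]
      rw [e1, e2]
      nlinarith [sq_nonneg (|a - b| ^ 3 - |c - d| ^ 3)]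
    linarith [s1 a b, s1 c d]
  calc ∫ ω, |biasProduct M Z m ω - M.b₀| ^ 3 ∂μ
      ≤ _ := integral_mono (by simpa using hD.integrable_norm_pow (by norm_num)) hsum.1
        fun ω => hpt _ _ _ _ _
    _ = _ := hsum.2
    _ ≤ _ := by
      simp only [integral_const, probReal_univ, one_smul]
      linarith [h₁ _ (nonempty_half₁ hm), h₁ _ (nonempty_half₂ hm), h₂ _ (nonempty_half₁ hm),
        h₂ _ (nonempty_half₂ hm)]

lemma integral_biasProduct (hM : M.Regular) (hI : IsIIDSample μ Z M.law) {m : ℕ} (hm : 1 ≤ m) :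
    HasMean μ (biasProduct M Z m) M.b₀ := by
  have := hM.isProbabilityMeasure_law
  have hind := hM.indepFun_XY hI m
  have X0 := hI.integral_scaledSum (hM.memLp_X.integrable (by norm_num)) hM.integral_X
  have Y0 := hI.integral_scaledSum (hM.memLp_Y.integrable (by norm_num)) hM.integral_Y
  have e1 := IndepFun.hasMean_mul hind (φ := fun x => x 0) (ψ := fun x => x 1)
    (by fun_prop) (by fun_prop) (X0 _) (Y0 _)
  have e2 := IndepFun.hasMean_mul hind (φ := fun x => x 1) (ψ := fun x => x 0)
    (by fun_prop) (by fun_prop) (Y0 _) (X0 _)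
  refine ((((hM.integral_XY hI (nonempty_half₁ hm)).add
    (hM.integral_XY hI (nonempty_half₂ hm))).const_mul (1 / 2)).add
      ((e1.add e2).const_mul (-1 / 2))).congr (fun ω => ?_) (by ring)
  simp only [biasProduct, Matrix.cons_val]
  ring

/-- The variance of the bias product is `Υ` up to a term of order `1 / n`. -/
lemma integral_biasProduct_sub_sq (hM : M.Regular) (hI : IsIIDSample μ Z M.law) :
    ∃ K : ℝ, ∀ m : ℕ, 1 ≤ m →
      ∫ ω, (biasProduct M Z m ω - M.b₀) ^ 2 ∂μ = M.Upsilon + K / ((2 * m : ℕ) : ℝ) := by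
  have := hM.isProbabilityMeasure_law
  have hle : (4 : ENNReal) ≤ 16 := by norm_num
  have hX := hM.memLp_X.mono_exponent hle
  have hY := hM.memLp_Y.mono_exponent hle
  refine ⟨(∫ z, M.X z * M.Y z * (M.X z * M.Y z) ∂M.law) -
    (M.b₀ * M.b₀ + M.info⁻¹ * (∫ z, M.Y z * M.Y z ∂M.law) + M.b₀ * M.b₀), fun m hm => ?_⟩
  set ε : ℕ → ℝ := fun i => if i < m then 1 else -1 with hε
  have hε1 : ∀ i, ε i * ε i = 1 := fun i => by simp only [hε]; split_ifs <;> norm_num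
  have hsq := hI.integral_signed_prod_four hX hY hX hY hM.integral_X hM.integral_Y hM.integral_X
    hM.integral_Y ε hε1 (nonempty_wholeSample (show 1 ≤ 2 * m by omega))
  have hsigned : ∀ (g : 𝒵 → ℝ) (ω : Ω), (√((wholeSample (2 * m)).card : ℝ))⁻¹ *
      ∑ i ∈ wholeSample (2 * m), ε i * g (Z i ω) =
        (√2)⁻¹ * (scaledSum Z g (half₁ m) ω - scaledSum Z g (half₂ m) ω) := fun g ω => by
    have h1 : ∑ i ∈ half₁ m, ε i * g (Z i ω) = ∑ i ∈ half₁ m, g (Z i ω) :=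
      Finset.sum_congr rfl fun i hi => by
        simp only [hε, half₁, Finset.mem_range] at hi ⊢
        rw [if_pos hi, one_mul]
    have h2 : ∑ i ∈ half₂ m, ε i * g (Z i ω) = -∑ i ∈ half₂ m, g (Z i ω) := by
      rw [← Finset.sum_neg_distrib]
      refine Finset.sum_congr rfl fun i hi => ?_
      simp only [hε, half₂, Finset.mem_Ico] at hi ⊢
      rw [if_neg (by omega), neg_one_mul]
    rw [sum_wholeSample, h1, h2, card_wholeSample, sqrt_two_mul_cast]
    simp only [scaledSum, card_half₁, card_half₂, mul_inv]
    ring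
  simp only [hsigned] at hsq
  rw [card_wholeSample] at hsq
  have h2 : (√2)⁻¹ * (√2)⁻¹ = (1 / 2 : ℝ) := by
    rw [← mul_inv, Real.mul_self_sqrt (by norm_num)]; norm_num
  have hD := hM.integral_biasProduct hI hm
  have hYX : ∫ z, M.Y z * M.X z ∂M.law = M.b₀ := by
    rw [← hM.integral_X_mul_Y]; simp only [mul_comm]
  refine HasMean.eq (((hsq.add (hD.const_mul (-2 * M.b₀))).add
    (Integrable.hasMean (integrable_const (M.b₀ ^ 2)))).congr (fun ω => ?_) ?_)
  · simp only [biasProduct]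
    generalize (√2)⁻¹ = c at h2
    linear_combination (-((scaledSum Z M.X (half₁ m) ω - scaledSum Z M.X (half₂ m) ω) *
      (scaledSum Z M.Y (half₁ m) ω - scaledSum Z M.Y (half₂ m) ω)) ^ 2 * (c * c + 1 / 2)) * h2
  · rw [hM.integral_X_sq, hM.integral_X_mul_Y, hYX, hM.upsilon_eq]
    simp only [integral_const, probReal_univ, one_smul]
    ring

end Regular
end ParametricModel

/-! ### The expansions, inconsistency and the higher-order variance -/

namespace ParametricModel.Regular

variable {𝒵 Ω : Type*} [MeasurableSpace 𝒵] [MeasurableSpace Ω] {M : ParametricModel 𝒵}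
  {μ : Measure Ω} [IsProbabilityMeasure μ] {Z : ℕ → Ω → 𝒵} {θhat : Finset ℕ → Ω → ℝ}

lemma hasThirdOrderExpansion_mle (hM : M.Regular) (hI : IsIIDSample μ Z M.law)
    (hθhat : ∀ s : Finset ℕ, s.Nonempty → M.IsMLE μ Z s (θhat s)) :
    HasThirdOrderExpansion μ (fun n => n) (fun n => θhat (wholeSample n)) M.θ₀
      (fun n => M.A₁ Z (wholeSample n)) (fun n => M.A₂ Z (wholeSample n))
      (fun n => M.A₃ Z (wholeSample n)) := by
  have h := (hM.expansion_mle hI hθhat).comp tendsto_wholeSample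
  simp only [Function.comp_def, card_wholeSample] at h
  exact h

lemma hasThirdOrderExpansion_split (hM : M.Regular) (hI : IsIIDSample μ Z M.law)
    (hθhat : ∀ s : Finset ℕ, s.Nonempty → M.IsMLE μ Z s (θhat s)) :
    HasThirdOrderExpansion μ (fun m => 2 * m) (splitEstimator θhat) M.θ₀
      (fun m => M.A₁ Z (wholeSample (2 * m))) (M.A₂SS Z) (M.A₃SS Z) := by
  have hrem : TendstoInMeasure μ (expansionRem M Z θhat) sampleFilter (fun _ => 0) :=
    hM.expansion_mle hI hθhat
  have h := ((hrem.comp tendsto_wholeSample_two_mul).const_mul_zero 2).add_tendsto_zero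
    (((hrem.comp tendsto_half₁).add_tendsto_zero (hrem.comp tendsto_half₂)).const_mul_zero (-√2))
  refine h.congr_zero ?_
  filter_upwards [eventually_ge_atTop 1] with m hm ω
  exact splitEstimator_rem_eq hm ω

lemma boundedInProbability_splitBias_sub (hM : M.Regular) (hI : IsIIDSample μ Z M.law)
    (hθhat : ∀ s : Finset ℕ, s.Nonempty → M.IsMLE μ Z s (θhat s)) :
    BoundedInProbability μ (fun m ω => splitBias θhat m ω - M.b₀) := by
  have oX := hM.isBigOp_X hI
  have oY := hM.isBigOp_Y hI
  have x1 := oX.comp tendsto_half₁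
  have x2 := oX.comp tendsto_half₂
  have y1 := oY.comp tendsto_half₁
  have y2 := oY.comp tendsto_half₂
  have hmain := ((((x1.mul y1).add (x2.mul y2)).add (IsBigOp.const (-2 * M.b₀))).add
    (((x1.mul y2).add (x2.mul y1)).const_mul (-1))).const_mul (1 / 2)
  have h := (hM.tendstoInMeasure_splitBias_sub hI hθhat).isBigOp.add hmain
  refine IsBigOp.congr (L := atTop) h fun m ω => ?_
  ring

/-- Inconsistency of the split-sample bias estimate: were it consistent, the bias product would
converge to `b₀` in probability, hence in mean square, whereas its variance tends to `Υ`. -/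
lemma not_tendstoInMeasure_splitBias (hM : M.Regular) (hI : IsIIDSample μ Z M.law)
    (hθhat : ∀ s : Finset ℕ, s.Nonempty → M.IsMLE μ Z s (θhat s)) (hΥ : 0 < M.Upsilon) :
    ¬ TendstoInMeasure μ (splitBias θhat) atTop (fun _ => M.b₀) := by
  intro hcons
  rw [tendstoInMeasure_sub_iff] at hcons
  have hD : TendstoInMeasure μ (fun m ω => biasProduct M Z m ω - M.b₀) atTop (fun _ => 0) := by
    refine (hcons.add_tendsto_zero
      ((hM.tendstoInMeasure_splitBias_sub hI hθhat).const_mul_zero (-1))).congr_zero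
      (Eventually.of_forall fun m ω => ?_)
    rw [biasProduct]
    ring
  obtain ⟨C, hC⟩ := hM.exists_integral_biasProduct_sub_le hI
  obtain ⟨K, hK⟩ := hM.integral_biasProduct_sub_sq hI
  have hL3 : ∀ m, MemLp (fun ω => biasProduct M Z m ω - M.b₀) (3 : ℕ) μ := fun m =>
    (hM.memLp_biasProduct hI m).sub (memLp_const _)
  have h0 := hD.tendsto_integral_sq (C := C)
    (Eventually.of_forall fun m => (hL3 m).mono_exponent (by norm_num))
    (Eventually.of_forall fun m => by
      simpa using (hL3 m).integrable_norm_pow (by norm_num))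
    ((eventually_ge_atTop 1).mono hC)
  have h1 : Tendsto (fun m : ℕ => M.Upsilon + K / ((2 * m : ℕ) : ℝ)) atTop
      (𝓝 (M.Upsilon + 0)) :=
    tendsto_const_nhds.add ((tendsto_const_nhds.div_atTop tendsto_natCast_atTop_atTop).comp
      (tendsto_id.const_mul_atTop' two_pos))
  have h2 := h0.congr' ((eventually_ge_atTop 1).mono hK)
  linarith [tendsto_nhds_unique h1 h2]

lemma exists_abs_higherOrderVariance_sub_le (hM : M.Regular) (hI : IsIIDSample μ Z M.law) :
    ∃ C : ℝ, ∀ m : ℕ, 1 ≤ m →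
      |(variance (M.A₁ Z (wholeSample (2 * m))) μ
          + higherOrderVariance μ (2 * m) (M.A₁ Z (wholeSample (2 * m))) (M.A₂SS Z m)
              (M.A₃SS Z m) / ((2 * m : ℕ) : ℝ))
        - (M.info⁻¹ + 2 / ((2 * m : ℕ) : ℝ) * M.Upsilon)| ≤ C / ((2 * m : ℕ) : ℝ) ^ 2 := by
  obtain ⟨K, hK⟩ := hM.integral_A₁_mul_A₃SS hI
  refine ⟨4 * |K|, fun m hm => le_of_eq ?_⟩
  have hm0 : (0 : ℝ) < m := by exact_mod_cast hm
  rw [hM.variance_A₁ hI (nonempty_wholeSample (by omega)), higherOrderVariance,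
    hM.variance_A₂SS hI hm, hM.integral_A₁_mul_A₂SS hI hm, hK m hm]
  have h : M.info⁻¹ + (2 * M.Upsilon + 2 * √((2 * m : ℕ) : ℝ) * 0 + 2 * (K / m)) /
      ((2 * m : ℕ) : ℝ) - (M.info⁻¹ + 2 / ((2 * m : ℕ) : ℝ) * M.Upsilon) =
      4 * K / ((2 * m : ℕ) : ℝ) ^ 2 := by
    push_cast
    field_simp
    ring
  rw [h, abs_div, abs_mul, abs_of_pos (show (0 : ℝ) < 4 by norm_num),
    abs_of_nonneg (sq_nonneg ((2 * m : ℕ) : ℝ))]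

end ParametricModel.Regular

theorem mainTheorem3 {𝒵 Ω : Type*} [MeasurableSpace 𝒵] [MeasurableSpace Ω]
    (M : ParametricModel 𝒵) (hM : M.Regular)
    (μ : Measure Ω) [IsProbabilityMeasure μ]
    (Z : ℕ → Ω → 𝒵) (hZ : ∀ i, Measurable (Z i)) (hindep : iIndepFun Z μ)
    (hlaw : ∀ i, μ.map (Z i) = M.law)
    (θhat : Finset ℕ → Ω → ℝ)
    (hθhat : ∀ s : Finset ℕ, s.Nonempty → M.IsMLE μ Z s (θhat s)) :
    -- the maximum likelihood estimator has the expansion with terms `A₁, A₂, A₃`,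
    -- and `b₀ = E[A₂]`
    HasThirdOrderExpansion μ (fun n => n) (fun n => θhat (wholeSample n)) M.θ₀
        (fun n => M.A₁ Z (wholeSample n)) (fun n => M.A₂ Z (wholeSample n))
        (fun n => M.A₃ Z (wholeSample n)) ∧
    (∀ n : ℕ, 1 ≤ n → Integrable (M.A₂ Z (wholeSample n)) μ ∧
        ∫ ω, M.A₂ Z (wholeSample n) ω ∂μ = M.b₀) ∧
    -- half-sample cross-product form of the split-sample bias estimate, up to `o_p(1)`
    TendstoInMeasure μ
      (fun m ω => (splitBias θhat m ω - M.b₀) -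
        1 / 2 * (scaledSum Z M.X (half₁ m) ω * scaledSum Z M.Y (half₁ m) ω
          + scaledSum Z M.X (half₂ m) ω * scaledSum Z M.Y (half₂ m) ω - 2 * M.b₀
          - (scaledSum Z M.X (half₁ m) ω * scaledSum Z M.Y (half₂ m) ω
            + scaledSum Z M.X (half₂ m) ω * scaledSum Z M.Y (half₁ m) ω)))
      atTop (fun _ => 0) ∧
    -- it is `O_p(1)`, and inconsistent whenever `Υ > 0`
    BoundedInProbability μ (fun m ω => splitBias θhat m ω - M.b₀) ∧
    (0 < M.Upsilon → ¬ TendstoInMeasure μ (splitBias θhat) atTop (fun _ => M.b₀)) ∧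
    -- the third-order expansion of the split-sample estimator
    HasThirdOrderExpansion μ (fun m => 2 * m) (splitEstimator θhat) M.θ₀
        (fun m => M.A₁ Z (wholeSample (2 * m))) (M.A₂SS Z) (M.A₃SS Z) ∧
    -- its higher-order variance is `𝓘⁻¹ + (2 / n) Υ`, up to `O(n⁻²)`, where `n = 2m`
    (∀ m : ℕ, 1 ≤ m → MemLp (M.A₁ Z (wholeSample (2 * m))) 2 μ ∧ MemLp (M.A₂SS Z m) 2 μ ∧
        MemLp (M.A₃SS Z m) 2 μ ∧
        variance (M.A₁ Z (wholeSample (2 * m))) μ = M.info⁻¹) ∧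
    (∃ C : ℝ, ∀ m : ℕ, 1 ≤ m →
        |(variance (M.A₁ Z (wholeSample (2 * m))) μ
            + higherOrderVariance μ (2 * m) (M.A₁ Z (wholeSample (2 * m))) (M.A₂SS Z m)
                (M.A₃SS Z m) / ((2 * m : ℕ) : ℝ))
          - (M.info⁻¹ + 2 / ((2 * m : ℕ) : ℝ) * M.Upsilon)| ≤ C / ((2 * m : ℕ) : ℝ) ^ 2) := by
  have hI : IsIIDSample μ Z M.law := ⟨hZ, hindep, hlaw⟩
  exact ⟨hM.hasThirdOrderExpansion_mle hI hθhat,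
    fun n hn => hM.integral_A₂ hI (nonempty_wholeSample hn),
    hM.tendstoInMeasure_splitBias_sub hI hθhat, hM.boundedInProbability_splitBias_sub hI hθhat,
    hM.not_tendstoInMeasure_splitBias hI hθhat, hM.hasThirdOrderExpansion_split hI hθhat,
    fun m hm => ⟨hM.memLp_A₁ hI _, hM.memLp_A₂SS hI m, hM.memLp_A₃SS hI m,
      hM.variance_A₁ hI (nonempty_wholeSample (by omega))⟩,
    hM.exists_abs_higherOrderVariance_sub_le hI⟩
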